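/- **Setting.** Let $T>0$, $n_e\in\mathbb N$, $\Omega=\,]0,1[$, with $(\cdot,\cdot)$ and $\|\cdot\|$ the inner product and norm of $L_2(\Omega)$. Let $\alpha,\beta\in C^2([0,T])$, $\gamma=\beta-\alpha$ with $0<\gamma_0<\gamma(t)<\gamma_1<\infty$ on $[0,T]$, $|\alpha'|\le\alpha'_{\max}$, $|\gamma'|\le\gamma'_{\max}$, and put $$b_1(y,t)=\frac{\alpha'(t)+\gamma'(t)y}{\gamma(t)},\qquad b_2(t)=\frac1{\gamma(t)^2},\qquad l(v)(t)=\gamma(t)\int_0^1 v\,dy .$$ Let $a_i:\mathbb R^{n_e}\to\mathbb R$ be Lipschitz continuous with constant $L$ and $0<m_a\le a_i\le M_a$, $g_i(\cdot,t)\in L_2(\Omega)$ for $0<t<T$, and $v_{i0}\in H^1_0(\Omega)$, $i=1,\dots,n_e$. A weak solution is $\mathbf v=(v_1,\dots,v_{n_e})$ with $v_i\in L_\infty(0,T;H^1_0(\Omega)\cap H^2(\Omega))$, $\partial_t v_i\in L_2(0,T;L_2(\Omega))$, $v_i(\cdot,0)=v_{i0}$ and, for all $t\in\,]0,T[$ and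 $w\in H_0^1(\Omega)$, $$(\partial_t v_i,w)+a_i(l(v_1),\dots,l(v_{n_e}))\,b_2\,(\partial_y v_i,\partial_y w)-(b_1\partial_y v_i,w)=(g_i,w).$$ **Scheme.** Let $k\ge1$. Let $S_h^k$ be the space of continuous functions on $[0,1]$ that vanish at $0$ and $1$ and are polynomials of degree at most $k$ on each interval of a partition of $\Omega$ into finitely many intervals, the largest of length $h$. Let $I_h$ be Lagrange interpolation into $S_h^k$ at $k+1$ distinct points of each closed interval of the partition, both end points included. Let $\delta=T/N$ with an integer $N\ge1$, and $t_n=n\delta$. An upper index $n-\frac12$ means evaluation at $t_{n-1/2}=(n-\frac12)\delta$ (in $l$, too, $\gamma$ is taken there). Write $\bar\partial V^{(n)}=(V^{(n)}-V^{(n-1)})/\delta$, $\hat V^{(n)}=\frac12(V^{(n)}+V^{(n-1)})$ and $\bar V^{(n)}=\frac32V^{(n-1)}-\frac12V^{(n-2)}$. Let $V_i^{(n)},V_i^{(1,0)}\in S_h^k$ satisfy $V_i^{(0)}=I_hv_{i0}$ and, for all $W\in S_h^k$ and all $i$, for $2\le n\le N$ $$(\bar\partial V_i^{(n)},W)+a_i\big(l(\bar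 V_1^{(n)}),\dots,l(\bar V_{n_e}^{(n)})\big)b_2^{(n-\frac12)}(\partial_y\hat V_i^{(n)},\partial_yW)-(b_1^{(n-\frac12)}\partial_y\hat V_i^{(n)},W)=(g_i^{(n-\frac12)},W),$$ while $V^{(1)}$ is obtained from the predictor $$\Big(\tfrac{V_i^{(1,0)}-V_i^{(0)}}{\delta},W\Big)+a_i\big(l(V_1^{(0)}),\dots,l(V_{n_e}^{(0)})\big)b_2^{(\frac12)}\Big(\partial_y\tfrac{V_i^{(1,0)}+V_i^{(0)}}2,\partial_yW\Big)-\Big(b_1^{(\frac12)}\partial_y\tfrac{V_i^{(1,0)}+V_i^{(0)}}2,W\Big)=(g_i^{(\frac12)},W)$$ and the corrector $$(\bar\partial V_i^{(1)},W)+a_i\Big(l\big(\tfrac{V_1^{(1,0)}+V_1^{(0)}}2\big),\dots,l\big(\tfrac{V_{n_e}^{(1,0)}+V_{n_e}^{(0)}}2\big)\Big)b_2^{(\frac12)}(\partial_y\hat V_i^{(1)},\partial_yW)-(b_1^{(\frac12)}\partial_y\hat V_i^{(1)},W)=(g_i^{(\frac12)},W).$$ **Theorem.** Suppose that the weak solution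 $\mathbf v$ satisfies $v_i,\partial_tv_i\in L_\infty(0,T;H^{k+1}(\Omega))$ and $\partial_t^2v_i,\ \partial_t^3v_i,\ \partial_y\partial_t^2v_i\in L_\infty(0,T;L_2(\Omega))$. Then there are $C>0$ and $\delta_0>0$ such that, whenever $\delta\le\delta_0$, $$\|V_i^{(n)}-v_i(\cdot,t_n)\|\le C\,(h^{k+1}+\delta^2),\qquad n=1,\dots,N,\quad i=1,\dots,n_e .$$ Here $C$ and $\delta_0$ do not depend on $h$, $k$, $\delta$, the partition or the interpolation points; they depend only on $n_e,T,L,m_a,M_a,\gamma_0,\gamma_1,\gamma'_{\max},\alpha'_{\max}$ and on an upper bound for the norms of $v_i,\partial_tv_i$ in $L_\infty(0,T;H^{k+1}(\Omega))$ and of $\partial_t^2v_i,\partial_t^3v_i,\partial_y\partial_t^2v_i$ in $L_\infty(0,T;L_2(\Omega))$. -/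

import Mathlib

open MeasureTheory Set
open scoped ContDiff NNReal Polynomial

noncomputable section

namespace NonlocalFEM

/-! ### Lebesgue and Sobolev spaces on the reference interval `Ω = ]0,1[` -/

/-- Lebesgue measure on `Ω = ]0,1[`. -/
abbrev μΩ : Measure ℝ := volume.restrict (Ioo (0 : ℝ) 1)

/-- The Hilbert space `L₂(Ω)`. -/
abbrev L2Ω : Type := Lp ℝ 2 μΩ

/-- The inner product `(f, g) = ∫₀¹ f g dy`. -/
def ip (f g : ℝ → ℝ) : ℝ := ∫ y, f y * g y ∂μΩ

/-- The norm `‖f‖ = (f, f)^{1/2}`. -/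
def nrm (f : ℝ → ℝ) : ℝ := √(ip f f)

/-- `u'` is the weak derivative of `u` in `Ω` (used for `u`, `u'` in `L₂(Ω)` only). -/
def IsWeakDeriv (u u' : ℝ → ℝ) : Prop :=
  ∀ φ : ℝ → ℝ, ContDiff ℝ ∞ φ → HasCompactSupport φ → tsupport φ ⊆ Ioo (0 : ℝ) 1 →
    ∫ y, u y * deriv φ y ∂μΩ = - ∫ y, u' y * φ y ∂μΩ

/-- `u ∈ H^m(Ω)` and `‖u‖_{H^m} ≤ R`, where `‖u‖²_{H^m}` is the sum of the squared `L₂` norms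
of the weak derivatives of orders `0, …, m`. -/
def HNormLE (m : ℕ) (u : L2Ω) (R : ℝ) : Prop :=
  ∃ D : ℕ → L2Ω, D 0 = u ∧ (∀ j < m, IsWeakDeriv (D j) (D (j + 1))) ∧
    √(∑ j ∈ Finset.range (m + 1), ‖D j‖ ^ 2) ≤ R

/-- `u` is (the continuous representative of) an element of `H¹₀(Ω)`, with weak derivative `u'`. -/
structure MemH10 (u u' : ℝ → ℝ) : Prop where
  cont : ContinuousOn u (Icc 0 1)
  left : u 0 = 0
  right : u 1 = 0
  memLp : MemLp u' 2 μΩ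
  weak : IsWeakDeriv u u'

/-! ### Functions of time with values in `L₂(Ω)` -/

/-- `u ∈ C([0,T]; L₂(Ω))` is absolutely continuous with `∂u/∂t = w ∈ L₁(0,T; L₂(Ω))`. -/
def IsTimeDeriv (T : ℝ) (u w : ℝ → L2Ω) : Prop :=
  IntervalIntegrable w volume 0 T ∧ ∀ t ∈ Icc 0 T, u t = u 0 + ∫ s in (0 : ℝ)..t, w s

/-- `‖u‖_{L_∞(0,T; H^m(Ω))} ≤ R`. -/
def LInftyHNormLE (T : ℝ) (m : ℕ) (u : ℝ → L2Ω) (R : ℝ) : Prop :=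
  ∀ᵐ t ∂(volume.restrict (Ioo 0 T)), HNormLE m (u t) R

/-! ### The continuous problem -/

/-- The data of the problem: the lateral boundaries `α`, `β`, the diffusion coefficients `a i`,
the right-hand sides `g i t y` and the initial values `v₀ i y`. -/
structure Problem (ne : ℕ) where
  α : ℝ → ℝ
  β : ℝ → ℝ
  a : Fin ne → (Fin ne → ℝ) → ℝ
  g : Fin ne → ℝ → ℝ → ℝ
  v₀ : Fin ne → ℝ → ℝ

namespace Problem

variable {ne : ℕ}

/-- `γ = β - α`. -/
def γ (P : Problem ne) (t : ℝ) : ℝ := P.β t - P.α t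

/-- `b₁(y,t) = (α'(t) + γ'(t) y) / γ(t)`. -/
def b₁ (P : Problem ne) (t y : ℝ) : ℝ := (deriv P.α t + deriv P.γ t * y) / P.γ t

/-- `b₂(t) = 1 / γ(t)²`. -/
def b₂ (P : Problem ne) (t : ℝ) : ℝ := 1 / (P.γ t) ^ 2

/-- `l(v) = γ(t) ∫₀¹ v dy`. -/
def l (P : Problem ne) (t : ℝ) (v : ℝ → ℝ) : ℝ := P.γ t * ∫ y, v y ∂μΩ

/-- The diffusion coefficient `a_i(l(u₁), …, l(u_{nₑ}))` at time `t`. -/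
def coeff (P : Problem ne) (i : Fin ne) (t : ℝ) (u : Fin ne → ℝ → ℝ) : ℝ :=
  P.a i (fun j => P.l t (u j))

/-- The variational identity at time `t` for the `i`-th equation, with diffusion coefficient `A`:
`(ut, w) + A b₂(t) (uy, wy) - (b₁(·,t) uy, w) = (g_i(·,t), w)`. -/
def VarEq (P : Problem ne) (i : Fin ne) (t A : ℝ) (ut uy w wy : ℝ → ℝ) : Prop :=
  ip ut w + A * P.b₂ t * ip uy wy - ip (fun y => P.b₁ t y * uy y) w = ip (P.g i t) w

/-- The standing assumptions on the data, with the constants that quantify them. -/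
structure Admissible (P : Problem ne) (T γ₀ γ₁ ma Ma : ℝ) (La : ℝ≥0) (αmax γmax : ℝ) : Prop where
  smooth_α : ContDiffOn ℝ 2 P.α (Icc 0 T)
  smooth_β : ContDiffOn ℝ 2 P.β (Icc 0 T)
  γ_bounds : ∀ t ∈ Icc 0 T, γ₀ < P.γ t ∧ P.γ t < γ₁
  α_speed : ∀ t ∈ Ioo 0 T, |deriv P.α t| ≤ αmax
  γ_speed : ∀ t ∈ Ioo 0 T, |deriv P.γ t| ≤ γmax
  a_lip : ∀ i, LipschitzWith La (P.a i)
  a_bounds : ∀ i s, ma ≤ P.a i s ∧ P.a i s ≤ Ma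
  g_memLp : ∀ i, ∀ t ∈ Ioo 0 T, MemLp (P.g i t) 2 μΩ
  v₀_mem : ∀ i, ∃ dv₀, MemH10 (P.v₀ i) dv₀

/-- `v` is a weak solution on `[0,T]`, with time derivative `vt`. -/
structure IsWeakSolution (P : Problem ne) (T : ℝ) (v vt : Fin ne → ℝ → L2Ω) : Prop where
  bdd : ∀ i, ∃ R, LInftyHNormLE T 2 (v i) R
  timeDeriv : ∀ i, IsTimeDeriv T (v i) (vt i)
  timeDeriv_sq : ∀ i, MemLp (vt i) 2 (volume.restrict (Ioo 0 T))
  eqn : ∀ i, ∀ t ∈ Ioo 0 T, ∃ u uy : ℝ → ℝ, v i t =ᵐ[μΩ] u ∧ MemH10 u uy ∧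
    ∀ w wy : ℝ → ℝ, MemH10 w wy →
      P.VarEq i t (P.coeff i t (fun j => v j t)) (vt i t) uy w wy
  init : ∀ i, v i 0 =ᵐ[μΩ] P.v₀ i

end Problem

/-- `vt, vtt, vttt` are the first three time derivatives of `v`, and
`‖v‖_{L_∞(H^{k+1})}`, `‖∂v/∂t‖_{L_∞(H^{k+1})}`, `‖∂²v/∂t²‖_{L_∞(L₂)}`, `‖∂³v/∂t³‖_{L_∞(L₂)}`,
`‖∂³v/∂y∂t²‖_{L_∞(L₂)}` are at most `R`. -/
structure RegularityBound {ne : ℕ} (T : ℝ) (k : ℕ) (R : ℝ)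
    (v vt vtt vttt : Fin ne → ℝ → L2Ω) : Prop where
  deriv1 : ∀ i, IsTimeDeriv T (v i) (vt i)
  deriv2 : ∀ i, IsTimeDeriv T (vt i) (vtt i)
  deriv3 : ∀ i, IsTimeDeriv T (vtt i) (vttt i)
  bound_v : ∀ i, LInftyHNormLE T (k + 1) (v i) R
  bound_vt : ∀ i, LInftyHNormLE T (k + 1) (vt i) R
  bound_vtt : ∀ i, ∀ᵐ t ∂(volume.restrict (Ioo 0 T)), ‖vtt i t‖ ≤ R
  bound_vttt : ∀ i, ∀ᵐ t ∂(volume.restrict (Ioo 0 T)), ‖vttt i t‖ ≤ R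
  bound_vytt : ∀ i, ∀ᵐ t ∂(volume.restrict (Ioo 0 T)),
    ∃ d : L2Ω, IsWeakDeriv (vtt i t) d ∧ ‖d‖ ≤ R

/-! ### Finite elements -/

/-- A partition `0 = x₀ < x₁ < ⋯ < x_{nt} = 1` of `Ω` into `nt ≥ 1` intervals. -/
structure Mesh where
  nt : ℕ
  nt_pos : 0 < nt
  x : ℕ → ℝ
  x_zero : x 0 = 0
  x_last : x nt = 1
  x_lt : ∀ j < nt, x j < x (j + 1)

/-- The mesh size `h`: the largest length of an interval of the partition. -/
def Mesh.h (M : Mesh) : ℝ :=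
  (Finset.range M.nt).sup' ⟨0, Finset.mem_range.2 M.nt_pos⟩ (fun j => M.x (j + 1) - M.x j)

/-- `W ∈ S_h^k`: `W` is continuous on `[0,1]`, vanishes at `0` and `1`, and is a polynomial of
degree at most `k` on each interval of the partition. -/
structure MemS (M : Mesh) (k : ℕ) (W : ℝ → ℝ) : Prop where
  cont : ContinuousOn W (Icc 0 1)
  left : W 0 = 0
  right : W 1 = 0
  poly : ∀ j < M.nt, ∃ p : ℝ[X], p.natDegree ≤ k ∧
    ∀ y ∈ Icc (M.x j) (M.x (j + 1)), W y = p.eval y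

/-- Lagrange points for degree `k`: `k + 1` points
`x_j = pt j 0 < pt j 1 < ⋯ < pt j k = x_{j+1}` in each interval. -/
structure LagrangePoints (M : Mesh) (k : ℕ) where
  pt : ℕ → ℕ → ℝ
  first : ∀ j < M.nt, pt j 0 = M.x j
  last : ∀ j < M.nt, pt j k = M.x (j + 1)
  lt : ∀ j < M.nt, ∀ r < k, pt j r < pt j (r + 1)

/-- `I` is the interpolant `I_h u`: the element of `S_h^k` which coincides with `u` at the
Lagrange points. -/
def IsInterpolant {M : Mesh} {k : ℕ} (ξ : LagrangePoints M k) (u I : ℝ → ℝ) : Prop :=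
  MemS M k I ∧ ∀ j < M.nt, ∀ r ≤ k, I (ξ.pt j r) = u (ξ.pt j r)

/-! ### The linearised Crank–Nicolson scheme -/

/-- `(U - U') / δ`. -/
def diffQ (δ : ℝ) (U U' : ℝ → ℝ) : ℝ → ℝ := fun y => (U y - U' y) / δ

/-- `(U + U') / 2`. -/
def avg (U U' : ℝ → ℝ) : ℝ → ℝ := fun y => (U y + U' y) / 2

/-- `(3/2) U - (1/2) U'`. -/
def extrap (U U' : ℝ → ℝ) : ℝ → ℝ := fun y => 3 / 2 * U y - 1 / 2 * U' y

/-- One (linear) Crank–Nicolson step of length `δ` for the `i`-th equation, from `U'` to `U`, with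
midpoint `t` and with diffusion coefficient `a_i(l(Z₁), …, l(Z_{nₑ}))`. -/
def CNStep {ne : ℕ} (P : Problem ne) (M : Mesh) (k : ℕ) (δ t : ℝ) (i : Fin ne)
    (Z : Fin ne → ℝ → ℝ) (U' U : ℝ → ℝ) : Prop :=
  ∀ W, MemS M k W →
    P.VarEq i t (P.coeff i t Z) (diffQ δ U U') (deriv (avg U U')) W (deriv W)

/-- `V n i` (`0 ≤ n ≤ N`) and the predictor `Vp i` solve the linearised Crank–Nicolson scheme
with `N` time steps of length `δ`. -/
structure IsLinearisedCN {ne : ℕ} (P : Problem ne) {M : Mesh} {k : ℕ} (ξ : LagrangePoints M k)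
    (N : ℕ) (δ : ℝ) (V : ℕ → Fin ne → ℝ → ℝ) (Vp : Fin ne → ℝ → ℝ) : Prop where
  mem : ∀ n ≤ N, ∀ i, MemS M k (V n i)
  mem_pred : ∀ i, MemS M k (Vp i)
  init : ∀ i, IsInterpolant ξ (P.v₀ i) (V 0 i)
  predictor : ∀ i, CNStep P M k δ (δ / 2) i (V 0) (V 0 i) (Vp i)
  corrector : ∀ i, CNStep P M k δ (δ / 2) i (fun j => avg (Vp j) (V 0 j)) (V 0 i) (V 1 i)
  step : ∀ n, 2 ≤ n → n ≤ N → ∀ i,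
    CNStep P M k δ (((n : ℝ) - 1 / 2) * δ) i (fun j => extrap (V (n - 1) j) (V (n - 2) j))
      (V (n - 1) i) (V n i)

end NonlocalFEM

end

open NonlocalFEM

open NonlocalFEM

/-! Let `Q` be the Ritz projection of the exact solution and split `V - v = (V - Q) + (Q - v)`. In
one space dimension `Q` is local: it agrees with `v` at the nodes, and on each cell its derivative
is the `L₂` projection of `∂v` onto polynomials of degree less than `k`. Since `Q - v` vanishes at
the nodes, integrating the derivative error over a cell gains the missing power of `h`, and no
duality argument is needed (`IsRitz.nrm_sub_le`). The local bounds come from Rolle's theorem: `k +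
1` interpolation points give every derivative of the interpolation error up to order `k` a zero in
the cell (`interpolation_error`). No reference element is used, so the constants depend neither on
`k` nor on the points.

For `V - Q`, the scheme and the weak equation at the midpoint are both tested with the average of `V
- Q` over the two time levels (`energy_step`). The Ritz error drops out of the diffusion term by
orthogonality, and in the convection term an integration by parts leaves only its `L₂` norm, of
order `h^{k+1}`. The nonlocal coefficients depend on integrals only, so their error is bounded by
`L₂` errors of earlier levels and no gradient error enters. Young's inequality absorbs the gradient
of the test function in the coercive term.

Summing over the equations gives a three-level recursion for the squared errors (`scheme_step_sum`),
which `gronwall` solves. The predictor freezes the coefficient at time zero and has only a first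
order error there, but this error reaches the corrector multiplied twice by `δ`.

The spatial regularity is given for almost every time only, and the weak derivatives are not given
as measurable functions of time. They are therefore handled by duality: `DualBound` bounds `φ ↦ (u,
φ^{(j)})`, which can be integrated and Taylor expanded in time as a scalar function for each fixed
`φ`. Riesz representation then returns actual derivatives with the same bound at every time
(`exists_sobolevRep`). -/

namespace NonlocalFEM

/-! ### Integrals over `Ω` and primitives -/

lemma integral_μΩ (f : ℝ → ℝ) : ∫ y, f y ∂μΩ = ∫ y in (0 : ℝ)..1, f y := by
  rw [intervalIntegral.integral_of_le zero_le_one, integral_Ioc_eq_integral_Ioo]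

lemma intervalIntegrable_of_integrable {f : ℝ → ℝ} (hf : Integrable f μΩ) {a b : ℝ}
    (ha : a ∈ Icc (0 : ℝ) 1) (hb : b ∈ Icc (0 : ℝ) 1) : IntervalIntegrable f volume a b := by
  have h : IntervalIntegrable f volume 0 1 := by
    rw [intervalIntegrable_iff_integrableOn_Ioo_of_le zero_le_one]; exact hf
  refine h.mono_set ?_
  rw [uIcc_of_le zero_le_one]
  exact uIcc_subset_Icc ha hb

lemma intervalIntegrable_of_memLp {f : ℝ → ℝ} (hf : MemLp f 2 μΩ) {a b : ℝ}
    (ha : a ∈ Icc (0 : ℝ) 1) (hb : b ∈ Icc (0 : ℝ) 1) : IntervalIntegrable f volume a b :=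
  intervalIntegrable_of_integrable (hf.integrable one_le_two) ha hb

lemma memLp_of_continuousOn {f : ℝ → ℝ} (hf : ContinuousOn f (Icc 0 1)) : MemLp f 2 μΩ := by
  obtain ⟨C, hC⟩ := isCompact_Icc.exists_bound_of_continuousOn hf
  refine MemLp.of_bound ((hf.mono Ioo_subset_Icc_self).aestronglyMeasurable measurableSet_Ioo) C ?_
  filter_upwards [ae_restrict_mem measurableSet_Ioo] with y hy using hC y (Ioo_subset_Icc_self hy)

/-- `u` is absolutely continuous on `[0,1]` with derivative `u' ∈ L₂(Ω)`. -/
structure IsPrimitive (u u' : ℝ → ℝ) : Prop where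
  memLp : MemLp u' 2 μΩ
  eq : ∀ y ∈ Icc (0 : ℝ) 1, u y = u 0 + ∫ s in (0 : ℝ)..y, u' s

namespace IsPrimitive

variable {u u' w w' : ℝ → ℝ}

lemma sub_eq (h : IsPrimitive u u') {a b : ℝ} (ha : a ∈ Icc (0 : ℝ) 1) (hb : b ∈ Icc (0 : ℝ) 1) :
    u b - u a = ∫ s in a..b, u' s := by
  rw [h.eq a ha, h.eq b hb, ← intervalIntegral.integral_add_adjacent_intervals
    (intervalIntegrable_of_memLp h.memLp ⟨le_rfl, zero_le_one⟩ ha)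
    (intervalIntegrable_of_memLp h.memLp ha hb)]
  ring

lemma continuousOn (h : IsPrimitive u u') : ContinuousOn u (Icc 0 1) := by
  have h1 := intervalIntegrable_of_memLp h.memLp (a := 0) (b := 1) (by simp) (by simp)
  have h2 := (h1.absolutelyContinuousOnInterval_intervalIntegral (c := 0) (by simp)).continuousOn
  rw [uIcc_of_le zero_le_one] at h2
  exact (continuousOn_const (c := u 0) |>.add h2).congr h.eq

lemma memLp_self (h : IsPrimitive u u') : MemLp u 2 μΩ := memLp_of_continuousOn h.continuousOn

lemma congr_deriv (h : IsPrimitive u u') {w : ℝ → ℝ} (hw : u' =ᵐ[μΩ] w) : IsPrimitive u w := by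
  refine ⟨(memLp_congr_ae hw).1 h.memLp, fun y hy => ?_⟩
  rw [h.eq y hy]
  congr 1
  refine intervalIntegral.integral_congr_ae_restrict ?_
  rw [uIoc_of_le hy.1]
  have : u' =ᵐ[volume.restrict (Ioc (0:ℝ) 1)] w := by
    rw [← restrict_Ioo_eq_restrict_Ioc]; exact hw
  exact ae_restrict_of_ae_restrict_of_subset (Ioc_subset_Ioc_right hy.2) this

lemma congr_fun (h : IsPrimitive u u') (hw : EqOn u w (Icc 0 1)) : IsPrimitive w u' := by
  refine ⟨h.memLp, fun y hy => ?_⟩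
  rw [← hw hy, ← hw ⟨le_rfl, zero_le_one⟩, h.eq y hy]

lemma add (h : IsPrimitive u u') (h' : IsPrimitive w w') :
    IsPrimitive (fun y => u y + w y) (fun y => u' y + w' y) := by
  refine ⟨h.memLp.add h'.memLp, fun y hy => ?_⟩
  rw [intervalIntegral.integral_add (intervalIntegrable_of_memLp h.memLp (by simp) hy)
    (intervalIntegrable_of_memLp h'.memLp (by simp) hy), h.eq y hy, h'.eq y hy]
  ring

lemma const_mul (c : ℝ) (h : IsPrimitive u u') :
    IsPrimitive (fun y => c * u y) (fun y => c * u' y) := by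
  refine ⟨h.memLp.const_mul c, fun y hy => ?_⟩
  rw [intervalIntegral.integral_const_mul, h.eq y hy]
  ring

lemma sub (h : IsPrimitive u u') (h' : IsPrimitive w w') :
    IsPrimitive (fun y => u y - w y) (fun y => u' y - w' y) := by
  simpa [sub_eq_add_neg] using h.add (h'.const_mul (-1))

/-- Integration by parts. -/
lemma integral_mul (h : IsPrimitive u u') (h' : IsPrimitive w w') {a b : ℝ}
    (ha : a ∈ Icc (0 : ℝ) 1) (hb : b ∈ Icc (0 : ℝ) 1) :
    ∫ y in a..b, u y * w' y = u b * w b - u a * w a - ∫ y in a..b, u' y * w y := by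
  have hs : uIcc a b ⊆ Icc 0 1 := uIcc_subset_Icc ha hb
  -- Nothing is known about `u` outside `[0,1]`, so it is replaced by the explicit primitive of `u'`
  -- based at `a`. This agrees with `u` on the interval and has derivative `u'` almost everywhere
  -- there by Lebesgue differentiation.
  have key : ∀ {u u' : ℝ → ℝ}, IsPrimitive u u' →
      AbsolutelyContinuousOnInterval (fun y => u a + ∫ s in a..y, u' s) a b ∧
      (∀ᵐ y, y ∈ uIcc a b → deriv (fun y => u a + ∫ s in a..y, u' s) y = u' y) ∧
      ∀ y ∈ uIcc a b, u a + ∫ s in a..y, u' s = u y := by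
    intro u u' h
    have hi := intervalIntegrable_of_memLp h.memLp ha hb
    refine ⟨?_, ?_, fun y hy => by rw [← h.sub_eq ha (hs hy)]; ring⟩
    · have := hi.absolutelyContinuousOnInterval_intervalIntegral (c := a) (by simp)
      have hc : AbsolutelyContinuousOnInterval (fun _ : ℝ => u a) a b :=
        (LipschitzWith.const (u a)).lipschitzOnWith.absolutelyContinuousOnInterval
      exact hc.add this
    · filter_upwards [hi.ae_hasDerivAt_integral] with y hy hy'
      exact ((hy hy' a (by simp)).const_add (u a)).deriv
  obtain ⟨hu1, hu2, hu3⟩ := key h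
  obtain ⟨hw1, hw2, hw3⟩ := key h'
  have := hu1.integral_mul_deriv_eq_deriv_mul hw1
  rw [hu3 b (by simp), hu3 a (by simp), hw3 b (by simp), hw3 a (by simp)] at this
  have e1 : ∫ y in a..b, u y * w' y = ∫ y in a..b, (u a + ∫ s in a..y, u' s) *
      deriv (fun y => w a + ∫ s in a..y, w' s) y := by
    refine intervalIntegral.integral_congr_ae ?_
    filter_upwards [hw2] with y hy hy'
    rw [hu3 y (uIoc_subset_uIcc hy'), hy (uIoc_subset_uIcc hy')]
  have e2 : ∫ y in a..b, u' y * w y = ∫ y in a..b, deriv (fun y => u a + ∫ s in a..y, u' s) y *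
      (w a + ∫ s in a..y, w' s) := by
    refine intervalIntegral.integral_congr_ae ?_
    filter_upwards [hu2] with y hy hy'
    rw [hw3 y (uIoc_subset_uIcc hy'), hy (uIoc_subset_uIcc hy')]
  rw [e1, e2, this]

/-- Integration by parts, when the boundary terms vanish. -/
lemma ip_eq (h : IsPrimitive u u') (h' : IsPrimitive w w') (h0 : u 0 * w 0 = 0)
    (h1 : u 1 * w 1 = 0) : ip u w' = - ip u' w := by
  rw [ip, ip, integral_μΩ, integral_μΩ, h.integral_mul h' (by simp) (by simp), h0, h1]
  ring

end IsPrimitive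

lemma isPrimitive_of_hasDerivAt {u u' : ℝ → ℝ} (h : ∀ y, HasDerivAt u (u' y) y)
    (hc : Continuous u') : IsPrimitive u u' := by
  refine ⟨memLp_of_continuousOn hc.continuousOn, fun y _ => ?_⟩
  rw [intervalIntegral.integral_eq_sub_of_hasDerivAt (fun y _ => h y)
    (hc.intervalIntegrable _ _)]
  ring

/-! ### Inner products and norms -/

lemma ip_eq_inner {f g : ℝ → ℝ} (hf : MemLp f 2 μΩ) (hg : MemLp g 2 μΩ) :
    ip f g = inner ℝ (hf.toLp f) (hg.toLp g) := by
  rw [L2.inner_def, ip]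
  refine integral_congr_ae ?_
  filter_upwards [hf.coeFn_toLp, hg.coeFn_toLp] with y h1 h2
  simp [h1, h2, mul_comm]

lemma ip_congr {f g f' g' : ℝ → ℝ} (hf : f =ᵐ[μΩ] f') (hg : g =ᵐ[μΩ] g') : ip f g = ip f' g' := by
  refine integral_congr_ae ?_
  filter_upwards [hf, hg] with y h1 h2
  simp [h1, h2]

lemma nrm_congr {f f' : ℝ → ℝ} (hf : f =ᵐ[μΩ] f') : nrm f = nrm f' := by
  rw [nrm, nrm, ip_congr hf hf]

lemma nrm_eq_norm {f : ℝ → ℝ} (hf : MemLp f 2 μΩ) : nrm f = ‖hf.toLp f‖ := by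
  rw [nrm, ip_eq_inner hf hf, real_inner_self_eq_norm_sq, Real.sqrt_sq (norm_nonneg _)]

lemma nrm_coe (f : L2Ω) : nrm f = ‖f‖ := by
  rw [nrm_eq_norm (Lp.memLp f), Lp.toLp_coeFn]

lemma nrm_nonneg (f : ℝ → ℝ) : 0 ≤ nrm f := Real.sqrt_nonneg _

lemma ip_self_eq {f : ℝ → ℝ} : ip f f = ∫ y in (0 : ℝ)..1, f y ^ 2 := by
  rw [ip, integral_μΩ]; simp only [sq]

lemma integrable_mul_of_memLp {f g : ℝ → ℝ} (hf : MemLp f 2 μΩ) (hg : MemLp g 2 μΩ) :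
    Integrable (fun y => f y * g y) μΩ := hf.integrable_mul hg

lemma ip_comm (f g : ℝ → ℝ) : ip f g = ip g f := by simp only [ip, mul_comm]

lemma ip_const_mul_left (c : ℝ) (f w : ℝ → ℝ) : ip (fun y => c * f y) w = c * ip f w := by
  simp only [ip, mul_assoc, integral_const_mul]

lemma ip_sub_left {f g w : ℝ → ℝ} (hf : MemLp f 2 μΩ) (hg : MemLp g 2 μΩ) (hw : MemLp w 2 μΩ) :
    ip (fun y => f y - g y) w = ip f w - ip g w := by
  rw [ip, ip, ip, ← integral_sub (integrable_mul_of_memLp hf hw) (integrable_mul_of_memLp hg hw)]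
  simp only [sub_mul]

/-! ### Test functions -/

/-- The space of test functions on `Ω`. -/
def testSpace : Submodule ℝ (ℝ → ℝ) where
  carrier := {φ | ContDiff ℝ ∞ φ ∧ HasCompactSupport φ ∧ tsupport φ ⊆ Ioo (0 : ℝ) 1}
  add_mem' := fun {a b} ha hb => ⟨ha.1.add hb.1, ha.2.1.add hb.2.1,
    (tsupport_add a b).trans (union_subset ha.2.2 hb.2.2)⟩
  zero_mem' := ⟨contDiff_const, HasCompactSupport.zero, by simp [tsupport]⟩
  smul_mem' := fun c a ha => ⟨contDiff_const.smul ha.1, ha.2.1.smul_left (f := fun _ => c),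
    (tsupport_smul_subset_right (fun _ => c) a).trans ha.2.2⟩

lemma deriv_mem_testSpace {φ : ℝ → ℝ} (h : φ ∈ testSpace) : deriv φ ∈ testSpace :=
  ⟨h.1.deriv' , h.2.1.deriv, tsupport_deriv_subset.trans h.2.2⟩

lemma iteratedDeriv_mem_testSpace {φ : ℝ → ℝ} (h : φ ∈ testSpace) (j : ℕ) :
    iteratedDeriv j φ ∈ testSpace := by
  induction j with
  | zero => simpa using h
  | succ j ih => rw [iteratedDeriv_succ]; exact deriv_mem_testSpace ih

lemma memLp_of_mem_testSpace {φ : ℝ → ℝ} (h : φ ∈ testSpace) : MemLp φ 2 μΩ :=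
  memLp_of_continuousOn h.1.continuous.continuousOn

lemma apply_zero_of_mem_testSpace {φ : ℝ → ℝ} (h : φ ∈ testSpace) : φ 0 = 0 :=
  image_eq_zero_of_notMem_tsupport fun h0 => lt_irrefl _ (h.2.2 h0).1

lemma apply_one_of_mem_testSpace {φ : ℝ → ℝ} (h : φ ∈ testSpace) : φ 1 = 0 :=
  image_eq_zero_of_notMem_tsupport fun h0 => lt_irrefl _ (h.2.2 h0).2

lemma isPrimitive_of_mem_testSpace {φ : ℝ → ℝ} (h : φ ∈ testSpace) : IsPrimitive φ (deriv φ) :=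
  isPrimitive_of_hasDerivAt (fun y => ((h.1.differentiable (by simp)) y).hasDerivAt)
    (deriv_mem_testSpace h).1.continuous

/-- The class in `L₂(Ω)` of the `j`-th derivative of a test function. -/
noncomputable def testDeriv (j : ℕ) : testSpace →ₗ[ℝ] L2Ω where
  toFun φ := (memLp_of_mem_testSpace (iteratedDeriv_mem_testSpace φ.2 j)).toLp _
  map_add' φ ψ := by
    rw [← MemLp.toLp_add]
    congr 1
    funext y
    exact iteratedDeriv_add (φ.2.1.contDiffAt.of_le (by exact_mod_cast le_top))
      (ψ.2.1.contDiffAt.of_le (by exact_mod_cast le_top))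
  map_smul' c φ := by
    rw [RingHom.id_apply, ← MemLp.toLp_const_smul]
    congr 1
    funext y
    exact iteratedDeriv_const_smul_field c _

lemma inner_testDeriv (j : ℕ) (φ : testSpace) {u : ℝ → ℝ} (hu : MemLp u 2 μΩ) :
    inner ℝ (testDeriv j φ) (hu.toLp u) = ip u (iteratedDeriv j φ) := by
  rw [ip_eq_inner hu (memLp_of_mem_testSpace (iteratedDeriv_mem_testSpace φ.2 j)), real_inner_comm]
  rfl

lemma inner_testDeriv_coe (j : ℕ) (φ : testSpace) (u : L2Ω) :
    inner ℝ (testDeriv j φ) u = ip u (iteratedDeriv j φ) := by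
  rw [← inner_testDeriv j φ (Lp.memLp u), Lp.toLp_coeFn]

lemma isWeakDeriv_iff {u u' : ℝ → ℝ} :
    IsWeakDeriv u u' ↔ ∀ φ ∈ testSpace, ip u (deriv φ) = - ip u' φ :=
  ⟨fun h φ hφ => h φ hφ.1 hφ.2.1 hφ.2.2, fun h φ h1 h2 h3 => h φ ⟨h1, h2, h3⟩⟩

lemma IsPrimitive.isWeakDeriv {u u' : ℝ → ℝ} (h : IsPrimitive u u') : IsWeakDeriv u u' :=
  isWeakDeriv_iff.2 fun φ hφ => h.ip_eq (isPrimitive_of_mem_testSpace hφ)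
    (by rw [apply_zero_of_mem_testSpace hφ, mul_zero])
    (by rw [apply_one_of_mem_testSpace hφ, mul_zero])

lemma ae_eq_zero_of_ip_testSpace {u : ℝ → ℝ} (hu : MemLp u 2 μΩ)
    (h : ∀ φ ∈ testSpace, ip u φ = 0) : u =ᵐ[μΩ] 0 := by
  have h1 : LocallyIntegrableOn u (Ioo 0 1) volume :=
    IntegrableOn.locallyIntegrableOn (hu.integrable one_le_two)
  have := isOpen_Ioo.ae_eq_zero_of_integral_contDiff_smul_eq_zero h1 fun g h1 h2 h3 => by
    rw [← h g ⟨h1, h2, h3⟩, ip, ← setIntegral_eq_integral_of_forall_compl_eq_zero (s := Ioo 0 1)]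
    · simp only [smul_eq_mul, mul_comm]
    · intro y hy
      rw [image_eq_zero_of_notMem_tsupport fun h0 => hy (h3 h0), zero_smul]
  exact (ae_restrict_iff' measurableSet_Ioo).2 this

lemma isWeakDeriv_unique {u d d' : ℝ → ℝ} (hd : MemLp d 2 μΩ) (hd' : MemLp d' 2 μΩ)
    (h : IsWeakDeriv u d) (h' : IsWeakDeriv u d') : d =ᵐ[μΩ] d' := by
  have : (fun y => d y - d' y) =ᵐ[μΩ] 0 := by
    refine ae_eq_zero_of_ip_testSpace (hd.sub hd') fun φ hφ => ?_
    have h1 := isWeakDeriv_iff.1 h φ hφ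
    have h2 := isWeakDeriv_iff.1 h' φ hφ
    rw [ip_sub_left hd hd' (memLp_of_mem_testSpace hφ)]; linarith
  filter_upwards [this] with y hy
  simpa [sub_eq_zero] using hy

lemma IsWeakDeriv.congr {u d u₁ d₁ : ℝ → ℝ} (h : IsWeakDeriv u d) (hu : u =ᵐ[μΩ] u₁)
    (hd : d =ᵐ[μΩ] d₁) : IsWeakDeriv u₁ d₁ :=
  isWeakDeriv_iff.2 fun φ hφ => by
    rw [← ip_congr hu (ae_eq_refl _), ← ip_congr hd (ae_eq_refl _), isWeakDeriv_iff.1 h φ hφ]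

lemma eqOn_of_ae_eq {u w : ℝ → ℝ} (hu : ContinuousOn u (Icc 0 1)) (hw : ContinuousOn w (Icc 0 1))
    (h : u =ᵐ[μΩ] w) : EqOn u w (Icc 0 1) := by
  have h1 : EqOn u w (Ioo 0 1) := Measure.eqOn_open_of_ae_eq h isOpen_Ioo
    (hu.mono Ioo_subset_Icc_self) (hw.mono Ioo_subset_Icc_self)
  refine h1.of_subset_closure hu hw Ioo_subset_Icc_self ?_
  rw [closure_Ioo (zero_ne_one)]

/-- There is a test function with integral one. -/
lemma exists_testSpace_integral_eq_one : ∃ φ ∈ testSpace, ∫ y in (0 : ℝ)..1, φ y = 1 := by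
  let b : ContDiffBump (1 / 2 : ℝ) := ⟨1 / 8, 1 / 4, by norm_num, by norm_num⟩
  have hs : tsupport b ⊆ Ioo (0 : ℝ) 1 := by
    rw [b.tsupport_eq, Real.closedBall_eq_Icc]
    intro y hy
    simp only [b, mem_Icc] at hy
    constructor <;> linarith [hy.1, hy.2]
  refine ⟨b.normed volume, ⟨b.contDiff_normed, b.hasCompactSupport_normed, ?_⟩, ?_⟩
  · rw [b.tsupport_normed_eq, ← b.tsupport_eq]; exact hs
  · rw [← integral_μΩ, setIntegral_eq_integral_of_forall_compl_eq_zero, b.integral_normed]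
    intro y hy
    refine image_eq_zero_of_notMem_tsupport fun h0 => hy (hs ?_)
    rw [b.tsupport_normed_eq, ← b.tsupport_eq] at h0
    exact h0

/-- A test function with integral zero is the derivative of a test function. -/
lemma exists_testSpace_deriv_eq {ψ : ℝ → ℝ} (hψ : ψ ∈ testSpace)
    (h : ∫ y in (0 : ℝ)..1, ψ y = 0) : ∃ φ ∈ testSpace, deriv φ = ψ := by
  have hc := hψ.1.continuous
  have hd : ∀ y, HasDerivAt (fun y => ∫ s in (0 : ℝ)..y, ψ s) (ψ y) y := fun y =>
    intervalIntegral.integral_hasDerivAt_right (hc.intervalIntegrable _ _)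
      (hc.stronglyMeasurableAtFilter _ _) hc.continuousAt
  have hderiv : deriv (fun y => ∫ s in (0 : ℝ)..y, ψ s) = ψ := funext fun y => (hd y).deriv
  -- The primitive of `ψ` vanishes to the left of `a` because `ψ` does, and to the right of `b`
  -- because the total integral is zero. For empty support the choice `a = 1`, `b = 0` makes `Icc a
  -- b` empty.
  obtain ⟨a, b, ha, hb, hab⟩ : ∃ a b : ℝ, 0 < a ∧ b < 1 ∧ tsupport ψ ⊆ Icc a b := by
    rcases (tsupport ψ).eq_empty_or_nonempty with he | hne
    · exact ⟨1, 0, by norm_num, by norm_num, by simp [he]⟩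
    · have hK : IsCompact (tsupport ψ) := hψ.2.1
      exact ⟨sInf (tsupport ψ), sSup (tsupport ψ), (hψ.2.2 (hK.sInf_mem hne)).1,
        (hψ.2.2 (hK.sSup_mem hne)).2, fun y hy => ⟨csInf_le hK.bddBelow hy, le_csSup hK.bddAbove hy⟩⟩
  have hz : ∀ y, y ∉ Icc a b → ψ y = 0 := fun y hy =>
    image_eq_zero_of_notMem_tsupport fun h0 => hy (hab h0)
  have hsupp : Function.support (fun y => ∫ s in (0 : ℝ)..y, ψ s) ⊆ Icc a b := by
    intro y hy
    by_contra hn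
    refine hy ?_
    show ∫ s in (0 : ℝ)..y, ψ s = 0
    have h00 : ∀ p q : ℝ, (∀ s ∈ uIcc p q, ψ s = 0) → ∫ s in p..q, ψ s = 0 := fun p q hpq => by
      rw [intervalIntegral.integral_congr (g := fun _ => (0 : ℝ)) hpq, intervalIntegral.integral_zero]
    rw [mem_Icc, not_and_or, not_le, not_le] at hn
    rcases hn with hn | hn
    · refine h00 _ _ fun s hs => hz s fun hs' => ?_
      have := (mem_uIcc.1 hs)
      rcases this with h1 | h1 <;> linarith [h1.1, h1.2, hs'.1]
    · rw [← intervalIntegral.integral_add_adjacent_intervals (b := 1)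
        (hc.intervalIntegrable _ _) (hc.intervalIntegrable _ _), h, zero_add]
      refine h00 _ _ fun s hs => hz s fun hs' => ?_
      have := (mem_uIcc.1 hs)
      rcases this with h1 | h1 <;> linarith [h1.1, h1.2, hs'.2]
  have ht : tsupport (fun y => ∫ s in (0 : ℝ)..y, ψ s) ⊆ Icc a b :=
    closure_minimal hsupp isClosed_Icc
  refine ⟨_, ⟨?_, HasCompactSupport.of_support_subset_isCompact isCompact_Icc hsupp,
    ht.trans fun y hy => ⟨ha.trans_le hy.1, hy.2.trans_lt hb⟩⟩, hderiv⟩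
  rw [contDiff_infty_iff_deriv, hderiv]
  exact ⟨fun y => (hd y).differentiableAt, hψ.1⟩

/-- The du Bois-Reymond lemma: a function with weak derivative zero is constant. -/
lemma ae_eq_const_of_isWeakDeriv_zero {u : ℝ → ℝ} (hu : MemLp u 2 μΩ)
    (h : IsWeakDeriv u 0) : ∃ c : ℝ, u =ᵐ[μΩ] fun _ => c := by
  obtain ⟨φ₀, hφ₀, h1⟩ := exists_testSpace_integral_eq_one
  have hc : MemLp (fun _ : ℝ => ip u φ₀) 2 μΩ := memLp_const _
  refine ⟨ip u φ₀, ?_⟩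
  have : (fun y => u y - ip u φ₀) =ᵐ[μΩ] 0 := by
    refine ae_eq_zero_of_ip_testSpace (hu.sub hc) fun ψ hψ => ?_
    have hcψ : ip (fun _ : ℝ => ip u φ₀) ψ = ip u φ₀ * ∫ y in (0 : ℝ)..1, ψ y := by
      rw [ip, integral_const_mul, integral_μΩ]
    rw [ip_sub_left hu hc (memLp_of_mem_testSpace hψ), hcψ]
    -- Removing the mean of `ψ` with the help of `φ₀` leaves the derivative of a test function, to
    -- which `u` is orthogonal. Hence `(u, ψ)` is `(u, φ₀)` times the integral of `ψ`.
    have hmem : ψ - (∫ y in (0 : ℝ)..1, ψ y) • φ₀ ∈ testSpace :=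
      testSpace.sub_mem hψ (testSpace.smul_mem _ hφ₀)
    obtain ⟨φ, hφ, hd⟩ := exists_testSpace_deriv_eq hmem (by
      simp only [Pi.sub_apply, Pi.smul_apply, smul_eq_mul]
      rw [intervalIntegral.integral_sub (hψ.1.continuous.intervalIntegrable _ _)
        ((hφ₀.1.continuous.intervalIntegrable _ _).const_mul _),
        intervalIntegral.integral_const_mul, h1]
      ring)
    have h2 := isWeakDeriv_iff.1 h φ hφ
    have h3 : ip (0 : ℝ → ℝ) φ = 0 := by simp [ip]
    rw [hd, h3, ip_comm] at h2
    have h4 := ip_sub_left (memLp_of_mem_testSpace hψ)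
      ((memLp_of_mem_testSpace hφ₀).const_mul (∫ y in (0 : ℝ)..1, ψ y)) hu
    rw [ip_const_mul_left] at h4
    have h5 : ip (ψ - (∫ y in (0 : ℝ)..1, ψ y) • φ₀) u =
      ip (fun y => ψ y - (∫ y in (0 : ℝ)..1, ψ y) * φ₀ y) u := rfl
    rw [h5, h4] at h2
    rw [ip_comm u ψ, ip_comm u φ₀]
    linarith
  filter_upwards [this] with y hy
  simpa [sub_eq_zero] using hy

lemma isPrimitive_integral {u' : ℝ → ℝ} (h : MemLp u' 2 μΩ) (c : ℝ) :
    IsPrimitive (fun y => c + ∫ s in (0 : ℝ)..y, u' s) u' := ⟨h, fun y _ => by simp⟩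

/-- A function with a weak derivative in `L₂` has an absolutely continuous representative. -/
lemma exists_isPrimitive {u u' : ℝ → ℝ} (hu : MemLp u 2 μΩ) (hu' : MemLp u' 2 μΩ)
    (h : IsWeakDeriv u u') : ∃ f, IsPrimitive f u' ∧ u =ᵐ[μΩ] f := by
  have hp := isPrimitive_integral hu' 0
  obtain ⟨c, hc⟩ := ae_eq_const_of_isWeakDeriv_zero (hu.sub hp.memLp_self) (by
    refine isWeakDeriv_iff.2 fun φ hφ => ?_
    have h1 := isWeakDeriv_iff.1 h φ hφ
    have h2 := isWeakDeriv_iff.1 hp.isWeakDeriv φ hφ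
    have h3 : ip (0 : ℝ → ℝ) φ = 0 := by simp [ip]
    have h4 := ip_sub_left hu hp.memLp_self (memLp_of_mem_testSpace (deriv_mem_testSpace hφ))
    rw [h3, neg_zero]
    refine h4.trans ?_
    linarith)
  refine ⟨_, isPrimitive_integral hu' c, ?_⟩
  filter_upwards [hc] with y hy
  simp only [Pi.sub_apply, zero_add] at hy
  linarith

lemma IsPrimitive.eqOn {u u' w w' : ℝ → ℝ} (h : IsPrimitive u u') (h' : IsPrimitive w w')
    (he : u =ᵐ[μΩ] w) : EqOn u w (Icc 0 1) ∧ u' =ᵐ[μΩ] w' :=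
  ⟨eqOn_of_ae_eq h.continuousOn h'.continuousOn he,
    isWeakDeriv_unique h.memLp h'.memLp (h.isWeakDeriv.congr he (ae_eq_refl _)) h'.isWeakDeriv⟩

/-- A continuous function that agrees almost everywhere with its absolutely continuous
representative agrees with it everywhere on `[0,1]`, boundary points included. -/
lemma MemH10.isPrimitive {u u' : ℝ → ℝ} (h : MemH10 u u') : IsPrimitive u u' := by
  obtain ⟨f, hf, he⟩ := exists_isPrimitive (memLp_of_continuousOn h.cont) h.memLp h.weak
  exact hf.congr_fun (eqOn_of_ae_eq h.cont hf.continuousOn he).symm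

lemma IsPrimitive.memH10 {u u' : ℝ → ℝ} (h : IsPrimitive u u') (h0 : u 0 = 0) (h1 : u 1 = 0) :
    MemH10 u u' := ⟨h.continuousOn, h0, h1, h.memLp, h.isWeakDeriv⟩

/-! ### Dual characterisation of weak derivatives -/

/-- The functional `φ ↦ (u, φ^{(j)})` is bounded by `K` in the norm of `L₂(Ω)`. -/
def DualBound (j : ℕ) (u : L2Ω) (K : ℝ) : Prop :=
  ∀ φ : testSpace, |inner ℝ (testDeriv j φ) u| ≤ K * ‖testDeriv 0 φ‖

lemma DualBound.mono {j : ℕ} {u : L2Ω} {K K' : ℝ} (h : DualBound j u K) (hK : K ≤ K') :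
    DualBound j u K' := fun φ =>
  (h φ).trans (mul_le_mul_of_nonneg_right hK (norm_nonneg _))

lemma DualBound.add {j : ℕ} {u w : L2Ω} {K K' : ℝ} (h : DualBound j u K) (h' : DualBound j w K') :
    DualBound j (u + w) (K + K') := fun φ => by
  rw [inner_add_right, add_mul]
  exact (abs_add_le _ _).trans (add_le_add (h φ) (h' φ))

lemma DualBound.smul {j : ℕ} {u : L2Ω} {K : ℝ} (h : DualBound j u K) (c : ℝ) :
    DualBound j (c • u) (|c| * K) := fun φ => by
  rw [real_inner_smul_right, abs_mul, mul_assoc]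
  exact mul_le_mul_of_nonneg_left (h φ) (abs_nonneg c)

lemma ip_iteratedDeriv {m : ℕ} {D : ℕ → L2Ω} (hD : ∀ j < m, IsWeakDeriv (D j) (D (j + 1)))
    {j : ℕ} (hj : j ≤ m) : ∀ φ ∈ testSpace, ip (D 0) (iteratedDeriv j φ) = (-1) ^ j * ip (D j) φ := by
  induction j with
  | zero => intro φ _; simp
  | succ j ih =>
    intro φ hφ
    rw [iteratedDeriv_succ', ih (by omega) _ (deriv_mem_testSpace hφ),
      isWeakDeriv_iff.1 (hD j (by omega)) φ hφ]
    ring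

/-- Integrating by parts `j` times leaves `D j` tested with `φ`, and `‖D j‖` is dominated by the
full Sobolev norm. -/
lemma HNormLE.dualBound {m : ℕ} {u : L2Ω} {R : ℝ} (h : HNormLE m u R) {j : ℕ} (hj : j ≤ m) :
    DualBound j u R := by
  obtain ⟨D, rfl, hD, hR⟩ := h
  intro φ
  rw [inner_testDeriv_coe, ip_iteratedDeriv hD hj φ φ.2, abs_mul, abs_pow, abs_neg, abs_one,
    one_pow, one_mul]
  have h1 := inner_testDeriv_coe 0 φ (D j)
  rw [iteratedDeriv_zero] at h1
  rw [← h1, mul_comm]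
  refine (abs_real_inner_le_norm _ _).trans (mul_le_mul_of_nonneg_left ?_ (norm_nonneg _))
  refine le_trans ?_ hR
  refine Real.le_sqrt_of_sq_le ?_
  exact Finset.single_le_sum (f := fun j => ‖D j‖ ^ 2) (fun i _ => sq_nonneg _)
    (Finset.mem_range.2 (by omega))

lemma dualBound_of_isWeakDeriv {u d : L2Ω} {R : ℝ} (h : IsWeakDeriv u d) (hd : ‖d‖ ≤ R) :
    DualBound 1 u R := by
  intro φ
  have h1 := inner_testDeriv_coe 0 φ d
  rw [iteratedDeriv_zero] at h1
  rw [inner_testDeriv_coe, iteratedDeriv_one, isWeakDeriv_iff.1 h φ φ.2, ← h1, abs_neg]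
  rw [mul_comm]
  exact (abs_real_inner_le_norm _ _).trans (mul_le_mul_of_nonneg_left hd (norm_nonneg _))

lemma dualBound_zero {u : L2Ω} {R : ℝ} (h : ‖u‖ ≤ R) : DualBound 0 u R := fun φ => by
  rw [mul_comm]
  exact (abs_real_inner_le_norm _ _).trans (mul_le_mul_of_nonneg_left h (norm_nonneg _))

/-- Riesz representation of the functional `φ ↦ (u, φ^{(j)})`. -/
lemma DualBound.exists_repr {j : ℕ} {u : L2Ω} {K : ℝ} (hK : 0 ≤ K) (h : DualBound j u K) :
    ∃ D : L2Ω, ‖D‖ ≤ K ∧ ∀ φ ∈ testSpace, ip D φ = ip u (iteratedDeriv j φ) := by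
  let ℓ : testSpace →ₗ[ℝ] ℝ := (innerₗ L2Ω u) ∘ₗ testDeriv j
  have hℓ : ∀ φ, |ℓ φ| ≤ K * ‖testDeriv 0 φ‖ := fun φ => by
    simpa [ℓ, real_inner_comm] using h φ
  -- The dual bound makes `ℓ` vanish on the kernel of `testDeriv 0`, so `ℓ` descends to the `L₂`
  -- classes of test functions with bound `K`. A Hahn-Banach extension keeps this bound, and the
  -- Riesz theorem represents the extension.
  have hker : LinearMap.ker (testDeriv 0) ≤ LinearMap.ker ℓ := fun φ hφ => by
    have := hℓ φ
    rw [LinearMap.mem_ker.1 hφ, norm_zero, mul_zero] at this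
    exact LinearMap.mem_ker.2 (abs_nonpos_iff.1 this)
  obtain ⟨g, hg⟩ : ∃ g : LinearMap.range (testDeriv 0) →ₗ[ℝ] ℝ, ∀ φ,
      g ⟨testDeriv 0 φ, LinearMap.mem_range_self _ φ⟩ = ℓ φ := by
    refine ⟨((LinearMap.ker (testDeriv 0)).liftQ ℓ hker) ∘ₗ
      ((testDeriv 0).quotKerEquivRange.symm : _ →ₗ[ℝ] _), fun φ => ?_⟩
    have : (testDeriv 0).quotKerEquivRange (Submodule.Quotient.mk φ) =
      ⟨testDeriv 0 φ, LinearMap.mem_range_self _ φ⟩ := rfl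
    simp [← this]
  have hgb : ∀ x, ‖g x‖ ≤ K * ‖x‖ := by
    rintro ⟨_, φ, rfl⟩
    rw [hg]
    exact hℓ φ
  obtain ⟨G, hG, hGn⟩ := exists_extension_norm_eq _ (g.mkContinuous K hgb)
  refine ⟨(InnerProductSpace.toDual ℝ L2Ω).symm G, ?_, fun φ hφ => ?_⟩
  · rw [LinearIsometryEquiv.norm_map, hGn]
    exact LinearMap.mkContinuous_norm_le _ hK _
  · have h1 := inner_testDeriv_coe 0 ⟨φ, hφ⟩ ((InnerProductSpace.toDual ℝ L2Ω).symm G)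
    rw [iteratedDeriv_zero] at h1
    rw [← h1, real_inner_comm, InnerProductSpace.toDual_symm_apply]
    have h2 := hG ⟨testDeriv 0 ⟨φ, hφ⟩, LinearMap.mem_range_self _ _⟩
    rw [LinearMap.mkContinuous_apply, hg] at h2
    rw [h2, ← inner_testDeriv_coe j ⟨φ, hφ⟩, real_inner_comm]
    rfl

/-- `f 0, …, f m` are representatives of `u` and its derivatives, of norm at most `K`; all but the
last one are absolutely continuous. -/
structure SobolevRep (m : ℕ) (u : ℝ → ℝ) (K : ℝ) (f : ℕ → ℝ → ℝ) : Prop where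
  ae_eq : u =ᵐ[μΩ] f 0
  prim : ∀ j < m, IsPrimitive (f j) (f (j + 1))
  memLp : ∀ j ≤ m, MemLp (f j) 2 μΩ
  nrm_le : ∀ j ≤ m, nrm (f j) ≤ K

/-- This is the way back from dual bounds to functions. With the sign `(-1)^j`, the Riesz
representatives of `φ ↦ (u, φ^{(j)})` are successive weak derivatives because `φ^{(j+1)} =
(φ')^{(j)}`. Every one with a weak derivative in the chain is then replaced by its absolutely
continuous version. -/
lemma exists_sobolevRep {m : ℕ} {u : L2Ω} {K : ℝ} (hK : 0 ≤ K)
    (h : ∀ j ≤ m, DualBound j u K) : ∃ f, SobolevRep m u K f := by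
  have h1 : ∀ j, ∃ D : L2Ω, ‖D‖ ≤ K ∧ (j ≤ m → ∀ φ ∈ testSpace,
      ip D φ = (-1) ^ j * ip u (iteratedDeriv j φ)) := by
    intro j
    by_cases hj : j ≤ m
    · obtain ⟨D, hD, he⟩ := (h j hj).exists_repr hK
      refine ⟨((-1 : ℝ) ^ j) • D, by simpa [norm_smul] using hD, fun _ φ hφ => ?_⟩
      rw [← he φ hφ, ← ip_const_mul_left]
      exact ip_congr (Lp.coeFn_smul _ _) (ae_eq_refl _)
    · exact ⟨0, by simpa using hK, fun h => absurd h hj⟩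
  choose D hDn hD using h1
  have hw : ∀ j < m, IsWeakDeriv (D j) (D (j + 1)) := fun j hj => isWeakDeriv_iff.2 fun φ hφ => by
    rw [hD j hj.le _ (deriv_mem_testSpace hφ), hD (j + 1) hj φ hφ, iteratedDeriv_succ']
    ring
  have h2 : ∀ j, ∃ f, (D j =ᵐ[μΩ] f) ∧ (j < m → IsPrimitive f (D (j + 1))) := by
    intro j
    by_cases hj : j < m
    · obtain ⟨f, hf, he⟩ := exists_isPrimitive (Lp.memLp (D j)) (Lp.memLp (D (j + 1))) (hw j hj)
      exact ⟨f, he, fun _ => hf⟩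
    · exact ⟨D j, ae_eq_refl _, fun h => absurd h hj⟩
  choose f hfD hf using h2
  refine ⟨f, ?_, fun j hj => (hf j hj).congr_deriv (hfD (j + 1)),
    fun j _ => (memLp_congr_ae (hfD j)).1 (Lp.memLp _), fun j _ => ?_⟩
  · refine Filter.EventuallyEq.trans ?_ (hfD 0)
    have : (fun y => u y - D 0 y) =ᵐ[μΩ] 0 := by
      refine ae_eq_zero_of_ip_testSpace ((Lp.memLp u).sub (Lp.memLp (D 0))) fun φ hφ => ?_
      rw [ip_sub_left (Lp.memLp u) (Lp.memLp (D 0)) (memLp_of_mem_testSpace hφ),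
        hD 0 (Nat.zero_le _) φ hφ]
      simp
    filter_upwards [this] with y hy
    simpa [sub_eq_zero] using hy
  · rw [← nrm_congr (hfD j), nrm_coe]
    exact hDn j

/-! ### Chains of primitives with zeros -/

lemma intervalIntegrable_mul {f g : ℝ → ℝ} (hf : MemLp f 2 μΩ) (hg : MemLp g 2 μΩ) {a b : ℝ}
    (ha : a ∈ Icc (0 : ℝ) 1) (hb : b ∈ Icc (0 : ℝ) 1) :
    IntervalIntegrable (fun y => f y * g y) volume a b :=
  intervalIntegrable_of_integrable (integrable_mul_of_memLp hf hg) ha hb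

lemma intervalIntegrable_sq {f : ℝ → ℝ} (hf : MemLp f 2 μΩ) {a b : ℝ}
    (ha : a ∈ Icc (0 : ℝ) 1) (hb : b ∈ Icc (0 : ℝ) 1) :
    IntervalIntegrable (fun y => f y ^ 2) volume a b := by
  simpa only [sq] using intervalIntegrable_mul hf hf ha hb

/-- The Cauchy-Schwarz inequality `(∫ |f|)² ≤ (b - a) ∫ f²`. -/
lemma sq_integral_abs_le {f : ℝ → ℝ} (hf : MemLp f 2 μΩ) {a b : ℝ} (ha : a ∈ Icc (0 : ℝ) 1)
    (hb : b ∈ Icc (0 : ℝ) 1) (hab : a ≤ b) :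
    (∫ y in a..b, |f y|) ^ 2 ≤ (b - a) * ∫ y in a..b, f y ^ 2 := by
  rcases hab.eq_or_lt with rfl | hlt
  · simp
  set I := ∫ y in a..b, |f y| with hI
  have h1 := (intervalIntegrable_of_memLp hf ha hb).abs
  have h2 := intervalIntegrable_sq hf ha hb
  have hba : 0 < b - a := sub_pos.2 hlt
  -- Up to the factor `(b - a)²` this is the integrated squared deviation of `|f|` from its mean;
  -- expanding it gives the inequality.
  have key : 0 ≤ ∫ y in a..b, ((b - a) * |f y| - I) ^ 2 :=
    intervalIntegral.integral_nonneg hab fun _ _ => sq_nonneg _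
  have he : ∫ y in a..b, ((b - a) * |f y| - I) ^ 2 =
      (b - a) ^ 2 * (∫ y in a..b, f y ^ 2) - (b - a) * I ^ 2 := by
    have : ∀ y, ((b - a) * |f y| - I) ^ 2 =
        (b - a) ^ 2 * f y ^ 2 - (2 * (b - a) * I) * |f y| + I ^ 2 := fun y => by
      rw [← sq_abs (f y)]; ring
    simp_rw [this]
    rw [intervalIntegral.integral_add ((h2.const_mul _).sub (h1.const_mul _)) (by simp),
      intervalIntegral.integral_sub (h2.const_mul _) (h1.const_mul _),
      intervalIntegral.integral_const_mul, intervalIntegral.integral_const_mul, ← hI,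
      intervalIntegral.integral_const, smul_eq_mul]
    ring
  rw [he] at key
  have : 0 ≤ (b - a) * ((b - a) * (∫ y in a..b, f y ^ 2) - I ^ 2) := by linarith
  linarith [nonneg_of_mul_nonneg_right this hba]

/-- Integrating from a zero of `F j` bounds it by the next function and gains a factor `b - a` each
time. The last function need not be bounded, so the last step keeps its integral instead of a
supremum. -/
lemma chain_abs_le {a b : ℝ} (ha : a ∈ Icc (0 : ℝ) 1) (hb : b ∈ Icc (0 : ℝ) 1) (hab : a ≤ b)
    (n : ℕ) : ∀ F : ℕ → ℝ → ℝ, (∀ j ≤ n, IsPrimitive (F j) (F (j + 1))) →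
      (∀ j ≤ n, ∃ z ∈ Icc a b, F j z = 0) →
      ∀ y ∈ Icc a b, |F 0 y| ≤ (b - a) ^ n * ∫ s in a..b, |F (n + 1) s| := by
  have hsub : Icc a b ⊆ Icc 0 1 := Icc_subset_Icc ha.1 hb.2
  induction n with
  | zero =>
    intro F hF hz y hy
    obtain ⟨z, hz, h0⟩ := hz 0 le_rfl
    have h1 := (hF 0 le_rfl).sub_eq (hsub hz) (hsub hy)
    rw [h0, sub_zero] at h1
    rw [h1, pow_zero, one_mul]
    have h2 := (intervalIntegrable_of_memLp (hF 0 le_rfl).memLp ha hb).abs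
    have h3 : uIoc z y ⊆ uIoc a b := by
      rw [uIoc_of_le hab]
      exact Ioc_subset_Ioc (le_min hz.1 hy.1) (max_le hz.2 hy.2)
    calc |∫ s in z..y, F (0 + 1) s| ≤ |∫ s in z..y, (|F (0 + 1) s|)| :=
          intervalIntegral.norm_integral_le_abs_integral_norm (f := F (0 + 1))
      _ ≤ |∫ s in a..b, (|F (0 + 1) s|)| := intervalIntegral.abs_integral_mono_interval h3
          (Filter.Eventually.of_forall fun s => abs_nonneg _) h2
      _ = ∫ s in a..b, |F (0 + 1) s| :=
          abs_of_nonneg (intervalIntegral.integral_nonneg hab fun _ _ => abs_nonneg _)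
  | succ n ih =>
    intro F hF hZ y hy
    obtain ⟨z, hz, h0⟩ := hZ 0 (Nat.zero_le _)
    have h1 := (hF 0 (Nat.zero_le _)).sub_eq (hsub hz) (hsub hy)
    rw [h0, sub_zero] at h1
    have h2 := ih (fun j => F (j + 1)) (fun j hj => hF (j + 1) (by omega))
      (fun j hj => hZ (j + 1) (by omega))
    have h3 : |∫ s in z..y, F (0 + 1) s| ≤
        ((b - a) ^ n * ∫ s in a..b, |F (n + 1 + 1) s|) * |y - z| :=
      intervalIntegral.norm_integral_le_of_norm_le_const (f := F (0 + 1)) fun s hs => h2 s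
        ⟨(le_min hz.1 hy.1).trans hs.1.le, hs.2.trans (max_le hz.2 hy.2)⟩
    have h4 : |y - z| ≤ b - a := abs_sub_le_iff.2 ⟨by linarith [hy.2, hz.1], by linarith [hy.1, hz.2]⟩
    have h5 : 0 ≤ ∫ s in a..b, |F (n + 1 + 1) s| :=
      intervalIntegral.integral_nonneg hab fun _ _ => abs_nonneg _
    have h6 : 0 ≤ (b - a) ^ n := pow_nonneg (sub_nonneg.2 hab) n
    rw [h1]
    refine h3.trans ((mul_le_mul_of_nonneg_left h4 (mul_nonneg h6 h5)).trans (le_of_eq ?_))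
    ring

/-- If all the functions of a chain of primitives but the last one have a zero in `[a, b]`, then the
first one is controlled by the last one. -/
lemma chain_integral_sq_le {a b : ℝ} (ha : a ∈ Icc (0 : ℝ) 1) (hb : b ∈ Icc (0 : ℝ) 1) (hab : a ≤ b)
    (n : ℕ) {F : ℕ → ℝ → ℝ} (hF : ∀ j ≤ n, IsPrimitive (F j) (F (j + 1)))
    (hz : ∀ j ≤ n, ∃ z ∈ Icc a b, F j z = 0) :
    ∫ y in a..b, F 0 y ^ 2 ≤ ((b - a) ^ (n + 1)) ^ 2 * ∫ y in a..b, F (n + 1) y ^ 2 := by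
  have h1 := chain_abs_le ha hb hab n F hF hz
  set I := ∫ s in a..b, |F (n + 1) s|
  have h2 := sq_integral_abs_le (hF n le_rfl).memLp ha hb hab
  have hba : 0 ≤ b - a := sub_nonneg.2 hab
  have h3 : ∫ y in a..b, F 0 y ^ 2 ≤ ∫ y in a..b, ((b - a) ^ n * I) ^ 2 := by
    refine intervalIntegral.integral_mono_on hab
      (intervalIntegrable_sq (hF 0 (Nat.zero_le _)).memLp_self ha hb) (by simp) fun y hy => ?_
    rw [← sq_abs]
    exact pow_le_pow_left₀ (abs_nonneg _) (h1 y hy) 2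
  rw [intervalIntegral.integral_const, smul_eq_mul] at h3
  calc _ ≤ _ := h3
    _ = ((b - a) ^ n) ^ 2 * (b - a) * I ^ 2 := by ring
    _ ≤ ((b - a) ^ n) ^ 2 * (b - a) * ((b - a) * ∫ y in a..b, F (n + 1) y ^ 2) :=
      mul_le_mul_of_nonneg_left h2 (by positivity)
    _ = _ := by ring

lemma IsPrimitive.exists_zero {u u' : ℝ → ℝ} (h : IsPrimitive u u')
    (hc : ContinuousOn u' (Icc 0 1)) {p q : ℝ} (hp : p ∈ Icc (0 : ℝ) 1) (hq : q ∈ Icc (0 : ℝ) 1)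
    (hpq : p < q) (h0 : u p = 0) (h1 : u q = 0) : ∃ z ∈ Ioo p q, u' z = 0 := by
  refine exists_hasDerivAt_eq_zero hpq (h.continuousOn.mono (Icc_subset_Icc hp.1 hq.2))
    (h0.trans h1.symm) fun y hy => ?_
  have hy' : y ∈ Ioo (0 : ℝ) 1 := ⟨hp.1.trans_lt hy.1, hy.2.trans_le hq.2⟩
  have hd := intervalIntegral.integral_hasDerivAt_right
    (intervalIntegrable_of_memLp h.memLp (a := 0) (by simp) (Ioo_subset_Icc_self hy'))
    ((hc.mono Ioo_subset_Icc_self).stronglyMeasurableAtFilter isOpen_Ioo y hy')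
    (hc.continuousAt (Icc_mem_nhds hy'.1 hy'.2))
  refine (hd.const_add (u 0)).congr_of_eventuallyEq ?_
  filter_upwards [Icc_mem_nhds hy'.1 hy'.2] with s hs using h.eq s hs

/-- Rolle's theorem for a chain of primitives. -/
lemma chain_exists_zero {a b : ℝ} (ha : a ∈ Icc (0 : ℝ) 1) (hb : b ∈ Icc (0 : ℝ) 1) (n : ℕ) :
    ∀ (F : ℕ → ℝ → ℝ) (p : ℕ → ℝ), (∀ j < n, IsPrimitive (F j) (F (j + 1))) →
      ContinuousOn (F n) (Icc 0 1) → (∀ r < n, p r < p (r + 1)) → (∀ r ≤ n, p r ∈ Icc a b) →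
      (∀ r ≤ n, F 0 (p r) = 0) → ∀ j ≤ n, ∃ z ∈ Icc a b, F j z = 0 := by
  have hsub : Icc a b ⊆ Icc 0 1 := Icc_subset_Icc ha.1 hb.2
  induction n with
  | zero =>
    intro F p _ _ _ hm h0 j hj
    obtain rfl := Nat.le_zero.1 hj
    exact ⟨p 0, hm 0 le_rfl, h0 0 le_rfl⟩
  | succ n ih =>
    intro F p hF hc hp hm h0 j hj
    rcases j with _ | j
    · exact ⟨p 0, hm 0 (Nat.zero_le _), h0 0 (Nat.zero_le _)⟩
    have hc1 : ContinuousOn (F 1) (Icc 0 1) := by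
      rcases n with _ | n
      · exact hc
      · exact (hF 1 (by omega)).continuousOn
    have hq : ∀ r, ∃ q, r ≤ n → q ∈ Ioo (p r) (p (r + 1)) ∧ F 1 q = 0 := by
      intro r
      by_cases hr : r ≤ n
      · obtain ⟨q, hq, h⟩ := (hF 0 (by omega)).exists_zero hc1 (hsub (hm r (by omega)))
          (hsub (hm (r + 1) (by omega))) (hp r (by omega)) (h0 r (by omega)) (h0 (r + 1) (by omega))
        exact ⟨q, fun _ => ⟨hq, h⟩⟩
      · exact ⟨0, fun h => absurd h hr⟩
    choose q hq using hq
    exact ih (fun j => F (j + 1)) q (fun j hj => hF (j + 1) (by omega)) hc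
      (fun r hr => (hq r (by omega)).1.2.trans (hq (r + 1) (by omega)).1.1)
      (fun r hr => ⟨(hm r (by omega)).1.trans (hq r hr).1.1.le,
        (hq r hr).1.2.le.trans (hm (r + 1) (by omega)).2⟩)
      (fun r hr => (hq r hr).2) j (by omega)

/-! ### Polynomial interpolation on an interval -/

lemma isPrimitive_eval (p : ℝ[X]) :
    IsPrimitive (fun y => p.eval y) (fun y => (Polynomial.derivative p).eval y) :=
  isPrimitive_of_hasDerivAt (fun y => p.hasDerivAt y) (Polynomial.continuous _)

/-- Interpolation error: constants do not depend on the degree nor on the points. -/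
lemma interpolation_error {a b : ℝ} (ha : a ∈ Icc (0 : ℝ) 1) (hb : b ∈ Icc (0 : ℝ) 1) (hab : a ≤ b)
    {k : ℕ} {f : ℕ → ℝ → ℝ} (hf : ∀ j ≤ k, IsPrimitive (f j) (f (j + 1))) {p : ℝ[X]}
    (hp : p.natDegree ≤ k) {x : ℕ → ℝ} (hx : ∀ r < k, x r < x (r + 1))
    (hxm : ∀ r ≤ k, x r ∈ Icc a b) (hpx : ∀ r ≤ k, p.eval (x r) = f 0 (x r)) :
    ∫ y in a..b, (f 0 y - p.eval y) ^ 2 ≤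
      ((b - a) ^ (k + 1)) ^ 2 * ∫ y in a..b, f (k + 1) y ^ 2 ∧
    (1 ≤ k → ∫ y in a..b, (f 1 y - (Polynomial.derivative p).eval y) ^ 2 ≤
      ((b - a) ^ k) ^ 2 * ∫ y in a..b, f (k + 1) y ^ 2) := by
  -- The chain starts with the interpolation error. Differentiating `p` more than `k` times gives
  -- zero, so the chain ends with `f (k + 1)` itself.
  let F : ℕ → ℝ → ℝ := fun j y => f j y - (Polynomial.derivative^[j] p).eval y
  have hF : ∀ j ≤ k, IsPrimitive (F j) (F (j + 1)) := fun j hj => by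
    have := (hf j hj).sub (isPrimitive_eval (Polynomial.derivative^[j] p))
    simpa only [F, Function.iterate_succ_apply'] using this
  have hz : ∀ j ≤ k, ∃ z ∈ Icc a b, F j z = 0 := by
    refine chain_exists_zero ha hb k F x (fun j hj => hF j hj.le) (hF k le_rfl).continuousOn hx hxm
      fun r hr => ?_
    simp [F, hpx r hr]
  have hlast : F (k + 1) = f (k + 1) := by
    funext y
    simp [F, Polynomial.iterate_derivative_eq_zero (Nat.lt_succ_of_le hp)]
  refine ⟨?_, fun hk => ?_⟩
  · have := chain_integral_sq_le ha hb hab k hF hz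
    rw [hlast] at this
    exact this
  -- For the derivative the chain starts at index 1; it is one link shorter, whence the power `k` in
  -- place of `k + 1`.
  · obtain ⟨n, rfl⟩ : ∃ n, k = n + 1 := ⟨k - 1, by omega⟩
    have := chain_integral_sq_le ha hb hab n (F := fun j => F (j + 1))
      (fun j hj => hF (j + 1) (by omega)) (fun j hj => hz (j + 1) (by omega))
    rw [hlast] at this
    exact this

lemma exists_interpolating_polynomial {k : ℕ} {x : ℕ → ℝ} (hx : ∀ r < k, x r < x (r + 1))
    (c : ℕ → ℝ) : ∃ p : ℝ[X], p.natDegree ≤ k ∧ ∀ r ≤ k, p.eval (x r) = c r := by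
  have hmono : ∀ r s, r < s → s ≤ k → x r < x s := by
    intro r s hrs
    induction s, hrs using Nat.le_induction with
    | base => exact fun h => hx r h
    | succ s _ ih => exact fun h => (ih (by omega)).trans (hx s h)
  have hinj : InjOn x (Finset.range (k + 1)) := by
    intro r hr s hs h
    simp only [Finset.coe_range, mem_Iio] at hr hs
    rcases lt_trichotomy r s with h' | h' | h'
    · exact absurd h (hmono r s h' (by omega)).ne
    · exact h'
    · exact absurd h (hmono s r h' (by omega)).ne'
  refine ⟨Lagrange.interpolate (Finset.range (k + 1)) x c, ?_, fun r hr =>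
    Lagrange.eval_interpolate_at_node c hinj (Finset.mem_range.2 (by omega))⟩
  have := Lagrange.degree_interpolate_le c hinj
  rw [Finset.card_range, Nat.add_sub_cancel] at this
  exact Polynomial.natDegree_le_of_degree_le this

lemma exists_antiderivative {k : ℕ} {p : ℝ[X]} (hp : p.natDegree < k) (a c : ℝ) :
    ∃ P : ℝ[X], P.natDegree ≤ k ∧ Polynomial.derivative P = p ∧ P.eval a = c := by
  let P : ℝ[X] := ∑ i ∈ Finset.range k, Polynomial.monomial (i + 1) (p.coeff i / (i + 1))
  have hd : Polynomial.derivative P = p := by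
    conv_rhs => rw [p.as_sum_range' k hp]
    simp only [P, Polynomial.derivative_sum]
    refine Finset.sum_congr rfl fun i _ => ?_
    rw [Polynomial.derivative_monomial]
    have : (i : ℝ) + 1 ≠ 0 := by positivity
    push_cast
    rw [div_mul_cancel₀ _ this]
  refine ⟨P + Polynomial.C (c - P.eval a), ?_, by simp [hd], by simp⟩
  refine (Polynomial.natDegree_add_le _ _).trans (max_le ?_ (by simp))
  refine Polynomial.natDegree_sum_le_of_forall_le _ _ fun i hi => ?_
  exact (Polynomial.natDegree_monomial_le _).trans (Finset.mem_range.1 hi)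

lemma eq_zero_of_integral_sq_eq_zero {a b : ℝ} (hab : a < b) {p : ℝ[X]}
    (h : ∫ y in a..b, p.eval y * p.eval y = 0) : p = 0 := by
  by_contra hp
  obtain ⟨y, hy, hne⟩ : ∃ y ∈ Icc a b, p.eval y ≠ 0 := by
    by_contra! hall
    exact hp (Polynomial.eq_zero_of_infinite_isRoot p ((Icc_infinite hab).mono hall))
  refine (intervalIntegral.integral_pos hab (by fun_prop) (fun y _ => mul_self_nonneg _)
    ⟨y, hy, ?_⟩).ne' h
  exact mul_self_pos.2 hne

/-- Existence of the `L₂` projection onto polynomials of degree less than `k`. -/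
lemma exists_polynomial_projection {a b : ℝ} (hab : a < b) {k : ℕ} (hk : 1 ≤ k) {w : ℝ → ℝ}
    (hw : IntervalIntegrable w volume a b) :
    ∃ p : ℝ[X], p.natDegree < k ∧ ∀ q : ℝ[X], q.natDegree < k →
      ∫ y in a..b, (w y - p.eval y) * q.eval y = 0 := by
  have hpc : ∀ p q : ℝ[X], IntervalIntegrable (fun y => p.eval y * q.eval y) volume a b :=
    fun p q => Continuous.intervalIntegrable (by fun_prop) _ _
  have hwc : ∀ q : ℝ[X], IntervalIntegrable (fun y => w y * q.eval y) volume a b :=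
    fun q => hw.mul_continuousOn q.continuous.continuousOn
  -- `A` is the Gram operator of the `L₂` product on a finite-dimensional space. It is injective by
  -- definiteness, hence surjective, and a preimage of the functional `q ↦ ∫ w q` is the projection.
  let A : Polynomial.degreeLT ℝ k →ₗ[ℝ] Module.Dual ℝ (Polynomial.degreeLT ℝ k) :=
    LinearMap.mk₂ ℝ (fun p q => ∫ y in a..b, (p : ℝ[X]).eval y * (q : ℝ[X]).eval y)
      (fun p p' q => by
        rw [← intervalIntegral.integral_add (hpc _ _) (hpc _ _)]
        simp [add_mul])
      (fun c p q => by
        rw [smul_eq_mul, ← intervalIntegral.integral_const_mul]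
        simp [mul_assoc])
      (fun p q q' => by
        rw [← intervalIntegral.integral_add (hpc _ _) (hpc _ _)]
        simp [mul_add])
      (fun c p q => by
        rw [smul_eq_mul, ← intervalIntegral.integral_const_mul]
        simp [mul_left_comm])
  have hinj : Function.Injective A := by
    rw [injective_iff_map_eq_zero]
    intro p hp
    have : A p p = 0 := by rw [hp]; rfl
    exact Subtype.ext (eq_zero_of_integral_sq_eq_zero hab this)
  let ℓ : Module.Dual ℝ (Polynomial.degreeLT ℝ k) :=
    { toFun := fun q => ∫ y in a..b, w y * (q : ℝ[X]).eval y
      map_add' := fun q q' => by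
        rw [← intervalIntegral.integral_add (hwc _) (hwc _)]
        simp [mul_add]
      map_smul' := fun c q => by
        rw [RingHom.id_apply, smul_eq_mul, ← intervalIntegral.integral_const_mul]
        simp [mul_left_comm] }
  have : FiniteDimensional ℝ (Polynomial.degreeLT ℝ k) :=
    (Polynomial.degreeLTEquiv ℝ k).symm.finiteDimensional
  obtain ⟨p, hp⟩ := (LinearMap.injective_iff_surjective_of_finrank_eq_finrank
    (Subspace.dual_finrank_eq (K := ℝ) (V := Polynomial.degreeLT ℝ k)).symm).1 hinj ℓ
  have hdeg : ∀ q : ℝ[X], q.natDegree < k ↔ q ∈ Polynomial.degreeLT ℝ k := fun q => by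
    rw [Polynomial.mem_degreeLT]
    rcases eq_or_ne q 0 with rfl | hq
    · simp; omega
    · exact Polynomial.natDegree_lt_iff_degree_lt hq
  refine ⟨p, (hdeg p).2 p.2, fun q hq => ?_⟩
  have h1 : ∫ y in a..b, (p : ℝ[X]).eval y * q.eval y = ∫ y in a..b, w y * q.eval y :=
    DFunLike.congr_fun hp ⟨q, (hdeg q).1 hq⟩
  simp only [sub_mul]
  rw [intervalIntegral.integral_sub (hwc _) (hpc _ _), h1, sub_self]

/-! ### The mesh -/

namespace Mesh

variable (M : Mesh)

lemma x_mono {i j : ℕ} (hij : i ≤ j) (hj : j ≤ M.nt) : M.x i ≤ M.x j := by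
  induction j, hij using Nat.le_induction with
  | base => exact le_rfl
  | succ j _ ih => exact (ih (by omega)).trans (M.x_lt j (by omega)).le

lemma x_mem {j : ℕ} (hj : j ≤ M.nt) : M.x j ∈ Icc (0 : ℝ) 1 := by
  refine ⟨?_, ?_⟩
  · rw [← M.x_zero]; exact M.x_mono (Nat.zero_le _) hj
  · rw [← M.x_last]; exact M.x_mono hj le_rfl

lemma cell_subset {j : ℕ} (hj : j < M.nt) : Icc (M.x j) (M.x (j + 1)) ⊆ Icc 0 1 :=
  Icc_subset_Icc (M.x_mem hj.le).1 (M.x_mem hj).2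

lemma sub_le_h {j : ℕ} (hj : j < M.nt) : M.x (j + 1) - M.x j ≤ M.h :=
  Finset.le_sup' (fun j => M.x (j + 1) - M.x j) (Finset.mem_range.2 hj)

lemma h_pos : 0 < M.h := (sub_pos.2 (M.x_lt 0 M.nt_pos)).trans_le (M.sub_le_h M.nt_pos)

lemma exists_cell {y : ℝ} (hy : y ∈ Icc (0 : ℝ) 1) :
    ∃ j < M.nt, y ∈ Icc (M.x j) (M.x (j + 1)) := by
  have key : ∀ n ≤ M.nt, 1 ≤ n → y ≤ M.x n → ∃ j < n, y ∈ Icc (M.x j) (M.x (j + 1)) := by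
    intro n hn h1
    induction n, h1 using Nat.le_induction with
    | base => exact fun h => ⟨0, one_pos, by rw [M.x_zero]; exact hy.1, h⟩
    | succ n _ ih =>
      intro h
      rcases le_total y (M.x n) with h' | h'
      · obtain ⟨j, hj, hj'⟩ := ih (by omega) h'
        exact ⟨j, by omega, hj'⟩
      · exact ⟨n, by omega, h', h⟩
  exact key M.nt le_rfl M.nt_pos (by rw [M.x_last]; exact hy.2)

/-- The set of nodes. -/
def nodes : Set ℝ := M.x '' Iic M.nt

lemma nodes_countable : M.nodes.Countable := ((finite_Iic M.nt).image M.x).countable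

lemma exists_open_cell {y : ℝ} (hy : y ∈ Ioo (0 : ℝ) 1 \ M.nodes) :
    ∃ j < M.nt, y ∈ Ioo (M.x j) (M.x (j + 1)) := by
  obtain ⟨j, hj, h⟩ := M.exists_cell (Ioo_subset_Icc_self hy.1)
  refine ⟨j, hj, lt_of_le_of_ne h.1 fun he => hy.2 ⟨j, hj.le, he⟩,
    lt_of_le_of_ne h.2 fun he => hy.2 ⟨j + 1, hj, he.symm⟩⟩

lemma sum_integral {f : ℝ → ℝ} (hf : Integrable f μΩ) :
    ∑ j ∈ Finset.range M.nt, ∫ y in M.x j..M.x (j + 1), f y = ∫ y in (0 : ℝ)..1, f y := by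
  rw [intervalIntegral.sum_integral_adjacent_intervals, M.x_zero, M.x_last]
  exact fun j hj => intervalIntegrable_of_integrable hf (M.x_mem hj.le) (M.x_mem hj)

/-- Summation of local `L₂` estimates. -/
lemma nrm_le_of_cells {f g : ℝ → ℝ} (hf : MemLp f 2 μΩ) (hg : MemLp g 2 μΩ) {c : ℝ} (hc : 0 ≤ c)
    (h : ∀ j < M.nt, ∫ y in M.x j..M.x (j + 1), f y ^ 2 ≤
      c ^ 2 * ∫ y in M.x j..M.x (j + 1), g y ^ 2) : nrm f ≤ c * nrm g := by
  have hi : ∀ {f : ℝ → ℝ}, MemLp f 2 μΩ → Integrable (fun y => f y ^ 2) μΩ := fun hf => by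
    simpa only [sq] using integrable_mul_of_memLp hf hf
  rw [nrm, nrm, ip_self_eq, ip_self_eq]
  refine Real.sqrt_le_iff.2 ⟨by positivity, ?_⟩
  rw [mul_pow, Real.sq_sqrt (intervalIntegral.integral_nonneg zero_le_one fun _ _ => sq_nonneg _),
    ← M.sum_integral (hi hf), ← M.sum_integral (hi hg), Finset.mul_sum]
  exact Finset.sum_le_sum fun j hj => h j (Finset.mem_range.1 hj)

end Mesh

lemma intervalIntegral_congr_Ioo {f g : ℝ → ℝ} {a b : ℝ} (hab : a ≤ b)
    (h : ∀ y ∈ Ioo a b, f y = g y) : ∫ y in a..b, f y = ∫ y in a..b, g y := by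
  rw [intervalIntegral.integral_of_le hab, intervalIntegral.integral_of_le hab,
    integral_Ioc_eq_integral_Ioo, integral_Ioc_eq_integral_Ioo]
  exact setIntegral_congr_fun measurableSet_Ioo h

/-! ### The finite element space -/

namespace MemS

variable {M : Mesh} {k : ℕ} {W W' : ℝ → ℝ}

lemma combination (h : MemS M k W) (h' : MemS M k W') (a b : ℝ) :
    MemS M k (fun y => a * W y + b * W' y) := by
  refine ⟨(continuousOn_const.mul h.cont).add (continuousOn_const.mul h'.cont),
    by simp [h.left, h'.left], by simp [h.right, h'.right], fun j hj => ?_⟩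
  obtain ⟨p, hp, he⟩ := h.poly j hj
  obtain ⟨q, hq, he'⟩ := h'.poly j hj
  refine ⟨Polynomial.C a * p + Polynomial.C b * q, ?_, fun y hy => by simp [he y hy, he' y hy]⟩
  exact (Polynomial.natDegree_add_le _ _).trans (max_le
    ((Polynomial.natDegree_C_mul_le _ _).trans hp) ((Polynomial.natDegree_C_mul_le _ _).trans hq))

lemma hasDerivAt_of_poly {p : ℝ[X]} {a b : ℝ} (he : ∀ y ∈ Icc a b, W y = p.eval y) {y : ℝ}
    (hy : y ∈ Ioo a b) : HasDerivAt W ((Polynomial.derivative p).eval y) y := by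
  refine (p.hasDerivAt y).congr_of_eventuallyEq ?_
  filter_upwards [Icc_mem_nhds hy.1 hy.2] with z hz using he z hz

lemma hasDerivAt (h : MemS M k W) {y : ℝ} (hy : y ∈ Ioo (0 : ℝ) 1 \ M.nodes) :
    HasDerivAt W (deriv W y) y := by
  obtain ⟨j, hj, hy'⟩ := M.exists_open_cell hy
  obtain ⟨p, -, he⟩ := h.poly j hj
  exact (hasDerivAt_of_poly he hy').differentiableAt.hasDerivAt

/-- On each open cell `deriv W` is the derivative of a polynomial, hence bounded; its values at the
nodes are irrelevant because these form a null set. -/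
lemma memLp_deriv (h : MemS M k W) : MemLp (deriv W) 2 μΩ := by
  have h1 : ∀ j, ∃ C : ℝ, 0 ≤ C ∧ (j < M.nt → ∀ y ∈ Ioo (M.x j) (M.x (j + 1)), |deriv W y| ≤ C) := by
    intro j
    by_cases hj : j < M.nt
    · obtain ⟨p, -, he⟩ := h.poly j hj
      obtain ⟨C, hC⟩ := isCompact_Icc.exists_bound_of_continuousOn
        (Polynomial.derivative p).continuous.continuousOn (s := Icc (M.x j) (M.x (j + 1)))
      refine ⟨max C 0, le_max_right _ _, fun _ y hy => ?_⟩
      rw [(hasDerivAt_of_poly he hy).deriv]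
      exact (hC y (Ioo_subset_Icc_self hy)).trans (le_max_left _ _)
    · exact ⟨0, le_rfl, fun h => absurd h hj⟩
  choose C hC0 hC using h1
  refine MemLp.of_bound (measurable_deriv W).aestronglyMeasurable
    (∑ j ∈ Finset.range M.nt, C j) ?_
  have hn : ∀ᵐ y ∂μΩ, y ∉ M.nodes :=
    ae_restrict_of_ae (measure_eq_zero_iff_ae_notMem.1 (M.nodes_countable.measure_zero _))
  filter_upwards [ae_restrict_mem measurableSet_Ioo, hn] with y hy hy'
  obtain ⟨j, hj, h⟩ := M.exists_open_cell ⟨hy, hy'⟩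
  exact (hC j hj y h).trans
    (Finset.single_le_sum (fun i _ => hC0 i) (Finset.mem_range.2 hj))

lemma isPrimitive (h : MemS M k W) : IsPrimitive W (deriv W) := by
  refine ⟨h.memLp_deriv, fun y hy => ?_⟩
  rw [integral_eq_of_hasDerivAt_off_countable_of_le W (deriv W) hy.1 M.nodes_countable
    (h.cont.mono (Icc_subset_Icc_right hy.2))
    (fun z hz => h.hasDerivAt ⟨⟨hz.1.1, hz.1.2.trans_le hy.2⟩, hz.2⟩)
    (intervalIntegrable_of_memLp h.memLp_deriv (by simp) hy)]
  ring

lemma memLp (h : MemS M k W) : MemLp W 2 μΩ := h.isPrimitive.memLp_self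

lemma memH10 (h : MemS M k W) : MemH10 W (deriv W) := h.isPrimitive.memH10 h.left h.right

lemma deriv_combination (h : MemS M k W) (h' : MemS M k W') (a b : ℝ) :
    deriv (fun y => a * W y + b * W' y) =ᵐ[μΩ] fun y => a * deriv W y + b * deriv W' y := by
  have hn : ∀ᵐ y ∂μΩ, y ∉ M.nodes :=
    ae_restrict_of_ae (measure_eq_zero_iff_ae_notMem.1 (M.nodes_countable.measure_zero _))
  filter_upwards [ae_restrict_mem measurableSet_Ioo, hn] with y hy hy'
  exact (((h.hasDerivAt ⟨hy, hy'⟩).const_mul a).add ((h'.hasDerivAt ⟨hy, hy'⟩).const_mul b)).deriv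

/-- On each cell the derivative is a polynomial. -/
lemma exists_deriv_poly (h : MemS M k W) (hk : 1 ≤ k) {j : ℕ} (hj : j < M.nt) :
    ∃ q : ℝ[X], q.natDegree < k ∧ ∀ y ∈ Ioo (M.x j) (M.x (j + 1)), deriv W y = q.eval y := by
  obtain ⟨p, hp, he⟩ := h.poly j hj
  exact ⟨Polynomial.derivative p, by
    have := Polynomial.natDegree_derivative_le p; omega,
    fun y hy => (hasDerivAt_of_poly he hy).deriv⟩

end MemS

/-! ### Lagrange interpolation -/

lemma LagrangePoints.mem_cell {M : Mesh} {k : ℕ} (ξ : LagrangePoints M k) {j r : ℕ} (hj : j < M.nt)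
    (hr : r ≤ k) : ξ.pt j r ∈ Icc (M.x j) (M.x (j + 1)) := by
  have key : ∀ r s, r ≤ s → s ≤ k → ξ.pt j r ≤ ξ.pt j s := by
    intro r s hrs
    induction s, hrs using Nat.le_induction with
    | base => exact fun _ => le_rfl
    | succ s _ ih => exact fun h => (ih (by omega)).trans (ξ.lt j hj s (by omega)).le
  rw [← ξ.first j hj, ← ξ.last j hj]
  exact ⟨key 0 r (Nat.zero_le _) hr, key r k hr le_rfl⟩

lemma pow_le_h_pow (M : Mesh) {j : ℕ} (hj : j < M.nt) (m : ℕ) {I : ℝ} (hI : 0 ≤ I) :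
    ((M.x (j + 1) - M.x j) ^ m) ^ 2 * I ≤ (M.h ^ m) ^ 2 * I := by
  have := sub_nonneg.2 (M.x_lt j hj).le
  have h2 := M.sub_le_h hj
  gcongr

lemma cell_integral_sq_nonneg (M : Mesh) {j : ℕ} (hj : j < M.nt) (f : ℝ → ℝ) :
    0 ≤ ∫ y in M.x j..M.x (j + 1), f y ^ 2 :=
  intervalIntegral.integral_nonneg (M.x_lt j hj).le fun _ _ => sq_nonneg _

/-- Interpolation reads point values, which is why `u` has to equal the representative `f 0`
everywhere on `[0,1]` and not merely almost everywhere. -/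
lemma IsInterpolant.nrm_sub_le {M : Mesh} {k : ℕ} {ξ : LagrangePoints M k} {u I : ℝ → ℝ}
    (hI : IsInterpolant ξ u I) {f : ℕ → ℝ → ℝ} (hf : ∀ j ≤ k, IsPrimitive (f j) (f (j + 1)))
    (hu : EqOn u (f 0) (Icc 0 1)) :
    nrm (fun y => I y - f 0 y) ≤ M.h ^ (k + 1) * nrm (f (k + 1)) := by
  refine M.nrm_le_of_cells (hI.1.memLp.sub (hf 0 (Nat.zero_le _)).memLp_self) (hf k le_rfl).memLp
    (pow_nonneg M.h_pos.le _) fun j hj => ?_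
  obtain ⟨p, hp, he⟩ := hI.1.poly j hj
  have h1 := (interpolation_error (M.x_mem hj.le) (M.x_mem hj) (M.x_lt j hj).le hf hp
    (x := ξ.pt j) (ξ.lt j hj) (fun r hr => ξ.mem_cell hj hr) (fun r hr => by
      rw [← he _ (ξ.mem_cell hj hr), hI.2 j hj r hr, hu (M.cell_subset hj (ξ.mem_cell hj hr))])).1
  refine le_trans (le_of_eq ?_) (h1.trans (pow_le_h_pow M hj _ (cell_integral_sq_nonneg M hj _)))
  refine intervalIntegral_congr_Ioo (M.x_lt j hj).le fun y hy => ?_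
  rw [Pi.sub_apply, he y (Ioo_subset_Icc_self hy)]
  ring

/-! ### The Ritz projection -/

/-- `Q ∈ S_h^k` is the Ritz projection of `u`: it coincides with `u` at the nodes, and `∂Q` is on
each cell the `L₂` projection of `u'` onto polynomials of degree less than `k`. -/
structure IsRitz (M : Mesh) (k : ℕ) (u u' Q : ℝ → ℝ) : Prop where
  mem : MemS M k Q
  node : ∀ j ≤ M.nt, Q (M.x j) = u (M.x j)
  orth : ∀ j < M.nt, ∀ q : ℝ[X], q.natDegree < k →
    ∫ y in M.x j..M.x (j + 1), (u' y - deriv Q y) * q.eval y = 0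

/-- The construction is cell by cell: project `u'` onto polynomials of degree less than `k` and
integrate from the value of `u` at the left node. The pieces match at the nodes because the
projection preserves the integral of `u'` over the cell. -/
lemma exists_isRitz (M : Mesh) {k : ℕ} (hk : 1 ≤ k) {u u' : ℝ → ℝ} (h : IsPrimitive u u')
    (h0 : u 0 = 0) (h1 : u 1 = 0) : ∃ Q, IsRitz M k u u' Q := by
  have hloc : ∀ j, ∃ P : ℝ[X], P.natDegree ≤ k ∧ (j < M.nt → P.eval (M.x j) = u (M.x j) ∧
      P.eval (M.x (j + 1)) = u (M.x (j + 1)) ∧ ∀ q : ℝ[X], q.natDegree < k →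
      ∫ y in M.x j..M.x (j + 1), (u' y - (Polynomial.derivative P).eval y) * q.eval y = 0) := by
    intro j
    by_cases hj : j < M.nt
    · obtain ⟨p, hp, hpq⟩ := exists_polynomial_projection (M.x_lt j hj) hk
        (intervalIntegrable_of_memLp h.memLp (M.x_mem hj.le) (M.x_mem hj))
      obtain ⟨P, hP, hd, hPa⟩ := exists_antiderivative hp (M.x j) (u (M.x j))
      refine ⟨P, hP, fun _ => ⟨hPa, ?_, by rw [hd]; exact hpq⟩⟩
      -- Orthogonality to the constant `1`, admissible since `k ≥ 1`, gives the right value at the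
      -- right end of the cell.
      have h2 := hpq 1 (by simp; omega)
      simp only [Polynomial.eval_one, mul_one] at h2
      rw [intervalIntegral.integral_sub
        (intervalIntegrable_of_memLp h.memLp (M.x_mem hj.le) (M.x_mem hj))
        (p.continuous.intervalIntegrable _ _), ← h.sub_eq (M.x_mem hj.le) (M.x_mem hj), ← hd,
        intervalIntegral.integral_eq_sub_of_hasDerivAt (fun y _ => P.hasDerivAt y)
        ((Polynomial.continuous _).intervalIntegrable _ _), hPa] at h2
      linarith
    · exact ⟨0, by simp, fun h => absurd h hj⟩
  choose P hPk hP using hloc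
  -- Clamping `y` to each cell writes `Q` as a sum of continuous increments. For `y` in cell `j`,
  -- earlier cells contribute their full increment, later ones nothing, and the sum telescopes from
  -- `u 0 = 0`.
  let c : ℕ → ℝ → ℝ := fun i y => max (M.x i) (min y (M.x (i + 1)))
  let Q : ℝ → ℝ := fun y => ∑ i ∈ Finset.range M.nt, ((P i).eval (c i y) - (P i).eval (M.x i))
  have hQc : Continuous Q := by
    refine continuous_finsetSum _ fun i _ => Continuous.sub ?_ continuous_const
    exact (P i).continuous.comp (by fun_prop)
  have hQ : ∀ j < M.nt, ∀ y ∈ Icc (M.x j) (M.x (j + 1)), Q y = (P j).eval y := by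
    intro j hj y hy
    have hcell : ∀ i ∈ Finset.range M.nt, (P i).eval (c i y) - (P i).eval (M.x i) =
        if i < j then u (M.x (i + 1)) - u (M.x i) else
          if i = j then (P j).eval y - u (M.x j) else 0 := by
      intro i hi
      have hi' := Finset.mem_range.1 hi
      split_ifs with h1 h2
      · have : M.x (i + 1) ≤ y := (M.x_mono (show i + 1 ≤ j by omega) hj.le).trans hy.1
        simp only [c]
        rw [min_eq_right this, max_eq_right (M.x_lt i hi').le, (hP i hi').1, (hP i hi').2.1]
      · subst h2
        simp only [c]
        rw [min_eq_left hy.2, max_eq_right hy.1, (hP i hi').1]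
      · have : y ≤ M.x i := hy.2.trans (M.x_mono (show j + 1 ≤ i by omega) hi'.le)
        simp only [c]
        rw [max_eq_left ((min_le_left _ _).trans this), sub_self]
    show ∑ i ∈ Finset.range M.nt, ((P i).eval (c i y) - (P i).eval (M.x i)) = _
    rw [Finset.sum_congr rfl hcell, ← Finset.sum_range_add_sum_Ico _ hj, Finset.sum_range_succ]
    have e1 : ∑ i ∈ Finset.range j, (if i < j then u (M.x (i + 1)) - u (M.x i) else
          if i = j then (P j).eval y - u (M.x j) else 0) = u (M.x j) - u (M.x 0) := by
      rw [← Finset.sum_range_sub (fun i => u (M.x i)) j]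
      exact Finset.sum_congr rfl fun i hi => if_pos (Finset.mem_range.1 hi)
    have e2 : ∑ i ∈ Finset.Ico (j + 1) M.nt, (if i < j then u (M.x (i + 1)) - u (M.x i) else
          if i = j then (P j).eval y - u (M.x j) else 0) = 0 := by
      refine Finset.sum_eq_zero fun i hi => ?_
      have := (Finset.mem_Ico.1 hi).1
      rw [if_neg (by omega), if_neg (by omega)]
    rw [e1, e2, if_neg (lt_irrefl j), if_pos rfl, M.x_zero, h0]
    ring
  have hnode : ∀ j ≤ M.nt, Q (M.x j) = u (M.x j) := by
    intro j hj
    rcases hj.lt_or_eq with hj | rfl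
    · rw [hQ j hj _ ⟨le_rfl, (M.x_lt j hj).le⟩, (hP j hj).1]
    · obtain ⟨n, hn⟩ : ∃ n, M.nt = n + 1 := ⟨M.nt - 1, by have := M.nt_pos; omega⟩
      have hn' : n < M.nt := by omega
      rw [hn, hQ n hn' _ ⟨(M.x_lt n hn').le, le_rfl⟩, (hP n hn').2.1]
  refine ⟨Q, ⟨hQc.continuousOn, ?_, ?_, fun j hj => ⟨P j, hPk j, hQ j hj⟩⟩, hnode,
    fun j hj q hq => ?_⟩
  · rw [← M.x_zero, hnode 0 (Nat.zero_le _), M.x_zero, h0]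
  · rw [← M.x_last, hnode _ le_rfl, M.x_last, h1]
  · rw [← (hP j hj).2.2 q hq]
    refine intervalIntegral_congr_Ioo (M.x_lt j hj).le fun y hy => ?_
    rw [(MemS.hasDerivAt_of_poly (hQ j hj) hy).deriv]

namespace IsRitz

variable {M : Mesh} {k : ℕ} {u u' w w' Q Q' : ℝ → ℝ}

/-- The derivative of a finite element function is, on each cell, one of the polynomials admitted in
`orth`. This orthogonality removes the Ritz error from the diffusion term. -/
lemma ip_deriv_eq_zero (h : IsRitz M k u u' Q) (hk : 1 ≤ k) (hu' : MemLp u' 2 μΩ) {W : ℝ → ℝ}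
    (hW : MemS M k W) : ip (fun y => u' y - deriv Q y) (deriv W) = 0 := by
  have hm : MemLp (fun y => u' y - deriv Q y) 2 μΩ := hu'.sub h.mem.memLp_deriv
  rw [ip, integral_μΩ, ← M.sum_integral (integrable_mul_of_memLp hm hW.memLp_deriv)]
  refine Finset.sum_eq_zero fun j hj => ?_
  have hj' := Finset.mem_range.1 hj
  obtain ⟨q, hq, he⟩ := hW.exists_deriv_poly hk hj'
  rw [← h.orth j hj' q hq]
  refine intervalIntegral_congr_Ioo (M.x_lt j hj').le fun y hy => ?_
  rw [he y hy]

lemma congr_fun (h : IsRitz M k u u' Q) (hu : EqOn u w (Icc 0 1)) (hu' : u' =ᵐ[μΩ] w') :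
    IsRitz M k w w' Q := by
  refine ⟨h.mem, fun j hj => by rw [h.node j hj, hu (M.x_mem hj)], fun j hj q hq => ?_⟩
  rw [← h.orth j hj q hq, intervalIntegral.integral_of_le (M.x_lt j hj).le,
    intervalIntegral.integral_of_le (M.x_lt j hj).le, integral_Ioc_eq_integral_Ioo,
    integral_Ioc_eq_integral_Ioo]
  refine integral_congr_ae ?_
  have := ae_restrict_of_ae_restrict_of_subset
    (Ioo_subset_Ioo (M.x_mem hj.le).1 (M.x_mem hj).2) hu'
  filter_upwards [this] with y hy
  rw [hy]

/-- By linearity, averages and difference quotients in time of Ritz projections are the Ritz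
projections of the averages and difference quotients. -/
lemma combination (h : IsRitz M k u u' Q) (h' : IsRitz M k w w' Q') (hu' : MemLp u' 2 μΩ)
    (hw' : MemLp w' 2 μΩ) (a b : ℝ) : IsRitz M k (fun y => a * u y + b * w y)
      (fun y => a * u' y + b * w' y) (fun y => a * Q y + b * Q' y) := by
  refine ⟨h.mem.combination h'.mem a b, fun j hj => by rw [h.node j hj, h'.node j hj],
    fun j hj q hq => ?_⟩
  have hq' : MemLp (fun y => q.eval y) 2 μΩ := (isPrimitive_eval q).memLp_self
  have e : ∫ y in M.x j..M.x (j + 1), (a * u' y + b * w' y -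
      deriv (fun y => a * Q y + b * Q' y) y) * q.eval y = ∫ y in M.x j..M.x (j + 1),
      (a * ((u' y - deriv Q y) * q.eval y) + b * ((w' y - deriv Q' y) * q.eval y)) := by
    refine intervalIntegral_congr_Ioo (M.x_lt j hj).le fun y hy => ?_
    obtain ⟨p, -, he⟩ := h.mem.poly j hj
    obtain ⟨p', -, he'⟩ := h'.mem.poly j hj
    have d1 := (MemS.hasDerivAt_of_poly he hy).differentiableAt.hasDerivAt
    have d2 := (MemS.hasDerivAt_of_poly he' hy).differentiableAt.hasDerivAt
    have d3 : deriv (fun y => a * Q y + b * Q' y) y = a * deriv Q y + b * deriv Q' y :=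
      ((d1.const_mul a).add (d2.const_mul b)).deriv
    rw [d3]
    ring
  rw [e, intervalIntegral.integral_add, intervalIntegral.integral_const_mul,
    intervalIntegral.integral_const_mul, h.orth j hj q hq, h'.orth j hj q hq]
  · simp
  · exact (intervalIntegrable_mul (hu'.sub h.mem.memLp_deriv) hq' (M.x_mem hj.le)
      (M.x_mem hj)).const_mul a
  · exact (intervalIntegrable_mul (hw'.sub h'.mem.memLp_deriv) hq' (M.x_mem hj.le)
      (M.x_mem hj)).const_mul b

/-- The error of the Ritz projection in `L₂(Ω)`. -/
lemma nrm_sub_le {f : ℕ → ℝ → ℝ} (h : IsRitz M k (f 0) (f 1) Q) (ξ : LagrangePoints M k)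
    (hk : 1 ≤ k) (hf : ∀ j ≤ k, IsPrimitive (f j) (f (j + 1))) :
    nrm (fun y => Q y - f 0 y) ≤ M.h ^ (k + 1) * nrm (f (k + 1)) := by
  have hp : IsPrimitive (fun y => Q y - f 0 y) (fun y => deriv Q y - f 1 y) :=
    h.mem.isPrimitive.sub (hf 0 (Nat.zero_le _))
  have hf1 : MemLp (f 1) 2 μΩ := (hf 0 (Nat.zero_le _)).memLp
  refine M.nrm_le_of_cells hp.memLp_self (hf k le_rfl).memLp
    (pow_nonneg M.h_pos.le _) fun j hj => ?_
  have ha := M.x_mem hj.le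
  have hb := M.x_mem (j := j + 1) hj
  have hab := (M.x_lt j hj).le
  -- The error vanishes at the left node, so it is bounded by the cell length times the derivative
  -- error: this supplies the extra power of `h`.
  have h1 := chain_integral_sq_le ha hb hab 0
    (F := fun i => if i = 0 then fun y => Q y - f 0 y else fun y => deriv Q y - f 1 y)
    (fun i hi => by obtain rfl := Nat.le_zero.1 hi; simpa using hp)
    (fun i hi => by
      obtain rfl := Nat.le_zero.1 hi
      exact ⟨M.x j, ⟨le_rfl, hab⟩, by simp [h.node j hj.le]⟩)
  simp only [if_true, zero_add, one_ne_zero, if_false, pow_one] at h1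
  obtain ⟨p, hpk, hpe⟩ := exists_interpolating_polynomial (ξ.lt j hj) (fun r => f 0 (ξ.pt j r))
  have h2 := (interpolation_error ha hb hab hf hpk (ξ.lt j hj)
    (fun r hr => ξ.mem_cell hj hr) hpe).2 hk
  obtain ⟨q, hq, hqe⟩ := h.mem.exists_deriv_poly hk hj
  set p' := Polynomial.derivative p
  have hp' : p'.natDegree < k := by
    have : p'.natDegree ≤ p.natDegree - 1 := Polynomial.natDegree_derivative_le p
    omega
  -- `deriv Q` is the best `L₂` approximation of `f 1` on the cell, so by Pythagoras it may be
  -- replaced by the derivative of a Lagrange interpolant. The points `ξ` serve only this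
  -- comparison.
  have h3 : ∫ y in M.x j..M.x (j + 1), (deriv Q y - f 1 y) ^ 2 ≤
      ∫ y in M.x j..M.x (j + 1), (f 1 y - p'.eval y) ^ 2 := by
    have hqp : (q - p').natDegree < k :=
      (Polynomial.natDegree_sub_le _ _).trans_lt (max_lt hq hp')
    have hm : MemLp (fun y => (q - p').eval y) 2 μΩ := (isPrimitive_eval _).memLp_self
    have e : ∫ y in M.x j..M.x (j + 1), (f 1 y - p'.eval y) ^ 2 = ∫ y in M.x j..M.x (j + 1),
        ((deriv Q y - f 1 y) ^ 2 + 2 * ((f 1 y - deriv Q y) * (q - p').eval y) +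
          (q - p').eval y ^ 2) := by
      refine intervalIntegral_congr_Ioo hab fun y hy => ?_
      rw [hqe y hy, Polynomial.eval_sub]
      ring
    have i1 := intervalIntegrable_sq hp.memLp ha hb
    have hd : MemLp (fun y => f 1 y - deriv Q y) 2 μΩ := hf1.sub h.mem.memLp_deriv
    have i2 := (intervalIntegrable_mul hd hm ha hb).const_mul 2
    have i3 := intervalIntegrable_sq hm ha hb
    rw [e, intervalIntegral.integral_add (i1.add i2) i3, intervalIntegral.integral_add i1 i2,
      intervalIntegral.integral_const_mul]
    have h4 := h.orth j hj _ hqp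
    have h5 := cell_integral_sq_nonneg M hj (fun y => (q - p').eval y)
    rw [h4]
    linarith
  have hs := sq_nonneg (M.x (j + 1) - M.x j)
  calc _ ≤ _ := h1
    _ ≤ (M.x (j + 1) - M.x j) ^ 2 * (((M.x (j + 1) - M.x j) ^ k) ^ 2 *
        ∫ y in M.x j..M.x (j + 1), f (k + 1) y ^ 2) :=
      mul_le_mul_of_nonneg_left (h3.trans h2) hs
    _ = ((M.x (j + 1) - M.x j) ^ (k + 1)) ^ 2 * ∫ y in M.x j..M.x (j + 1), f (k + 1) y ^ 2 := by
      ring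
    _ ≤ _ := pow_le_h_pow M hj _ (cell_integral_sq_nonneg M hj _)

end IsRitz

/-! ### Taylor expansions in time -/

section Time

variable {E F : Type*} [NormedAddCommGroup E] [NormedSpace ℝ E]
  [NormedAddCommGroup F] [NormedSpace ℝ F]

/-- `u : [0,T] → E` is absolutely continuous with derivative `w`. -/
def HasTimeDeriv (T : ℝ) (u w : ℝ → E) : Prop :=
  IntervalIntegrable w volume 0 T ∧ ∀ t ∈ Icc 0 T, u t = u 0 + ∫ s in (0 : ℝ)..t, w s

namespace HasTimeDeriv

variable {T R : ℝ} {u w z : ℝ → E}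

lemma intervalIntegrable (h : HasTimeDeriv T u w) {a b : ℝ} (ha : a ∈ Icc 0 T) (hb : b ∈ Icc 0 T) :
    IntervalIntegrable w volume a b := by
  refine h.1.mono_set ?_
  rw [uIcc_of_le (ha.1.trans ha.2)]
  exact uIcc_subset_Icc ha hb

lemma sub_eq (h : HasTimeDeriv T u w) {a b : ℝ} (ha : a ∈ Icc 0 T) (hb : b ∈ Icc 0 T) :
    u b - u a = ∫ s in a..b, w s := by
  have h0 : (0 : ℝ) ∈ Icc 0 T := ⟨le_rfl, ha.1.trans ha.2⟩
  rw [h.2 a ha, h.2 b hb, ← intervalIntegral.integral_add_adjacent_intervals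
    (h.intervalIntegrable h0 ha) (h.intervalIntegrable ha hb)]
  abel

/-- Applied with `L` the inner product against `testDeriv j φ`, this turns the Taylor estimates
below into estimates of spatial derivatives in dual form. -/
lemma map [CompleteSpace E] [CompleteSpace F] (h : HasTimeDeriv T u w) (hT : 0 ≤ T) (L : E →L[ℝ] F) :
    HasTimeDeriv T (fun t => L (u t)) (fun t => L (w t)) := by
  refine ⟨⟨L.integrable_comp h.1.1, L.integrable_comp h.1.2⟩, fun t ht => ?_⟩
  rw [L.intervalIntegral_comp_comm (h.intervalIntegrable ⟨le_rfl, hT⟩ ht), ← map_add, ← h.2 t ht]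

lemma norm_sub_le (h : HasTimeDeriv T u w) (hw : ∀ᵐ t ∂(volume.restrict (Ioo 0 T)), ‖w t‖ ≤ R)
    {a b : ℝ} (ha : a ∈ Icc 0 T) (hb : b ∈ Icc 0 T) : ‖u b - u a‖ ≤ R * |b - a| := by
  rw [h.sub_eq ha hb]
  refine intervalIntegral.norm_integral_le_of_norm_le_const_ae ?_
  rw [ae_restrict_iff' measurableSet_Ioo] at hw
  -- The bound is known on the open interval, while the half-open interval of integration may
  -- contain `T`.
  have hne : ∀ᵐ t : ℝ, t ≠ T := by simp [ae_iff, measure_singleton]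
  filter_upwards [hw, hne] with t ht hne hm
  exact ht ⟨(le_min ha.1 hb.1).trans_lt hm.1, lt_of_le_of_ne (hm.2.trans (max_le ha.2 hb.2)) hne⟩

lemma abs_sub_le_of_mem_uIoc {a b s : ℝ} (hs : s ∈ uIoc a b) : |s - a| ≤ |b - a| := by
  rcases le_total a b with h | h
  · rw [uIoc_of_le h] at hs
    rw [abs_of_nonneg (by linarith [hs.1]), abs_of_nonneg (by linarith)]
    linarith [hs.2]
  · rw [uIoc_of_ge h] at hs
    rw [abs_of_nonpos (by linarith [hs.2]), abs_of_nonpos (by linarith)]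
    linarith [hs.1]

lemma mem_of_mem_uIoc {a b s : ℝ} (ha : a ∈ Icc 0 T) (hb : b ∈ Icc 0 T) (hs : s ∈ uIoc a b) :
    s ∈ Icc 0 T :=
  ⟨(le_min ha.1 hb.1).trans hs.1.le, hs.2.trans (max_le ha.2 hb.2)⟩

variable [CompleteSpace E]

/-- First order Taylor expansion. -/
lemma norm_taylor_one_le (h : HasTimeDeriv T u w) (h' : HasTimeDeriv T w z) (hR : 0 ≤ R)
    (hz : ∀ᵐ t ∂(volume.restrict (Ioo 0 T)), ‖z t‖ ≤ R) {a b : ℝ} (ha : a ∈ Icc 0 T)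
    (hb : b ∈ Icc 0 T) : ‖u b - u a - (b - a) • w a‖ ≤ R * |b - a| ^ 2 := by
  have e : u b - u a - (b - a) • w a = ∫ s in a..b, (w s - w a) := by
    rw [intervalIntegral.integral_sub (h.intervalIntegrable ha hb) (by simp), ← h.sub_eq ha hb,
      intervalIntegral.integral_const]
  rw [e, sq, ← mul_assoc]
  refine intervalIntegral.norm_integral_le_of_norm_le_const fun s hs => ?_
  exact (h'.norm_sub_le hz ha (mem_of_mem_uIoc ha hb hs)).trans
    (mul_le_mul_of_nonneg_left (abs_sub_le_of_mem_uIoc hs) hR)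

/-- Second order Taylor expansion. -/
lemma norm_taylor_two_le {y : ℝ → E} (h : HasTimeDeriv T u w) (h' : HasTimeDeriv T w z)
    (h'' : HasTimeDeriv T z y) (hR : 0 ≤ R)
    (hy : ∀ᵐ t ∂(volume.restrict (Ioo 0 T)), ‖y t‖ ≤ R) {a b : ℝ} (ha : a ∈ Icc 0 T)
    (hb : b ∈ Icc 0 T) :
    ‖u b - u a - (b - a) • w a - ((b - a) ^ 2 / 2) • z a‖ ≤ R * |b - a| ^ 3 := by
  have hi : IntervalIntegrable (fun s => (s - a) • z a) volume a b :=
    Continuous.intervalIntegrable (by fun_prop) _ _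
  have e1 : ∫ s in a..b, (s - a) = (b - a) ^ 2 / 2 := by
    rw [intervalIntegral.integral_sub (by simp) (by simp), integral_id,
      intervalIntegral.integral_const, smul_eq_mul]
    ring
  have e : u b - u a - (b - a) • w a - ((b - a) ^ 2 / 2) • z a =
      ∫ s in a..b, (w s - w a - (s - a) • z a) := by
    rw [intervalIntegral.integral_sub ((h.intervalIntegrable ha hb).sub (by simp)) hi,
      intervalIntegral.integral_sub (h.intervalIntegrable ha hb) (by simp), ← h.sub_eq ha hb,
      intervalIntegral.integral_const, intervalIntegral.integral_smul_const, e1]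
  rw [e, pow_succ, ← mul_assoc]
  refine intervalIntegral.norm_integral_le_of_norm_le_const fun s hs => ?_
  refine (h'.norm_taylor_one_le h'' hR hy ha (mem_of_mem_uIoc ha hb hs)).trans
    (mul_le_mul_of_nonneg_left ?_ hR)
  exact pow_le_pow_left₀ (abs_nonneg _) (abs_sub_le_of_mem_uIoc hs) 2

/-- Error of the average as an approximation of the midpoint value. -/
lemma norm_avg_sub_le (h : HasTimeDeriv T u w) (h' : HasTimeDeriv T w z) (hR : 0 ≤ R)
    (hz : ∀ᵐ t ∂(volume.restrict (Ioo 0 T)), ‖z t‖ ≤ R) {a δ : ℝ} (hδ : 0 ≤ δ)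
    (ha : a ∈ Icc 0 T) (hb : a + δ ∈ Icc 0 T) :
    ‖(1 / 2 : ℝ) • (u (a + δ) + u a) - u (a + δ / 2)‖ ≤ R * δ ^ 2 := by
  have hm : a + δ / 2 ∈ Icc 0 T := ⟨by linarith [ha.1], by linarith [hb.2]⟩
  have h1 := h.norm_taylor_one_le h' hR hz hm ha
  have h2 := h.norm_taylor_one_le h' hR hz hm hb
  have e1 : |a - (a + δ / 2)| = δ / 2 := by rw [abs_of_nonpos (by linarith)]; ring
  have e2 : |a + δ - (a + δ / 2)| = δ / 2 := by rw [abs_of_nonneg (by linarith)]; ring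
  rw [e1] at h1
  rw [e2] at h2
  have e : (1 / 2 : ℝ) • (u (a + δ) + u a) - u (a + δ / 2) =
      (1 / 2 : ℝ) • ((u a - u (a + δ / 2) - (a - (a + δ / 2)) • w (a + δ / 2)) +
        (u (a + δ) - u (a + δ / 2) - (a + δ - (a + δ / 2)) • w (a + δ / 2))) := by
    module
  rw [e, norm_smul, Real.norm_of_nonneg (by norm_num)]
  have h3 := norm_add_le (u a - u (a + δ / 2) - (a - (a + δ / 2)) • w (a + δ / 2))
    (u (a + δ) - u (a + δ / 2) - (a + δ - (a + δ / 2)) • w (a + δ / 2))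
  have : 0 ≤ R * δ ^ 2 := by positivity
  nlinarith

/-- Error of the central difference quotient. -/
lemma norm_diffQuot_sub_le {y : ℝ → E} (h : HasTimeDeriv T u w) (h' : HasTimeDeriv T w z)
    (h'' : HasTimeDeriv T z y) (hR : 0 ≤ R)
    (hy : ∀ᵐ t ∂(volume.restrict (Ioo 0 T)), ‖y t‖ ≤ R) {a δ : ℝ} (hδ : 0 < δ)
    (ha : a ∈ Icc 0 T) (hb : a + δ ∈ Icc 0 T) :
    ‖δ⁻¹ • (u (a + δ) - u a) - w (a + δ / 2)‖ ≤ R * δ ^ 2 := by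
  have hm : a + δ / 2 ∈ Icc 0 T := ⟨by linarith [ha.1], by linarith [hb.2]⟩
  have h1 := h.norm_taylor_two_le h' h'' hR hy hm ha
  have h2 := h.norm_taylor_two_le h' h'' hR hy hm hb
  have e1 : |a - (a + δ / 2)| = δ / 2 := by rw [abs_of_nonpos (by linarith)]; ring
  have e2 : |a + δ - (a + δ / 2)| = δ / 2 := by rw [abs_of_nonneg (by linarith)]; ring
  rw [e1] at h1
  rw [e2] at h2
  set p := u a - u (a + δ / 2) - (a - (a + δ / 2)) • w (a + δ / 2) -
    ((a - (a + δ / 2)) ^ 2 / 2) • z (a + δ / 2) with hp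
  set q := u (a + δ) - u (a + δ / 2) - (a + δ - (a + δ / 2)) • w (a + δ / 2) -
    ((a + δ - (a + δ / 2)) ^ 2 / 2) • z (a + δ / 2) with hq
  -- The expansions are centred at the midpoint, so their second order terms coincide and cancel in
  -- `q - p`.
  have e : δ⁻¹ • (u (a + δ) - u a) - w (a + δ / 2) = δ⁻¹ • (q - p) := by
    have : q - p = u (a + δ) - u a - δ • w (a + δ / 2) := by rw [hp, hq]; module
    rw [this, smul_sub _ (u (a + δ) - u a), smul_smul, inv_mul_cancel₀ hδ.ne', one_smul]
  rw [e, norm_smul, Real.norm_of_nonneg (by positivity)]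
  have h3 := _root_.norm_sub_le q p
  have h4 : ‖q - p‖ ≤ δ * (R * δ ^ 2) := by
    have : 0 ≤ R * δ ^ 3 := by positivity
    nlinarith
  calc δ⁻¹ * ‖q - p‖ ≤ δ⁻¹ * (δ * (R * δ ^ 2)) := by gcongr
    _ = R * δ ^ 2 := by rw [← mul_assoc, inv_mul_cancel₀ hδ.ne', one_mul]

/-- Error of the extrapolation to the midpoint of the next time interval. -/
lemma norm_extrap_sub_le (h : HasTimeDeriv T u w) (h' : HasTimeDeriv T w z) (hR : 0 ≤ R)
    (hz : ∀ᵐ t ∂(volume.restrict (Ioo 0 T)), ‖z t‖ ≤ R) {a δ : ℝ} (hδ : 0 ≤ δ)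
    (ha : a ∈ Icc 0 T) (ha' : a - δ ∈ Icc 0 T) (hb : a + δ / 2 ∈ Icc 0 T) :
    ‖(3 / 2 : ℝ) • u a - (1 / 2 : ℝ) • u (a - δ) - u (a + δ / 2)‖ ≤ R * δ ^ 2 := by
  have h1 := h.norm_taylor_one_le h' hR hz ha ha'
  have h2 := h.norm_taylor_one_le h' hR hz ha hb
  have e1 : |a - δ - a| = δ := by rw [abs_of_nonpos (by linarith)]; ring
  have e2 : |a + δ / 2 - a| = δ / 2 := by rw [abs_of_nonneg (by linarith)]; ring
  rw [e1] at h1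
  rw [e2] at h2
  set p := u (a - δ) - u a - (a - δ - a) • w a with hp
  set q := u (a + δ / 2) - u a - (a + δ / 2 - a) • w a with hq
  have e : (3 / 2 : ℝ) • u a - (1 / 2 : ℝ) • u (a - δ) - u (a + δ / 2) =
      -((1 / 2 : ℝ) • p + q) := by rw [hp, hq]; module
  rw [e, norm_neg]
  have h3 := norm_add_le ((1 / 2 : ℝ) • p) q
  rw [norm_smul, Real.norm_of_nonneg (by norm_num)] at h3
  have : 0 ≤ R * δ ^ 2 := by positivity
  nlinarith

end HasTimeDeriv

end Time

lemma exists_of_ae_Ioo {T : ℝ} (hT : 0 < T) {p : ℝ → Prop}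
    (h : ∀ᵐ t ∂(volume.restrict (Ioo 0 T)), p t) : ∃ t ∈ Ioo 0 T, p t := by
  have : (ae (volume.restrict (Ioo 0 T))).NeBot := by
    rw [ae_neBot, Ne, Measure.restrict_eq_zero]
    simp [hT]
  obtain ⟨t, h1, h2⟩ := (h.and (ae_restrict_mem measurableSet_Ioo)).exists
  exact ⟨t, h2, h1⟩

/-! ### Bounds of the representatives of a solution -/

/-- The Sobolev embedding of `H¹` in the continuous functions: average `|f x| ≤ |f y| + nrm f'` over
`y`. -/
lemma IsPrimitive.abs_le {f f' : ℝ → ℝ} (h : IsPrimitive f f') {x : ℝ} (hx : x ∈ Icc (0 : ℝ) 1) :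
    |f x| ≤ nrm f + nrm f' := by
  have hL1 : ∀ {g : ℝ → ℝ}, MemLp g 2 μΩ → ∫ y in (0 : ℝ)..1, |g y| ≤ nrm g := fun hg => by
    have := sq_integral_abs_le hg (a := 0) (b := 1) (by simp) (by simp) zero_le_one
    rw [sub_zero, one_mul, ← ip_self_eq] at this
    exact Real.le_sqrt_of_sq_le this
  have hi := (intervalIntegrable_of_memLp h.memLp_self (a := 0) (b := 1) (by simp) (by simp)).abs
  have hi' := (intervalIntegrable_of_memLp h.memLp (a := 0) (b := 1) (by simp) (by simp)).abs
  have h1 : ∀ y ∈ Icc (0 : ℝ) 1, |f x| ≤ |f y| + nrm f' := fun y hy => by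
    have h2 := h.sub_eq hy hx
    have h3 : |∫ s in y..x, f' s| ≤ |∫ s in y..x, (|f' s|)| :=
      intervalIntegral.norm_integral_le_abs_integral_norm (f := f')
    have h4 : |∫ s in y..x, (|f' s|)| ≤ |∫ s in (0 : ℝ)..1, (|f' s|)| :=
      intervalIntegral.abs_integral_mono_interval (by
        rw [uIoc_of_le zero_le_one]
        exact Ioc_subset_Ioc (le_min hy.1 hx.1) (max_le hy.2 hx.2))
        (Filter.Eventually.of_forall fun s => abs_nonneg _) hi'
    rw [abs_of_nonneg (a := ∫ s in (0 : ℝ)..1, (|f' s|))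
      (intervalIntegral.integral_nonneg zero_le_one fun _ _ => abs_nonneg _)] at h4
    have h5 := abs_sub_abs_le_abs_sub (f x) (f y)
    rw [h2] at h5
    linarith [hL1 h.memLp]
  have h6 : ∫ _ in (0 : ℝ)..1, |f x| ≤ ∫ y in (0 : ℝ)..1, (|f y| + nrm f') :=
    intervalIntegral.integral_mono_on zero_le_one (by simp) (hi.add (by simp)) h1
  rw [intervalIntegral.integral_add hi (by simp)] at h6
  simp only [intervalIntegral.integral_const, sub_zero, one_smul] at h6
  linarith [hL1 h.memLp_self]

section Solution

variable {T R : ℝ} {k : ℕ} {v vt vtt : ℝ → L2Ω}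

/-- For a fixed test function the pairing is a scalar absolutely continuous function of time, so a
bound of its derivative for almost every time suffices. No measurable choice of weak derivatives of
`vt t` is needed. -/
lemma dualBound_sub (hT : 0 ≤ T) (h : IsTimeDeriv T v vt) (j : ℕ) {K : ℝ}
    (hb : ∀ᵐ t ∂(volume.restrict (Ioo 0 T)), DualBound j (vt t) K) {a b : ℝ}
    (ha : a ∈ Icc 0 T) (hb' : b ∈ Icc 0 T) : DualBound j (v b - v a) (K * |b - a|) := by
  intro φ
  have h1 := (HasTimeDeriv.map h hT (innerSL ℝ (testDeriv j φ))).norm_sub_le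
    (R := K * ‖testDeriv 0 φ‖) (by filter_upwards [hb] with t ht using ht φ) ha hb'
  rw [innerSL_apply_apply, innerSL_apply_apply, ← inner_sub_right] at h1
  refine le_trans h1 (le_of_eq ?_)
  ring

lemma dualBound_avg_sub (hT : 0 ≤ T) (h : IsTimeDeriv T v vt) (h' : IsTimeDeriv T vt vtt) (j : ℕ)
    {K : ℝ} (hK : 0 ≤ K) (hb : ∀ᵐ t ∂(volume.restrict (Ioo 0 T)), DualBound j (vtt t) K) {a δ : ℝ}
    (hδ : 0 ≤ δ) (ha : a ∈ Icc 0 T) (hb' : a + δ ∈ Icc 0 T) :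
    DualBound j ((1 / 2 : ℝ) • (v (a + δ) + v a) - v (a + δ / 2)) (K * δ ^ 2) := by
  intro φ
  have h1 := (HasTimeDeriv.map h hT (innerSL ℝ (testDeriv j φ))).norm_avg_sub_le
    (HasTimeDeriv.map h' hT (innerSL ℝ (testDeriv j φ)))
    (R := K * ‖testDeriv 0 φ‖) (by positivity)
    (by filter_upwards [hb] with t ht using ht φ) hδ ha hb'
  rw [← map_add, ← map_smul, ← map_sub, innerSL_apply_apply] at h1
  refine le_trans h1 (le_of_eq ?_)
  ring

/-- The bound holds at some time `s` and is carried to every `t` by the bound of `vt`, at the cost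
of `K * |t - s| ≤ K * T`. This gives regularity at the grid points, including `0` and `T`. -/
lemma dualBound_of_ae (hT : 0 < T) (h : IsTimeDeriv T v vt) (j : ℕ) {K : ℝ} (hK : 0 ≤ K)
    (hv : ∀ᵐ t ∂(volume.restrict (Ioo 0 T)), DualBound j (v t) K)
    (hvt : ∀ᵐ t ∂(volume.restrict (Ioo 0 T)), DualBound j (vt t) K) {t : ℝ} (ht : t ∈ Icc 0 T) :
    DualBound j (v t) (K * (1 + T)) := by
  obtain ⟨s, hs, h1⟩ := exists_of_ae_Ioo hT hv
  have h2 := h1.add (dualBound_sub hT.le h j hvt (Ioo_subset_Icc_self hs) ht)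
  rw [add_sub_cancel] at h2
  refine h2.mono ?_
  have : |t - s| ≤ T := abs_sub_le_iff.2 ⟨by linarith [ht.2, hs.1], by linarith [ht.1, hs.2]⟩
  nlinarith

/-- The boundary values of a continuous family of functions which vanish at the boundary for
`0 < t < T` also vanish for `t = 0` and `t = T`. -/
lemma boundary_values (hT : 0 < T) (h : IsTimeDeriv T v vt) {K : ℝ} (hK : 0 ≤ K)
    (hvt : ∀ j ≤ 1, ∀ᵐ t ∂(volume.restrict (Ioo 0 T)), DualBound j (vt t) K)
    (h0 : ∀ t ∈ Ioo 0 T, ∃ u u', v t =ᵐ[μΩ] u ∧ MemH10 u u') {t : ℝ} (ht : t ∈ Icc 0 T)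
    {f f' : ℝ → ℝ} (hf : IsPrimitive f f') (hvf : v t =ᵐ[μΩ] f) : f 0 = 0 ∧ f 1 = 0 := by
  have key : ∀ ε > 0, |f 0| ≤ 2 * K * ε ∧ |f 1| ≤ 2 * K * ε := by
    intro ε hε
    obtain ⟨s, hs, hts⟩ : ∃ s ∈ Ioo 0 T, |t - s| < ε := by
      have : t ∈ closure (Ioo 0 T) := by rw [closure_Ioo hT.ne]; exact ht
      obtain ⟨s, hs, h⟩ := Metric.mem_closure_iff.1 this ε hε
      exact ⟨s, hs, h⟩
    obtain ⟨u, u', hu, hm⟩ := h0 s hs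
    -- At a nearby `s` in the open interval the boundary values are zero. The difference `v t - v s`
    -- and its derivative have norm at most `K * |t - s|`, and the Sobolev embedding adds the two,
    -- whence `2 * K * ε`.
    obtain ⟨g, hg⟩ := exists_sobolevRep (m := 1) (mul_nonneg hK (abs_nonneg (t - s)))
      fun j hj => dualBound_sub hT.le h j (hvt j hj) (Ioo_subset_Icc_self hs) ht
    have he : (fun y => f y - u y) =ᵐ[μΩ] g 0 := by
      filter_upwards [hg.ae_eq, hvf, hu, Lp.coeFn_sub (v t) (v s)] with y h1 h2 h3 h4
      rw [← h1, h4, Pi.sub_apply, h2, h3]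
    have hE := ((hf.sub hm.isPrimitive).eqOn (hg.prim 0 one_pos) he).1
    have hb : ∀ x ∈ Icc (0 : ℝ) 1, |g 0 x| ≤ 2 * K * ε := fun x hx => by
      have h1 := (hg.prim 0 one_pos).abs_le hx
      have h2 := hg.nrm_le 0 zero_le_one
      have h3 := hg.nrm_le 1 le_rfl
      simp only [zero_add] at h1
      nlinarith
    have e0 := hE (show (0 : ℝ) ∈ Icc 0 1 by simp)
    have e1 := hE (show (1 : ℝ) ∈ Icc 0 1 by simp)
    simp only [hm.left, hm.right, sub_zero] at e0 e1
    rw [e0, e1]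
    exact ⟨hb 0 (by simp), hb 1 (by simp)⟩
  have lim : ∀ c : ℝ, (∀ ε > 0, |c| ≤ 2 * K * ε) → c = 0 := fun c hc => by
    refine abs_nonpos_iff.1 (le_of_forall_pos_le_add fun η hη => ?_)
    refine (hc (η / (2 * K + 1)) (by positivity)).trans ?_
    rw [zero_add, mul_div_assoc', div_le_iff₀ (by positivity)]
    nlinarith
  exact ⟨lim _ fun ε hε => (key ε hε).1, lim _ fun ε hε => (key ε hε).2⟩

end Solution

/-! ### The energy inequality for one step -/

/-- The constant in the energy inequality. -/
noncomputable def energyConst (c C D β : ℝ) : ℝ :=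
  2 * ((β ^ 2 + D ^ 2 + (C + β) ^ 2) / c + (1 + 2 * β))

lemma energyConst_nonneg {c C D β : ℝ} (hc : 0 < c) (hβ : 0 ≤ β) : 0 ≤ energyConst c C D β := by
  unfold energyConst
  positivity

/-- In the application `X` is half the difference quotient of the squared error, `q` and `p` are the
norms of the test function and of its derivative, `ε` is the consistency error and `d` the error in
the coefficient. All terms linear in `p` form `S * p`, which `c * p ^ 2` absorbs by completing the
square. -/
lemma energy_scalar {X c C D β p q ε d : ℝ} (hc : 0 < c) (hβ : 0 ≤ β)
    (h : X + c * p ^ 2 ≤ β * p * q + ε * q + D * d * p + C * ε * p + ε * (β * (q + p)) +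
      ε * (β * q)) :
    2 * X ≤ energyConst c C D β * (q ^ 2 + d ^ 2 + ε ^ 2) := by
  set S := β * q + D * d + (C + β) * ε with hS
  have h1 : S * p ≤ c * p ^ 2 + S ^ 2 / (4 * c) := by
    have : c * p ^ 2 + S ^ 2 / (4 * c) - S * p = (2 * c * p - S) ^ 2 / (4 * c) := by
      field_simp; ring
    have : 0 ≤ (2 * c * p - S) ^ 2 / (4 * c) := by positivity
    linarith
  have h2 : S ^ 2 ≤ 3 * (β ^ 2 * q ^ 2 + D ^ 2 * d ^ 2 + (C + β) ^ 2 * ε ^ 2) := by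
    nlinarith [sq_nonneg (β * q - D * d), sq_nonneg (β * q - (C + β) * ε),
      sq_nonneg (D * d - (C + β) * ε)]
  set G₀ := q ^ 2 + d ^ 2 + ε ^ 2 with hG
  have h3 : β ^ 2 * q ^ 2 + D ^ 2 * d ^ 2 + (C + β) ^ 2 * ε ^ 2 ≤
      (β ^ 2 + D ^ 2 + (C + β) ^ 2) * G₀ := by
    have e1 := mul_nonneg (sq_nonneg β) (add_nonneg (sq_nonneg d) (sq_nonneg ε))
    have e2 := mul_nonneg (sq_nonneg D) (add_nonneg (sq_nonneg q) (sq_nonneg ε))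
    have e3 := mul_nonneg (sq_nonneg (C + β)) (add_nonneg (sq_nonneg q) (sq_nonneg d))
    rw [hG]
    linarith
  have h4 : S ^ 2 / (4 * c) ≤ (β ^ 2 + D ^ 2 + (C + β) ^ 2) / c * G₀ := by
    rw [div_mul_eq_mul_div, div_le_div_iff₀ (by positivity) hc]
    have : 0 ≤ (β ^ 2 + D ^ 2 + (C + β) ^ 2) * G₀ := by positivity
    nlinarith
  have h5 : (1 + 2 * β) * (ε * q) ≤ (1 + 2 * β) * G₀ := by
    refine mul_le_mul_of_nonneg_left ?_ (by positivity)
    rw [hG]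
    nlinarith [sq_nonneg (ε - q), sq_nonneg d]
  have h6 : X ≤ S ^ 2 / (4 * c) + (1 + 2 * β) * (ε * q) := by
    rw [hS] at h1 ⊢
    linarith
  unfold energyConst
  linarith

/-- The energy inequality for one linearised Crank-Nicolson step. -/
lemma energy_step {E : Type*} [NormedAddCommGroup E] [InnerProductSpace ℝ E]
    {U U' Uy Uy' Q Q' Qy Qy' f f' fy fy' ut uy w wy Bw z : E} {δ b A A' G β ε d c C D K : ℝ}
    (hδ : 0 < δ) (hc : 0 < c) (hβ : 0 ≤ β) (hε : 0 ≤ ε)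
    (hw : w = (1 / 2 : ℝ) • ((U - Q) + (U' - Q')))
    (hwy : wy = (1 / 2 : ℝ) • ((Uy - Qy) + (Uy' - Qy')))
    (h1 : inner ℝ ut w + A * b * inner ℝ uy wy - inner ℝ uy Bw = G)
    (h2 : inner ℝ (δ⁻¹ • (U - U')) w + A' * b * inner ℝ ((1 / 2 : ℝ) • (Uy + Uy')) wy -
      inner ℝ ((1 / 2 : ℝ) • (Uy + Uy')) Bw = G)
    (h3 : inner ℝ ((1 / 2 : ℝ) • (Qy + Qy') - (1 / 2 : ℝ) • (fy + fy')) wy = 0)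
    (h4 : inner ℝ ((1 / 2 : ℝ) • (Qy + Qy') - (1 / 2 : ℝ) • (fy + fy')) Bw =
      - inner ℝ ((1 / 2 : ℝ) • (Q + Q') - (1 / 2 : ℝ) • (f + f')) z)
    (hBw : ‖Bw‖ ≤ β * ‖w‖) (hz : ‖z‖ ≤ β * (‖w‖ + ‖wy‖))
    (e1 : ‖ut - δ⁻¹ • (Q - Q')‖ ≤ ε) (e2 : ‖uy - (1 / 2 : ℝ) • (fy + fy')‖ ≤ ε)
    (e3 : ‖(1 / 2 : ℝ) • (Q + Q') - (1 / 2 : ℝ) • (f + f')‖ ≤ ε)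
    (huy : ‖uy‖ ≤ K) (hcA : c ≤ A' * b) (hAC : A' * b ≤ C) (hAd : |(A - A') * b| * K ≤ D * d) :
    ‖U - Q‖ ^ 2 ≤ ‖U' - Q'‖ ^ 2 +
      δ * (energyConst c C D β * (‖U - Q‖ ^ 2 + ‖U' - Q'‖ ^ 2 + d ^ 2 + ε ^ 2)) := by
  -- Testing with the average turns the difference quotient into a difference of squares. Below,
  -- `Bw` stands for `b₁ W` and `z` for its derivative; `A` is the exact coefficient, `A'` the
  -- discrete one.
  have hlhs : inner ℝ (δ⁻¹ • ((U - Q) - (U' - Q'))) w =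
      (‖U - Q‖ ^ 2 - ‖U' - Q'‖ ^ 2) / (2 * δ) := by
    rw [hw, real_inner_smul_left, real_inner_smul_right, inner_sub_left, inner_add_right,
      inner_add_right, real_inner_self_eq_norm_sq, real_inner_self_eq_norm_sq,
      real_inner_comm (U - Q) (U' - Q')]
    field_simp
    ring
  -- The error equation: `h2 - h1` subtracts the weak equation from the scheme, `h3` removes the
  -- Ritz error from the diffusion term, and `h4` moves the derivative off it in the convection
  -- term.
  have hid : inner ℝ (δ⁻¹ • ((U - Q) - (U' - Q'))) w + A' * b * inner ℝ wy wy =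
      inner ℝ wy Bw + inner ℝ (ut - δ⁻¹ • (Q - Q')) w + (A - A') * b * inner ℝ uy wy +
      A' * b * inner ℝ (uy - (1 / 2 : ℝ) • (fy + fy')) wy -
      inner ℝ ((1 / 2 : ℝ) • (Q + Q') - (1 / 2 : ℝ) • (f + f')) z -
      inner ℝ (uy - (1 / 2 : ℝ) • (fy + fy')) Bw := by
    have r1 : inner ℝ wy wy = inner ℝ ((1 / 2 : ℝ) • (Uy + Uy')) wy -
        inner ℝ ((1 / 2 : ℝ) • (Qy + Qy')) wy := by
      rw [← inner_sub_left]
      congr 1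
      rw [hwy]; module
    have r2 : inner ℝ wy Bw = inner ℝ ((1 / 2 : ℝ) • (Uy + Uy')) Bw -
        inner ℝ ((1 / 2 : ℝ) • (Qy + Qy')) Bw := by
      rw [← inner_sub_left]
      congr 1
      rw [hwy]; module
    have r3 : inner ℝ (δ⁻¹ • ((U - Q) - (U' - Q'))) w = inner ℝ (δ⁻¹ • (U - U')) w -
        inner ℝ (δ⁻¹ • (Q - Q')) w := by
      rw [← inner_sub_left]
      congr 1
      module
    rw [inner_sub_left] at h3 h4
    rw [r1, r2, r3, inner_sub_left ut, inner_sub_left uy, inner_sub_left uy]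
    linear_combination h2 - h1 - A' * b * h3 + h4
  have hC : 0 ≤ C := hc.le.trans (hcA.trans hAC)
  set p := ‖wy‖
  set q := ‖w‖
  have hp : 0 ≤ p := norm_nonneg _
  have hq : 0 ≤ q := norm_nonneg _
  have b1 : inner ℝ wy Bw ≤ β * p * q :=
    (real_inner_le_norm _ _).trans ((mul_le_mul_of_nonneg_left hBw hp).trans (le_of_eq (by ring)))
  have b2 : inner ℝ (ut - δ⁻¹ • (Q - Q')) w ≤ ε * q :=
    (real_inner_le_norm _ _).trans (mul_le_mul_of_nonneg_right e1 hq)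
  have b3 : (A - A') * b * inner ℝ uy wy ≤ D * d * p := by
    refine (le_abs_self _).trans ?_
    rw [abs_mul]
    calc |(A - A') * b| * |inner ℝ uy wy| ≤ |(A - A') * b| * (K * p) :=
          mul_le_mul_of_nonneg_left ((abs_real_inner_le_norm _ _).trans
            (mul_le_mul_of_nonneg_right huy hp)) (abs_nonneg _)
      _ = |(A - A') * b| * K * p := by ring
      _ ≤ D * d * p := mul_le_mul_of_nonneg_right hAd hp
  have b4 : A' * b * inner ℝ (uy - (1 / 2 : ℝ) • (fy + fy')) wy ≤ C * ε * p := by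
    calc A' * b * inner ℝ (uy - (1 / 2 : ℝ) • (fy + fy')) wy ≤ A' * b * (ε * p) :=
          mul_le_mul_of_nonneg_left ((real_inner_le_norm _ _).trans
            (mul_le_mul_of_nonneg_right e2 hp)) (hc.le.trans hcA)
      _ ≤ C * (ε * p) := mul_le_mul_of_nonneg_right hAC (mul_nonneg hε hp)
      _ = C * ε * p := by ring
  have b5 : - inner ℝ ((1 / 2 : ℝ) • (Q + Q') - (1 / 2 : ℝ) • (f + f')) z ≤
      ε * (β * (q + p)) := by
    refine (neg_le_abs _).trans ((abs_real_inner_le_norm _ _).trans ?_)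
    exact mul_le_mul e3 hz (norm_nonneg _) hε
  have b6 : - inner ℝ (uy - (1 / 2 : ℝ) • (fy + fy')) Bw ≤ ε * (β * q) := by
    refine (neg_le_abs _).trans ((abs_real_inner_le_norm _ _).trans ?_)
    exact mul_le_mul e2 hBw (norm_nonneg _) hε
  have b7 : c * p ^ 2 ≤ A' * b * inner ℝ wy wy := by
    rw [real_inner_self_eq_norm_sq]
    exact mul_le_mul_of_nonneg_right hcA (sq_nonneg _)
  have main := energy_scalar (X := (‖U - Q‖ ^ 2 - ‖U' - Q'‖ ^ 2) / (2 * δ)) (c := c) (C := C)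
    (D := D) (β := β) (p := p) (q := q) (ε := ε) (d := d) hc hβ (by
      rw [hlhs] at hid
      linarith)
  have hq2 : q ^ 2 ≤ ‖U - Q‖ ^ 2 + ‖U' - Q'‖ ^ 2 := by
    have : q ≤ 1 / 2 * (‖U - Q‖ + ‖U' - Q'‖) := by
      simp only [q]
      rw [hw, norm_smul, Real.norm_of_nonneg (by norm_num)]
      exact mul_le_mul_of_nonneg_left (norm_add_le _ _) (by norm_num)
    nlinarith [sq_nonneg (‖U - Q‖ - ‖U' - Q'‖), norm_nonneg (U - Q), norm_nonneg (U' - Q')]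
  have hE := energyConst_nonneg (c := c) (C := C) (D := D) (β := β) hc hβ
  have h5 : 2 * ((‖U - Q‖ ^ 2 - ‖U' - Q'‖ ^ 2) / (2 * δ)) ≤ energyConst c C D β *
      (‖U - Q‖ ^ 2 + ‖U' - Q'‖ ^ 2 + d ^ 2 + ε ^ 2) :=
    main.trans (mul_le_mul_of_nonneg_left (by linarith) hE)
  have h6 : 2 * ((‖U - Q‖ ^ 2 - ‖U' - Q'‖ ^ 2) / (2 * δ)) =
      (‖U - Q‖ ^ 2 - ‖U' - Q'‖ ^ 2) / δ := by field_simp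
  rw [h6, div_le_iff₀ hδ] at h5
  linarith

/-! ### A discrete Gronwall inequality -/

/-- The constant in the discrete Gronwall inequality. -/
noncomputable def gronwallConst (B K T : ℝ) : ℝ := (6 * B + 2 + 4 * K ^ 2) * Real.exp (8 * K * T)

/-- The term `δ ^ 2` in `hp` is the square of the first order error of the predictor. It reaches `e
1` with the factor `(δ * K) ^ 2`, so it contributes `K ^ 2 * δ ^ 4`, which is at most `K ^ 2 * η ^
2`. The other terms on the new level are absorbed on the left by `δ * K ≤ 1 / 2`. -/
lemma gronwall {e : ℕ → ℝ} {ep η δ K T B : ℝ} {N : ℕ} (he : ∀ n, 0 ≤ e n) (hep : 0 ≤ ep)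
    (hδ : 0 < δ) (hK : 0 ≤ K) (hδK : δ * K ≤ 1 / 2) (hNT : N * δ = T) (hB : 0 ≤ B)
    (hη : δ ^ 2 ≤ η) (h0 : e 0 ≤ B * η ^ 2)
    (hp : ep ≤ e 0 + δ * K * (ep + e 0 + η ^ 2 + δ ^ 2))
    (h1 : e 1 ≤ e 0 + δ * K * (e 1 + e 0 + ep + η ^ 2))
    (hstep : ∀ n, n + 2 ≤ N →
      e (n + 2) ≤ e (n + 1) + δ * K * (e (n + 2) + e (n + 1) + e n + η ^ 2))
    {n : ℕ} (hn : n ≤ N) : e n ≤ gronwallConst B K T * η ^ 2 := by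
  set x := δ * K with hx
  have hx0 : 0 ≤ x := mul_nonneg hδ.le hK
  -- Exactly the bound of `e 1` obtained by inserting `hp` into `h1` and using `δ * K ≤ 1 / 2`.
  set Y := (6 * B + 2 + 4 * K ^ 2) * η ^ 2 with hY
  have hη2 : 0 ≤ η ^ 2 := sq_nonneg η
  have hY0 : 0 ≤ Y := by positivity
  have hη4 : δ ^ 4 ≤ η ^ 2 := by
    calc δ ^ 4 = (δ ^ 2) ^ 2 := by ring
      _ ≤ η ^ 2 := pow_le_pow_left₀ (sq_nonneg _) hη 2
  have hBη : 0 ≤ B * η ^ 2 := by positivity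
  have hKη : 0 ≤ K ^ 2 * η ^ 2 := by positivity
  have e0Y : e 0 ≤ Y := by rw [hY]; nlinarith
  have ηY : η ^ 2 ≤ Y := by rw [hY]; nlinarith
  have hxe0 : x * e 0 ≤ 1 / 2 * e 0 := mul_le_mul_of_nonneg_right hδK (he 0)
  have hxη : x * η ^ 2 ≤ 1 / 2 * η ^ 2 := mul_le_mul_of_nonneg_right hδK hη2
  have hxep : x * ep ≤ 1 / 2 * ep := mul_le_mul_of_nonneg_right hδK hep
  have hep' : ep ≤ 3 * e 0 + η ^ 2 + 2 * (x * δ ^ 2) := by linarith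
  have e1Y : e 1 ≤ Y := by
    have hxe1 : x * e 1 ≤ 1 / 2 * e 1 := mul_le_mul_of_nonneg_right hδK (he 1)
    have h2 : x * ep ≤ x * (3 * e 0 + η ^ 2 + 2 * (x * δ ^ 2)) := mul_le_mul_of_nonneg_left hep' hx0
    have h3 : x * (x * δ ^ 2) ≤ K ^ 2 * η ^ 2 := by
      calc x * (x * δ ^ 2) = K ^ 2 * δ ^ 4 := by rw [hx]; ring
        _ ≤ K ^ 2 * η ^ 2 := mul_le_mul_of_nonneg_left hη4 (sq_nonneg _)
    rw [hY]
    linarith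
  have hq : 1 ≤ 1 + 8 * x := by linarith
  -- Two consecutive levels are carried because the recursion has three.
  have key : ∀ n, (n ≤ N → e n ≤ Y * (1 + 8 * x) ^ n) ∧
      (n + 1 ≤ N → e (n + 1) ≤ Y * (1 + 8 * x) ^ (n + 1)) := by
    intro n
    induction n with
    | zero =>
      refine ⟨fun _ => by simpa using e0Y, fun _ => ?_⟩
      rw [zero_add, pow_one]
      exact e1Y.trans (le_mul_of_one_le_right hY0 hq)
    | succ n ih =>
      refine ⟨ih.2, fun hN' => ?_⟩
      have i1 := ih.1 (by omega)
      have i2 := ih.2 (by omega)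
      have i3 := hstep n hN'
      set Z := Y * (1 + 8 * x) ^ (n + 1) with hZ
      have hZ1 : Y * (1 + 8 * x) ^ n ≤ Z :=
        mul_le_mul_of_nonneg_left (pow_le_pow_right₀ hq (Nat.le_succ n)) hY0
      have hZ2 : Y ≤ Z := le_mul_of_one_le_right hY0 (one_le_pow₀ hq)
      have hZ0 : 0 ≤ Z := hY0.trans hZ2
      have j1 : x * e (n + 1) ≤ x * Z := mul_le_mul_of_nonneg_left i2 hx0
      have j2 : x * e n ≤ x * Z := mul_le_mul_of_nonneg_left (i1.trans hZ1) hx0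
      have j3 : x * η ^ 2 ≤ x * Z := mul_le_mul_of_nonneg_left (ηY.trans hZ2) hx0
      -- The recursion gives `(1 + 3 * x) * Z` on the right; the growth factor works because `(1 -
      -- x) * (1 + 8 * x) ≥ 1 + 3 * x` for `0 ≤ x ≤ 1 / 2`.
      have j4 : (1 - x) * e (n + 2) ≤ (1 - x) * (Z * (1 + 8 * x)) := by
        have : x * (x * Z) ≤ 1 / 2 * (x * Z) := mul_le_mul_of_nonneg_right hδK (mul_nonneg hx0 hZ0)
        linarith
      have j5 := le_of_mul_le_mul_left j4 (by linarith)
      rw [pow_succ, ← mul_assoc]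
      exact j5
  have h2 := (key n).1 hn
  have h3 : (1 + 8 * x) ^ n ≤ Real.exp (8 * K * T) := by
    calc (1 + 8 * x) ^ n ≤ (1 + 8 * x) ^ N := pow_le_pow_right₀ hq hn
      _ ≤ (Real.exp (8 * x)) ^ N :=
        pow_le_pow_left₀ (by linarith) (by linarith [Real.add_one_le_exp (8 * x)]) N
      _ = Real.exp (8 * K * T) := by
        rw [← Real.exp_nat_mul, ← hNT, hx]
        congr 1
        ring
  calc e n ≤ Y * (1 + 8 * x) ^ n := h2
    _ ≤ Y * Real.exp (8 * K * T) := mul_le_mul_of_nonneg_left h3 hY0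
    _ = gronwallConst B K T * η ^ 2 := by rw [hY, gronwallConst]; ring

/-! ### From functions to elements of `L₂(Ω)` -/

lemma nrm_sub_eq {f g : ℝ → ℝ} (hf : MemLp f 2 μΩ) (hg : MemLp g 2 μΩ) :
    nrm (fun y => f y - g y) = ‖hf.toLp f - hg.toLp g‖ := by
  rw [← MemLp.toLp_sub, ← nrm_eq_norm (hf.sub hg)]
  rfl

lemma nrm_sub_coe_eq {f : ℝ → ℝ} (hf : MemLp f 2 μΩ) (u : L2Ω) :
    nrm (fun y => f y - u y) = ‖hf.toLp f - u‖ := by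
  rw [nrm_sub_eq hf (Lp.memLp u), Lp.toLp_coeFn]

lemma toLp_eq_of_ae_eq {f : ℝ → ℝ} (hf : MemLp f 2 μΩ) {u : L2Ω} (h : u =ᵐ[μΩ] f) :
    hf.toLp f = u := by
  refine Lp.ext ?_
  exact hf.coeFn_toLp.trans h.symm

lemma memLp_combination {f g : ℝ → ℝ} (hf : MemLp f 2 μΩ) (hg : MemLp g 2 μΩ) (a b : ℝ) :
    MemLp (fun y => a * f y + b * g y) 2 μΩ := (hf.const_mul a).add (hg.const_mul b)

lemma toLp_combination {f g : ℝ → ℝ} (hf : MemLp f 2 μΩ) (hg : MemLp g 2 μΩ) (a b : ℝ)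
    (h : MemLp (fun y => a * f y + b * g y) 2 μΩ) :
    h.toLp _ = a • hf.toLp f + b • hg.toLp g := by
  rw [← MemLp.toLp_const_smul, ← MemLp.toLp_const_smul, ← MemLp.toLp_add]
  rfl

lemma nrm_le_of_abs_le {f g : ℝ → ℝ} (hf : MemLp f 2 μΩ) (hg : MemLp g 2 μΩ) {c : ℝ}
    (h : ∀ y ∈ Ioo (0 : ℝ) 1, |f y| ≤ c * |g y|) : nrm f ≤ c * nrm g := by
  rw [nrm_eq_norm hf, nrm_eq_norm hg]
  refine Lp.norm_le_mul_norm_of_ae_le_mul ?_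
  filter_upwards [hf.coeFn_toLp, hg.coeFn_toLp, ae_restrict_mem measurableSet_Ioo] with y h1 h2 h3
  rw [h1, h2]
  exact h y h3

lemma memLp_continuous_mul {f g : ℝ → ℝ} (hf : MemLp f 2 μΩ) (hg : ContinuousOn g (Icc 0 1)) :
    MemLp (fun y => g y * f y) 2 μΩ := by
  obtain ⟨C, hC⟩ := isCompact_Icc.exists_bound_of_continuousOn hg
  refine MemLp.of_le_mul hf
    (((hg.mono Ioo_subset_Icc_self).aestronglyMeasurable measurableSet_Ioo).mul hf.1) (c := C) ?_
  filter_upwards [ae_restrict_mem measurableSet_Ioo] with y hy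
  rw [norm_mul]
  exact mul_le_mul_of_nonneg_right (hC y (Ioo_subset_Icc_self hy)) (norm_nonneg _)

lemma abs_integral_le_nrm {f : ℝ → ℝ} (hf : MemLp f 2 μΩ) : |∫ y, f y ∂μΩ| ≤ nrm f := by
  have h1 := sq_integral_abs_le hf (a := 0) (b := 1) (by simp) (by simp) zero_le_one
  rw [sub_zero, one_mul, ← ip_self_eq] at h1
  rw [integral_μΩ]
  refine le_trans ?_ (Real.le_sqrt_of_sq_le h1)
  exact intervalIntegral.abs_integral_le_integral_abs zero_le_one

/-- The product rule. -/
lemma IsPrimitive.mul {u u' w w' : ℝ → ℝ} (h : IsPrimitive u u') (h' : IsPrimitive w w') :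
    IsPrimitive (fun y => u y * w y) (fun y => w y * u' y + u y * w' y) := by
  have m1 := memLp_continuous_mul h.memLp h'.continuousOn
  have m2 := memLp_continuous_mul h'.memLp h.continuousOn
  refine ⟨m1.add m2, fun y hy => ?_⟩
  have h1 := h.integral_mul h' (a := 0) (by simp) hy
  rw [intervalIntegral.integral_add (intervalIntegrable_of_memLp m1 (by simp) hy)
    (intervalIntegrable_of_memLp m2 (by simp) hy), h1]
  have : ∫ s in (0 : ℝ)..y, w s * u' s = ∫ s in (0 : ℝ)..y, u' s * w s := by simp only [mul_comm]
  rw [this]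
  ring

lemma MemS.toLp_deriv_combination {M : Mesh} {k : ℕ} {W W' : ℝ → ℝ} (h : MemS M k W)
    (h' : MemS M k W') (a b : ℝ) (hm : MemLp (deriv fun y => a * W y + b * W' y) 2 μΩ) :
    hm.toLp _ = a • h.memLp_deriv.toLp _ + b • h'.memLp_deriv.toLp _ := by
  rw [← toLp_combination h.memLp_deriv h'.memLp_deriv a b
    (memLp_combination h.memLp_deriv h'.memLp_deriv a b)]
  exact MemLp.toLp_congr _ _ (h.deriv_combination h' a b)

/-- A primitive with bounded dual norms has a bounded derivative. -/
lemma IsPrimitive.nrm_deriv_le {u u' : ℝ → ℝ} (h : IsPrimitive u u') {w : L2Ω} (hw : w =ᵐ[μΩ] u)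
    {K : ℝ} (hK : 0 ≤ K) (hb : ∀ j ≤ 1, DualBound j w K) : nrm u' ≤ K := by
  obtain ⟨g, hg⟩ := exists_sobolevRep hK hb
  rw [nrm_congr (h.eqOn (hg.prim 0 one_pos) (hw.symm.trans hg.ae_eq)).2]
  exact hg.nrm_le 1 le_rfl

/-! ### Representatives and Ritz projections of the solution at a fixed time -/

/-- Representatives `f 0, …, f (k+1)` of `u ∈ H^{k+1}(Ω)`, and the Ritz projection `Q` of `u`. -/
structure Snapshot (M : Mesh) (k : ℕ) (K : ℝ) (u : L2Ω) (f : ℕ → ℝ → ℝ) (Q : ℝ → ℝ) : Prop where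
  rep : SobolevRep (k + 1) u K f
  ritz : IsRitz M k (f 0) (f 1) Q

namespace Snapshot

variable {M : Mesh} {k : ℕ} {K : ℝ} {u u₁ : L2Ω} {f f₁ : ℕ → ℝ → ℝ} {Q Q₁ : ℝ → ℝ}

lemma prim (s : Snapshot M k K u f Q) : IsPrimitive (f 0) (f 1) := s.rep.prim 0 (Nat.succ_pos k)

lemma toLp_eq (s : Snapshot M k K u f Q) : s.prim.memLp_self.toLp (f 0) = u :=
  toLp_eq_of_ae_eq _ s.rep.ae_eq

lemma norm_sub_le (s : Snapshot M k K u f Q) (ξ : LagrangePoints M k) (hk : 1 ≤ k) :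
    ‖s.ritz.mem.memLp.toLp Q - u‖ ≤ M.h ^ (k + 1) * K := by
  have h1 := s.ritz.nrm_sub_le ξ hk fun j hj => s.rep.prim j (Nat.lt_succ_of_le hj)
  rw [nrm_sub_eq s.ritz.mem.memLp s.prim.memLp_self, s.toLp_eq] at h1
  exact h1.trans (mul_le_mul_of_nonneg_left (s.rep.nrm_le _ le_rfl) (pow_nonneg M.h_pos.le _))

/-- The error of the Ritz projection of a multiple of a difference. -/
lemma norm_smul_sub_le (s : Snapshot M k K u f Q) (s₁ : Snapshot M k K u₁ f₁ Q₁)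
    (ξ : LagrangePoints M k) (hk : 1 ≤ k) (c : ℝ) {K' : ℝ} (hK' : 0 ≤ K')
    (hb : ∀ j ≤ k + 1, DualBound j (c • (u - u₁)) K') :
    ‖c • (s.ritz.mem.memLp.toLp Q - s₁.ritz.mem.memLp.toLp Q₁) - c • (u - u₁)‖ ≤
      M.h ^ (k + 1) * K' := by
  -- The Ritz estimate is applied to the scaled difference as a whole. For `c = δ⁻¹` the bound `K'`
  -- then comes from the time derivative, and no power of `δ` is lost.
  obtain ⟨g, hg⟩ := exists_sobolevRep hK' hb
  have hr := s.ritz.combination s₁.ritz s.prim.memLp s₁.prim.memLp c (-c)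
  have hp : IsPrimitive (fun y => c * f 0 y + -c * f₁ 0 y) (fun y => c * f 1 y + -c * f₁ 1 y) :=
    (s.prim.const_mul c).add (s₁.prim.const_mul (-c))
  have e0 : c • (u - u₁) = hp.memLp_self.toLp _ := by
    rw [toLp_combination s.prim.memLp_self s₁.prim.memLp_self, s.toLp_eq, s₁.toLp_eq]
    module
  have hae : (fun y => c * f 0 y + -c * f₁ 0 y) =ᵐ[μΩ] g 0 := by
    refine (hp.memLp_self.coeFn_toLp).symm.trans ?_
    rw [← e0]
    exact hg.ae_eq
  have he := hp.eqOn (hg.prim 0 (Nat.succ_pos k)) hae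
  have sg : Snapshot M k K' (c • (u - u₁)) g (fun y => c * Q y + -c * Q₁ y) :=
    ⟨hg, hr.congr_fun he.1 he.2⟩
  have h1 := sg.norm_sub_le ξ hk
  rw [toLp_combination s.ritz.mem.memLp s₁.ritz.mem.memLp] at h1
  refine le_trans (le_of_eq ?_) h1
  congr 2
  module

end Snapshot

/-! ### One step of the scheme -/

section Step

variable {ne : ℕ} {P : Problem ne} {T γ₀ γ₁ ma Ma αmax γmax R : ℝ} {La : ℝ≥0}

lemma coeff_sub_le (hP : P.Admissible T γ₀ γ₁ ma Ma La αmax γmax) (i : Fin ne) {t d : ℝ}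
    (hd : 0 ≤ d) {Z Z' : Fin ne → ℝ → ℝ} (h : ∀ j, |P.l t (Z j) - P.l t (Z' j)| ≤ d) :
    |P.coeff i t Z - P.coeff i t Z'| ≤ La * d := by
  refine ((hP.a_lip i).dist_le_mul _ _).trans (mul_le_mul_of_nonneg_left ?_ La.2)
  exact (dist_pi_le_iff hd).2 h

lemma l_sub_le (hP : P.Admissible T γ₀ γ₁ ma Ma La αmax γmax) (hγ₀ : 0 < γ₀) {t d : ℝ}
    (ht : t ∈ Icc 0 T) {z z' : ℝ → ℝ} (hz : MemLp z 2 μΩ) (hz' : MemLp z' 2 μΩ)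
    (h : nrm (fun y => z y - z' y) ≤ d) : |P.l t z - P.l t z'| ≤ γ₁ * d := by
  have hγ := hP.γ_bounds t ht
  have hm : MemLp (fun y => z y - z' y) 2 μΩ := hz.sub hz'
  have e : P.l t z - P.l t z' = P.γ t * ∫ y, (z y - z' y) ∂μΩ := by
    rw [integral_sub (hz.integrable one_le_two) (hz'.integrable one_le_two)]
    simp only [Problem.l]
    ring
  have hpos : 0 < P.γ t := hγ₀.trans hγ.1
  rw [e, abs_mul, abs_of_pos hpos]
  exact mul_le_mul hγ.2.le ((abs_integral_le_nrm hm).trans h) (abs_nonneg _) (hpos.le.trans hγ.2.le)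

/-- The bound of `b₁` and of its derivative. -/
noncomputable def convectionBound (γ₀ αmax γmax : ℝ) : ℝ := (|αmax| + |γmax|) / γ₀

/-- The constant in the energy inequality for a step of the scheme. -/
noncomputable def stepConst (T γ₀ γ₁ ma Ma αmax γmax R La : ℝ) : ℝ :=
  energyConst (ma / γ₁ ^ 2) (Ma / γ₀ ^ 2) (La * (R * (1 + T)) / γ₀ ^ 2)
    (convectionBound γ₀ αmax γmax)

lemma convection_bounds (hP : P.Admissible T γ₀ γ₁ ma Ma La αmax γmax) (hγ₀ : 0 < γ₀) {t : ℝ}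
    (ht : t ∈ Ioo 0 T) : |deriv P.γ t / P.γ t| ≤ convectionBound γ₀ αmax γmax ∧
      ∀ y ∈ Icc (0 : ℝ) 1, |P.b₁ t y| ≤ convectionBound γ₀ αmax γmax := by
  have hγ := hP.γ_bounds t (Ioo_subset_Icc_self ht)
  have hpos : 0 < P.γ t := hγ₀.trans hγ.1
  have h1 : |deriv P.α t| ≤ |αmax| := (hP.α_speed t ht).trans (le_abs_self _)
  have h2 : |deriv P.γ t| ≤ |γmax| := (hP.γ_speed t ht).trans (le_abs_self _)
  have key : ∀ c : ℝ, |c| ≤ |αmax| + |γmax| → |c / P.γ t| ≤ convectionBound γ₀ αmax γmax :=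
    fun c hc => by
      rw [abs_div, abs_of_pos hpos]
      exact div_le_div₀ (by positivity) hc hγ₀ hγ.1.le
  refine ⟨key _ (h2.trans (le_add_of_nonneg_left (abs_nonneg _))), fun y hy => key _ ?_⟩
  refine (abs_add_le _ _).trans (add_le_add h1 ?_)
  rw [abs_mul, abs_of_nonneg hy.1]
  exact (mul_le_of_le_one_right (abs_nonneg _) hy.2).trans h2

lemma isPrimitive_b₁ (P : Problem ne) (t : ℝ) :
    IsPrimitive (P.b₁ t) (fun _ => deriv P.γ t / P.γ t) := by
  refine isPrimitive_of_hasDerivAt (fun y => ?_) continuous_const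
  have := (((hasDerivAt_id y).const_mul (deriv P.γ t)).const_add (deriv P.α t)).div_const (P.γ t)
  have h2 : HasDerivAt (fun y => (deriv P.α t + deriv P.γ t * y) / P.γ t)
      (deriv P.γ t / P.γ t) y := by simpa using this
  exact h2

variable {v vt vtt vttt : Fin ne → ℝ → L2Ω} {M : Mesh} {k N : ℕ}

lemma RegularityBound.dualBound_vt (h : RegularityBound T k R v vt vtt vttt) (i : Fin ne) {j : ℕ}
    (hj : j ≤ k + 1) : ∀ᵐ t ∂(volume.restrict (Ioo 0 T)), DualBound j (vt i t) R := by
  filter_upwards [h.bound_vt i] with t ht using ht.dualBound hj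

lemma RegularityBound.dualBound_v (h : RegularityBound T k R v vt vtt vttt) (hT : 0 < T)
    (hR : 0 ≤ R) (i : Fin ne) {j : ℕ} (hj : j ≤ k + 1) {t : ℝ} (ht : t ∈ Icc 0 T) :
    DualBound j (v i t) (R * (1 + T)) := by
  refine dualBound_of_ae hT (h.deriv1 i) j hR ?_ (h.dualBound_vt i hj) ht
  filter_upwards [h.bound_v i] with t ht using ht.dualBound hj

lemma RegularityBound.dualBound_vtt (h : RegularityBound T k R v vt vtt vttt) (i : Fin ne) {j : ℕ}
    (hj : j ≤ 1) : ∀ᵐ t ∂(volume.restrict (Ioo 0 T)), DualBound j (vtt i t) R := by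
  filter_upwards [h.bound_vtt i, h.bound_vytt i] with t h1 h2
  obtain ⟨d, hd, hdR⟩ := h2
  interval_cases j
  · exact dualBound_zero h1
  · exact dualBound_of_isWeakDeriv hd hdR

/-- The grid points may belong to the null set excluded by the regularity assumption, and at `0` and
`T` there is no equation. Dual bounds and continuity in time provide derivatives and zero boundary
values there as well. -/
lemma exists_snapshot (hT : 0 < T) (hR : 0 ≤ R) (hv : P.IsWeakSolution T v vt)
    (h : RegularityBound T k R v vt vtt vttt) (M : Mesh) (hk : 1 ≤ k) (i : Fin ne) {t : ℝ}
    (ht : t ∈ Icc 0 T) : ∃ f Q, Snapshot M k (R * (1 + T)) (v i t) f Q := by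
  obtain ⟨f, hf⟩ := exists_sobolevRep (m := k + 1) (u := v i t) (K := R * (1 + T)) (by positivity)
    fun j hj => h.dualBound_v hT hR i hj ht
  have hp := hf.prim 0 (Nat.succ_pos k)
  obtain ⟨h0, h1⟩ := boundary_values hT (h.deriv1 i) hR
    (fun j hj => h.dualBound_vt i (by omega))
    (fun s hs => by
      obtain ⟨u, u', hu, hm, -⟩ := hv.eqn i s hs
      exact ⟨u, u', hu, hm⟩) ht hp hf.ae_eq
  obtain ⟨Q, hQ⟩ := exists_isRitz M hk hp h0 h1
  exact ⟨f, Q, hf, hQ⟩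

/-- The energy inequality for one step of the scheme. -/
lemma scheme_step (hT : 0 < T) (hγ₀ : 0 < γ₀) (hma : 0 < ma) (hR : 0 ≤ R)
    (hP : P.Admissible T γ₀ γ₁ ma Ma La αmax γmax) (hv : P.IsWeakSolution T v vt)
    (h : RegularityBound T k R v vt vtt vttt) (ξ : LagrangePoints M k) (hk : 1 ≤ k) {i : Fin ne}
    {a δ : ℝ} (hδ : 0 < δ) (ha : 0 ≤ a) (hb : a + δ ≤ T) {f f' : ℕ → ℝ → ℝ} {Q Q' : ℝ → ℝ}
    (s : Snapshot M k (R * (1 + T)) (v i (a + δ)) f Q)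
    (s' : Snapshot M k (R * (1 + T)) (v i a) f' Q')
    {U U' : ℝ → ℝ} {Z : Fin ne → ℝ → ℝ} (hU : MemS M k U) (hU' : MemS M k U')
    (hstep : CNStep P M k δ (a + δ / 2) i Z U' U) {d : ℝ} (hd0 : 0 ≤ d)
    (hZ : ∀ j, MemLp (Z j) 2 μΩ)
    (hd : ∀ j, nrm (fun y => Z j y - v j (a + δ / 2) y) ≤ d) :
    nrm (fun y => U y - Q y) ^ 2 ≤ nrm (fun y => U' y - Q' y) ^ 2 +
      δ * (stepConst T γ₀ γ₁ ma Ma αmax γmax R La *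
        (nrm (fun y => U y - Q y) ^ 2 + nrm (fun y => U' y - Q' y) ^ 2 + (γ₁ * d) ^ 2 +
          ((R + R * (1 + T)) * (M.h ^ (k + 1) + δ ^ 2)) ^ 2)) := by
  set t := a + δ / 2 with ht_def
  have ht : t ∈ Ioo 0 T := ⟨by linarith, by linarith⟩
  have hIa : a ∈ Icc 0 T := ⟨ha, by linarith⟩
  have hIb : a + δ ∈ Icc 0 T := ⟨by linarith, hb⟩
  set K := R * (1 + T) with hK_def
  have hK : 0 ≤ K := by positivity
  set η := M.h ^ (k + 1) + δ ^ 2 with hη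
  have hh : 0 ≤ M.h ^ (k + 1) := pow_nonneg M.h_pos.le _
  have hδ2 : 0 ≤ δ ^ 2 := sq_nonneg δ
  set β := convectionBound γ₀ αmax γmax with hβ_def
  have hβ : 0 ≤ β := by rw [hβ_def, convectionBound]; positivity
  have hγ := hP.γ_bounds t (Ioo_subset_Icc_self ht)
  have hγpos : 0 < P.γ t := hγ₀.trans hγ.1
  have hγ₁ : 0 < γ₁ := hγpos.trans hγ.2
  obtain ⟨u, uy, hu, hm, heq⟩ := hv.eqn i t ht
  have hup := hm.isPrimitive
  -- the test function
  have hθ : MemS M k (fun y => 1 * U y + -1 * Q y) := hU.combination s.ritz.mem 1 (-1)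
  have hθ' : MemS M k (fun y => 1 * U' y + -1 * Q' y) := hU'.combination s'.ritz.mem 1 (-1)
  have hW := hθ.combination hθ' (1 / 2) (1 / 2)
  set W : ℝ → ℝ := fun y => 1 / 2 * (1 * U y + -1 * Q y) + 1 / 2 * (1 * U' y + -1 * Q' y) with hWd
  have hw : hW.memLp.toLp W = (1 / 2 : ℝ) • ((hU.memLp.toLp U - s.ritz.mem.memLp.toLp Q) +
      (hU'.memLp.toLp U' - s'.ritz.mem.memLp.toLp Q')) := by
    rw [toLp_combination hθ.memLp hθ'.memLp, toLp_combination hU.memLp s.ritz.mem.memLp,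
      toLp_combination hU'.memLp s'.ritz.mem.memLp]
    module
  have hwy : hW.memLp_deriv.toLp (deriv W) = (1 / 2 : ℝ) •
      ((hU.memLp_deriv.toLp _ - s.ritz.mem.memLp_deriv.toLp _) +
      (hU'.memLp_deriv.toLp _ - s'.ritz.mem.memLp_deriv.toLp _)) := by
    rw [hθ.toLp_deriv_combination hθ' (1 / 2) (1 / 2), hU.toLp_deriv_combination s.ritz.mem,
      hU'.toLp_deriv_combination s'.ritz.mem]
    module
  have hbW := (isPrimitive_b₁ P t).mul hW.isPrimitive
  have hmB : MemLp (fun y => P.b₁ t y * W y) 2 μΩ := hbW.memLp_self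
  have hmz := hbW.memLp
  obtain ⟨hc1, hb1⟩ := convection_bounds hP hγ₀ ht
  -- With `b₁` on the test function, the product `b₁ W` vanishes at the boundary and can be
  -- integrated by parts against the Ritz error.
  have hswap : ∀ g : ℝ → ℝ, ip (fun y => P.b₁ t y * g y) W = ip g (fun y => P.b₁ t y * W y) :=
    fun g => by
      rw [ip, ip]
      congr 1
      funext y
      ring
  -- the two variational identities
  have e1 := heq W (deriv W) hW.memH10
  rw [Problem.VarEq, hswap, ip_eq_inner (Lp.memLp _) hW.memLp, Lp.toLp_coeFn,
    ip_eq_inner hm.memLp hW.memLp_deriv, ip_eq_inner hm.memLp hmB] at e1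
  have e2 := hstep W hW
  have hdq : diffQ δ U U' = fun y => δ⁻¹ * U y + -δ⁻¹ * U' y := by
    funext y
    simp only [diffQ]
    ring
  have hav : avg U U' = fun y => 1 / 2 * U y + 1 / 2 * U' y := by
    funext y
    simp only [avg]
    ring
  have hmav := (hU.combination hU' (1 / 2) (1 / 2)).memLp_deriv
  have hvec1 : δ⁻¹ • hU.memLp.toLp U + -δ⁻¹ • hU'.memLp.toLp U' =
      δ⁻¹ • (hU.memLp.toLp U - hU'.memLp.toLp U') := by module
  rw [Problem.VarEq, hswap, hdq, hav, ip_eq_inner (memLp_combination hU.memLp hU'.memLp _ _)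
    hW.memLp, ip_eq_inner hmav hW.memLp_deriv, ip_eq_inner hmav hmB,
    toLp_combination hU.memLp hU'.memLp, hU.toLp_deriv_combination hU' (1 / 2) (1 / 2), hvec1,
    ← smul_add] at e2
  -- orthogonality of the Ritz projection
  have hr := s.ritz.combination s'.ritz s.prim.memLp s'.prim.memLp (1 / 2) (1 / 2)
  have hfp : IsPrimitive (fun y => 1 / 2 * f 0 y + 1 / 2 * f' 0 y)
      (fun y => 1 / 2 * f 1 y + 1 / 2 * f' 1 y) :=
    (s.prim.const_mul (1 / 2)).add (s'.prim.const_mul (1 / 2))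
  have vf : hfp.memLp_self.toLp _ = (1 / 2 : ℝ) • (v i (a + δ) + v i a) := by
    rw [toLp_combination s.prim.memLp_self s'.prim.memLp_self, s.toLp_eq, s'.toLp_eq, smul_add]
  have vfy : hfp.memLp.toLp _ =
      (1 / 2 : ℝ) • (s.prim.memLp.toLp (f 1) + s'.prim.memLp.toLp (f' 1)) := by
    rw [toLp_combination s.prim.memLp s'.prim.memLp, smul_add]
  have vQ : hr.mem.memLp.toLp _ =
      (1 / 2 : ℝ) • (s.ritz.mem.memLp.toLp Q + s'.ritz.mem.memLp.toLp Q') := by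
    rw [toLp_combination s.ritz.mem.memLp s'.ritz.mem.memLp, smul_add]
  have vQy : hr.mem.memLp_deriv.toLp _ =
      (1 / 2 : ℝ) • (s.ritz.mem.memLp_deriv.toLp _ + s'.ritz.mem.memLp_deriv.toLp _) := by
    rw [s.ritz.mem.toLp_deriv_combination s'.ritz.mem, smul_add]
  have e3 := hr.ip_deriv_eq_zero hk hfp.memLp hW
  rw [ip_sub_left hfp.memLp hr.mem.memLp_deriv hW.memLp_deriv, ip_eq_inner hfp.memLp hW.memLp_deriv,
    ip_eq_inner hr.mem.memLp_deriv hW.memLp_deriv, vfy, vQy] at e3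
  have hp := hr.mem.isPrimitive.sub hfp
  have e4 := hp.ip_eq hbW (by rw [hW.left]; simp) (by rw [hW.right]; simp)
  rw [ip_sub_left hr.mem.memLp hfp.memLp_self hmz, ip_sub_left hr.mem.memLp_deriv hfp.memLp hmB,
    ip_eq_inner hr.mem.memLp hmz, ip_eq_inner hfp.memLp_self hmz,
    ip_eq_inner hr.mem.memLp_deriv hmB, ip_eq_inner hfp.memLp hmB, vf, vfy, vQ, vQy] at e4
  -- bounds of the test functions
  have nB : ‖hmB.toLp _‖ ≤ β * ‖hW.memLp.toLp W‖ := by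
    rw [← nrm_eq_norm hmB, ← nrm_eq_norm hW.memLp]
    refine nrm_le_of_abs_le hmB hW.memLp fun y hy => ?_
    rw [abs_mul]
    exact mul_le_mul_of_nonneg_right (hb1 y (Ioo_subset_Icc_self hy)) (abs_nonneg _)
  have nz : ‖hmz.toLp _‖ ≤ β * (‖hW.memLp.toLp W‖ + ‖hW.memLp_deriv.toLp (deriv W)‖) := by
    have m1 : MemLp (fun y => W y * (deriv P.γ t / P.γ t)) 2 μΩ := hW.memLp.mul_const _
    have m2 : MemLp (fun y => P.b₁ t y * deriv W y) 2 μΩ :=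
      memLp_continuous_mul hW.memLp_deriv (isPrimitive_b₁ P t).continuousOn
    have : hmz.toLp _ = m1.toLp _ + m2.toLp _ := rfl
    rw [this, mul_add]
    refine (norm_add_le _ _).trans (add_le_add ?_ ?_)
    · rw [← nrm_eq_norm m1, ← nrm_eq_norm hW.memLp]
      refine nrm_le_of_abs_le m1 hW.memLp fun y _ => ?_
      rw [abs_mul, mul_comm]
      exact mul_le_mul_of_nonneg_right hc1 (abs_nonneg _)
    · rw [← nrm_eq_norm m2, ← nrm_eq_norm hW.memLp_deriv]
      refine nrm_le_of_abs_le m2 hW.memLp_deriv fun y hy => ?_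
      rw [abs_mul]
      exact mul_le_mul_of_nonneg_right (hb1 y (Ioo_subset_Icc_self hy)) (abs_nonneg _)
  -- consistency
  set ε := (R + K) * η with hε_def
  have hε : 0 ≤ ε := by positivity
  have hRK : ∀ x y : ℝ, 0 ≤ x → 0 ≤ y → x ≤ M.h ^ (k + 1) → y ≤ δ ^ 2 → x * K + y * R ≤ ε := by
    intro x y hx hy hx' hy'
    have t1 := mul_le_mul_of_nonneg_right hx' hK
    have t2 := mul_le_mul_of_nonneg_right hy' hR
    have t3 : 0 ≤ M.h ^ (k + 1) * R := by positivity
    have t4 : 0 ≤ δ ^ 2 * K := by positivity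
    rw [hε_def, hη]
    linarith
  have hRK' : R ≤ K := by rw [hK_def]; nlinarith
  have c1 : ‖vt i t - δ⁻¹ • (s.ritz.mem.memLp.toLp Q - s'.ritz.mem.memLp.toLp Q')‖ ≤ ε := by
    have q1 := HasTimeDeriv.norm_diffQuot_sub_le (h.deriv1 i) (h.deriv2 i) (h.deriv3 i) hR
      (h.bound_vttt i) hδ hIa hIb
    -- The factor `δ⁻¹` cancels the time increment in the bound of `v (a + δ) - v a` by its time
    -- derivative.
    have q2 := s.norm_smul_sub_le s' ξ hk δ⁻¹ hR fun j hj => by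
      refine ((dualBound_sub hT.le (h.deriv1 i) j (h.dualBound_vt i hj) hIa hIb).smul δ⁻¹).mono
        (le_of_eq ?_)
      rw [add_sub_cancel_left, abs_of_pos hδ, abs_of_pos (inv_pos.2 hδ)]
      field_simp
    have q3 := norm_add_le
      (δ⁻¹ • (s.ritz.mem.memLp.toLp Q - s'.ritz.mem.memLp.toLp Q') - δ⁻¹ • (v i (a + δ) - v i a))
      (δ⁻¹ • (v i (a + δ) - v i a) - vt i t)
    rw [sub_add_sub_cancel, norm_sub_rev] at q3
    have q4 := hRK (M.h ^ (k + 1)) (δ ^ 2) hh hδ2 le_rfl le_rfl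
    have q5 := mul_le_mul_of_nonneg_left hRK' hh
    linarith
  have c2 : ‖hm.memLp.toLp uy - (1 / 2 : ℝ) • (s.prim.memLp.toLp (f 1) +
      s'.prim.memLp.toLp (f' 1))‖ ≤ ε := by
    rw [norm_sub_rev, ← vfy, ← nrm_sub_eq hfp.memLp hm.memLp]
    -- The midpoint error of `∂_y v` is read off from dual bounds of orders 0 and 1; this is where
    -- the bound of `∂_y ∂_t² v` enters.
    have q1 := (hfp.sub hup).nrm_deriv_le
      (w := (1 / 2 : ℝ) • (v i (a + δ) + v i a) - v i t) (by
        rw [← vf]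
        filter_upwards [Lp.coeFn_sub (hfp.memLp_self.toLp _) (v i t), hfp.memLp_self.coeFn_toLp,
          hu] with y h1 h2 h3
        rw [h1, Pi.sub_apply, h2, h3]) (mul_nonneg hR hδ2)
      fun j hj => dualBound_avg_sub hT.le (h.deriv1 i) (h.deriv2 i) j hR
        (h.dualBound_vtt i hj) hδ.le hIa hIb
    have q2 := hRK 0 (δ ^ 2) le_rfl hδ2 hh le_rfl
    linarith
  have c3 : ‖(1 / 2 : ℝ) • (s.ritz.mem.memLp.toLp Q + s'.ritz.mem.memLp.toLp Q') -
      (1 / 2 : ℝ) • (v i (a + δ) + v i a)‖ ≤ ε := by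
    have q1 := s.norm_sub_le ξ hk
    have q2 := s'.norm_sub_le ξ hk
    have q3 := norm_add_le (s.ritz.mem.memLp.toLp Q - v i (a + δ))
      (s'.ritz.mem.memLp.toLp Q' - v i a)
    have q4 : (1 / 2 : ℝ) • (s.ritz.mem.memLp.toLp Q + s'.ritz.mem.memLp.toLp Q') -
        (1 / 2 : ℝ) • (v i (a + δ) + v i a) = (1 / 2 : ℝ) • ((s.ritz.mem.memLp.toLp Q -
        v i (a + δ)) + (s'.ritz.mem.memLp.toLp Q' - v i a)) := by module
    rw [q4, norm_smul, Real.norm_of_nonneg (by norm_num)]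
    have q5 := hRK (M.h ^ (k + 1)) 0 hh le_rfl le_rfl hδ2
    linarith
  have huyK : ‖hm.memLp.toLp uy‖ ≤ K := by
    rw [← nrm_eq_norm]
    exact hup.nrm_deriv_le hu hK fun j hj =>
      h.dualBound_v hT hR i (by omega) (Ioo_subset_Icc_self ht)
  -- the coefficients
  have hA := hP.a_bounds i fun j => P.l t (Z j)
  change ma ≤ P.coeff i t Z ∧ P.coeff i t Z ≤ Ma at hA
  have hb2 : P.b₂ t ≤ 1 / γ₀ ^ 2 := by
    rw [Problem.b₂]
    have := hγ.1.le
    gcongr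
  have hb2' : 1 / γ₁ ^ 2 ≤ P.b₂ t := by
    rw [Problem.b₂]
    have := hγ.2.le
    gcongr
  have hb20 : 0 ≤ P.b₂ t := le_trans (by positivity) hb2'
  have hcA : ma / γ₁ ^ 2 ≤ P.coeff i t Z * P.b₂ t := by
    rw [div_eq_mul_one_div]
    exact mul_le_mul hA.1 hb2' (by positivity) (hma.le.trans hA.1)
  have hAC : P.coeff i t Z * P.b₂ t ≤ Ma / γ₀ ^ 2 := by
    rw [div_eq_mul_one_div]
    exact mul_le_mul hA.2 hb2 hb20 ((hma.le.trans hA.1).trans hA.2)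
  have hγd : 0 ≤ γ₁ * d := mul_nonneg hγ₁.le hd0
  have hAd : |(P.coeff i t (fun j => v j t) - P.coeff i t Z) * P.b₂ t| * K ≤
      La * K / γ₀ ^ 2 * (γ₁ * d) := by
    have q1 := coeff_sub_le hP i (t := t) hγd (Z := Z) (Z' := fun j => v j t) fun j =>
      l_sub_le hP hγ₀ (Ioo_subset_Icc_self ht) (hZ j) (Lp.memLp _) (hd j)
    rw [abs_sub_comm] at q1
    rw [abs_mul, abs_of_nonneg hb20]
    calc _ ≤ (La * (γ₁ * d)) * (1 / γ₀ ^ 2) * K :=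
          mul_le_mul_of_nonneg_right (mul_le_mul q1 hb2 hb20 (mul_nonneg La.2 hγd)) hK
      _ = _ := by ring
  have main := energy_step (U := hU.memLp.toLp U) (U' := hU'.memLp.toLp U')
    (Uy := hU.memLp_deriv.toLp _) (Uy' := hU'.memLp_deriv.toLp _)
    (Q := s.ritz.mem.memLp.toLp Q) (Q' := s'.ritz.mem.memLp.toLp Q')
    (f := v i (a + δ)) (f' := v i a) hδ (c := ma / γ₁ ^ 2) (by positivity) hβ hε hw hwy e1 e2
    (by rw [inner_sub_left]; linarith) (by rw [inner_sub_left, inner_sub_left]; linarith)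
    nB nz c1 c2 c3 huyK hcA hAC hAd
  rw [nrm_sub_eq hU.memLp s.ritz.mem.memLp, nrm_sub_eq hU'.memLp s'.ritz.mem.memLp]
  exact main

end Step

/-! ### The error estimate -/

lemma norm_le_of_hNormLE {m : ℕ} {u : L2Ω} {R : ℝ} (h : HNormLE m u R) : ‖u‖ ≤ R := by
  obtain ⟨D, rfl, -, hR⟩ := h
  refine le_trans (Real.le_sqrt_of_sq_le ?_) hR
  exact Finset.single_le_sum (f := fun j => ‖D j‖ ^ 2) (fun i _ => sq_nonneg _)
    (Finset.mem_range.2 (Nat.succ_pos m))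

/-- The factor in the recursion for the sum of the squared errors. -/
noncomputable def sumConst (ne : ℕ) (T γ₀ γ₁ ma Ma αmax γmax R La : ℝ) : ℝ :=
  stepConst T γ₀ γ₁ ma Ma αmax γmax R La *
    (1 + ne * ((12 * γ₁ ^ 2 + 1) * (1 + (R + R * (1 + T)) ^ 2)))

section Final

variable {ne : ℕ} {P : Problem ne} {T γ₀ γ₁ ma Ma αmax γmax R : ℝ} {La : ℝ≥0}
  {v vt vtt vttt : Fin ne → ℝ → L2Ω} {M : Mesh} {k N : ℕ}

lemma stepConst_nonneg (hT : 0 < T) (hγ₀ : 0 < γ₀) (hma : 0 < ma)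
    (hP : P.Admissible T γ₀ γ₁ ma Ma La αmax γmax) :
    0 ≤ stepConst T γ₀ γ₁ ma Ma αmax γmax R La := by
  have hγ := hP.γ_bounds 0 ⟨le_rfl, hT.le⟩
  have : 0 < γ₁ := hγ₀.trans (hγ.1.trans hγ.2)
  exact energyConst_nonneg (by positivity) (by unfold convectionBound; positivity)

lemma sumConst_nonneg (hT : 0 < T) (hγ₀ : 0 < γ₀) (hma : 0 < ma)
    (hP : P.Admissible T γ₀ γ₁ ma Ma La αmax γmax) :
    0 ≤ sumConst ne T γ₀ γ₁ ma Ma αmax γmax R La :=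
  mul_nonneg (stepConst_nonneg hT hγ₀ hma hP) (by positivity)

/-- The energy inequality for one step of the scheme, summed over the equations. -/
lemma scheme_step_sum (hT : 0 < T) (hγ₀ : 0 < γ₀) (hma : 0 < ma) (hR : 0 ≤ R)
    (hP : P.Admissible T γ₀ γ₁ ma Ma La αmax γmax) (hv : P.IsWeakSolution T v vt)
    (h : RegularityBound T k R v vt vtt vttt) (ξ : LagrangePoints M k) (hk : 1 ≤ k)
    {a δ : ℝ} (hδ : 0 < δ) (ha : 0 ≤ a) (hb : a + δ ≤ T) {f f' : Fin ne → ℕ → ℝ → ℝ}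
    {Q Q' : Fin ne → ℝ → ℝ}
    (s : ∀ i, Snapshot M k (R * (1 + T)) (v i (a + δ)) (f i) (Q i))
    (s' : ∀ i, Snapshot M k (R * (1 + T)) (v i a) (f' i) (Q' i))
    {U U' Z : Fin ne → ℝ → ℝ} (hU : ∀ i, MemS M k (U i)) (hU' : ∀ i, MemS M k (U' i))
    (hstep : ∀ i, CNStep P M k δ (a + δ / 2) i Z (U' i) (U i)) {d S H : ℝ} (hd0 : 0 ≤ d)
    (hZ : ∀ j, MemLp (Z j) 2 μΩ)
    (hd : ∀ j, nrm (fun y => Z j y - v j (a + δ / 2) y) ≤ d) (hS : 0 ≤ S)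
    (hH : (M.h ^ (k + 1) + δ ^ 2) ^ 2 ≤ H)
    (hdS : d ^ 2 ≤ 12 * (S + (R + R * (1 + T)) ^ 2 * H)) :
    ∑ i, nrm (fun y => U i y - Q i y) ^ 2 ≤ ∑ i, nrm (fun y => U' i y - Q' i y) ^ 2 +
      δ * sumConst ne T γ₀ γ₁ ma Ma αmax γmax R La *
        (∑ i, nrm (fun y => U i y - Q i y) ^ 2 + ∑ i, nrm (fun y => U' i y - Q' i y) ^ 2 +
          S + H) := by
  have hE : 0 ≤ stepConst T γ₀ γ₁ ma Ma αmax γmax R La := stepConst_nonneg hT hγ₀ hma hP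
  rw [sumConst]
  set E := stepConst T γ₀ γ₁ ma Ma αmax γmax R La
  set ρ := R + R * (1 + T)
  set η := M.h ^ (k + 1) + δ ^ 2
  set A := ∑ i, nrm (fun y => U i y - Q i y) ^ 2
  set B := ∑ i, nrm (fun y => U' i y - Q' i y) ^ 2
  have hA : 0 ≤ A := Finset.sum_nonneg fun _ _ => sq_nonneg _
  have hB : 0 ≤ B := Finset.sum_nonneg fun _ _ => sq_nonneg _
  have hH0 : 0 ≤ H := (sq_nonneg η).trans hH
  have h1 : A ≤ ∑ i, (nrm (fun y => U' i y - Q' i y) ^ 2 + δ * (E *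
      (nrm (fun y => U i y - Q i y) ^ 2 + nrm (fun y => U' i y - Q' i y) ^ 2 +
        ((γ₁ * d) ^ 2 + (ρ * η) ^ 2)))) :=
    Finset.sum_le_sum fun i _ => by
      have := scheme_step hT hγ₀ hma hR hP hv h ξ hk hδ ha hb (s i) (s' i) (hU i) (hU' i)
        (hstep i) hd0 hZ hd
      simpa only [add_assoc] using this
  rw [Finset.sum_add_distrib, ← Finset.mul_sum, ← Finset.mul_sum, Finset.sum_add_distrib,
    Finset.sum_add_distrib, Finset.sum_const, Finset.card_univ, Fintype.card_fin,
    nsmul_eq_mul] at h1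
  refine h1.trans (add_le_add le_rfl ?_)
  rw [mul_assoc, mul_assoc]
  refine mul_le_mul_of_nonneg_left (mul_le_mul_of_nonneg_left ?_ hE) hδ.le
  -- `S` collects the squared errors of the levels in the coefficient. `H` bounds the squared
  -- consistency error and exceeds `η ^ 2` for the predictor only.
  have h2 : (γ₁ * d) ^ 2 + (ρ * η) ^ 2 ≤ ((12 * γ₁ ^ 2 + 1) * (1 + ρ ^ 2)) * (S + H) := by
    have e1 : (γ₁ * d) ^ 2 ≤ γ₁ ^ 2 * (12 * (S + ρ ^ 2 * H)) := by
      rw [mul_pow]; exact mul_le_mul_of_nonneg_left hdS (sq_nonneg _)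
    have e2 : (ρ * η) ^ 2 ≤ ρ ^ 2 * H := by
      rw [mul_pow]; exact mul_le_mul_of_nonneg_left hH (sq_nonneg _)
    have e3 : 0 ≤ γ₁ ^ 2 * ρ ^ 2 * S := by positivity
    have e4 : 0 ≤ γ₁ ^ 2 * H := by positivity
    have e5 : 0 ≤ ρ ^ 2 * S := by positivity
    linarith
  have h3 : (ne : ℝ) * ((γ₁ * d) ^ 2 + (ρ * η) ^ 2) ≤
      ne * (((12 * γ₁ ^ 2 + 1) * (1 + ρ ^ 2)) * (S + H)) :=
    mul_le_mul_of_nonneg_left h2 (Nat.cast_nonneg _)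
  have h4 : 0 ≤ (ne : ℝ) * ((12 * γ₁ ^ 2 + 1) * (1 + ρ ^ 2)) * (A + B) := by positivity
  linarith

/-- The error in the argument of the diffusion coefficients. -/
lemma nrm_combination_sub_le {K : ℝ} (ξ : LagrangePoints M k) (hk : 1 ≤ k) {u₁ u₂ w : L2Ω}
    {f₁ f₂ : ℕ → ℝ → ℝ} {Q₁ Q₂ U₁ U₂ : ℝ → ℝ} (s₁ : Snapshot M k K u₁ f₁ Q₁)
    (s₂ : Snapshot M k K u₂ f₂ Q₂) (h₁ : MemS M k U₁) (h₂ : MemS M k U₂) (a b : ℝ) :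
    nrm (fun y => a * U₁ y + b * U₂ y - w y) ≤
      |a| * (nrm (fun y => U₁ y - Q₁ y) + M.h ^ (k + 1) * K) +
      |b| * (nrm (fun y => U₂ y - Q₂ y) + M.h ^ (k + 1) * K) + ‖a • u₁ + b • u₂ - w‖ := by
  rw [nrm_sub_coe_eq (memLp_combination h₁.memLp h₂.memLp a b), toLp_combination h₁.memLp h₂.memLp,
    nrm_sub_eq h₁.memLp s₁.ritz.mem.memLp, nrm_sub_eq h₂.memLp s₂.ritz.mem.memLp]
  set l₁ := h₁.memLp.toLp U₁
  set l₂ := h₂.memLp.toLp U₂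
  set q₁ := s₁.ritz.mem.memLp.toLp Q₁
  set q₂ := s₂.ritz.mem.memLp.toLp Q₂
  have e : a • l₁ + b • l₂ - w = a • ((l₁ - q₁) + (q₁ - u₁)) + b • ((l₂ - q₂) + (q₂ - u₂)) +
      (a • u₁ + b • u₂ - w) := by module
  have key : ∀ (c : ℝ) (x y : L2Ω) {m : ℝ}, ‖y‖ ≤ m → ‖c • (x + y)‖ ≤ |c| * (‖x‖ + m) := by
    intro c x y m hm
    rw [norm_smul, Real.norm_eq_abs]
    exact mul_le_mul_of_nonneg_left ((norm_add_le _ _).trans (add_le_add le_rfl hm)) (abs_nonneg _)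
  rw [e]
  refine (norm_add_le _ _).trans (add_le_add ((norm_add_le _ _).trans (add_le_add ?_ ?_)) le_rfl)
  · exact key a _ _ (s₁.norm_sub_le ξ hk)
  · exact key b _ _ (s₂.norm_sub_le ξ hk)

lemma le_sqrt_sum {x : Fin ne → ℝ} (j : Fin ne) : x j ≤ √(∑ i, x i ^ 2) :=
  Real.le_sqrt_of_sq_le
    (Finset.single_le_sum (f := fun i => x i ^ 2) (fun _ _ => sq_nonneg _) (Finset.mem_univ j))

/-- The source of the constant 12 in `scheme_step_sum` and `sumConst`. -/
lemma sq_three_le {p q r : ℝ} : (2 * (p + q + r)) ^ 2 ≤ 12 * (p ^ 2 + q ^ 2 + r ^ 2) := by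
  nlinarith [sq_nonneg (p - q), sq_nonneg (p - r), sq_nonneg (q - r)]

/-- The error of the initial values with respect to the Ritz projection. -/
lemma initial_error {K : ℝ} (ξ : LagrangePoints M k) (hk : 1 ≤ k) {u : L2Ω} {u₀ I : ℝ → ℝ}
    {f : ℕ → ℝ → ℝ} {Q : ℝ → ℝ} (s : Snapshot M k K u f Q) (hu : u =ᵐ[μΩ] u₀)
    (hc : ContinuousOn u₀ (Icc 0 1)) (hI : IsInterpolant ξ u₀ I) :
    nrm (fun y => I y - Q y) ≤ 2 * (M.h ^ (k + 1) * K) := by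
  have h1 := hI.nrm_sub_le (f := f) (fun j hj => s.rep.prim j (Nat.lt_succ_of_le hj))
    (eqOn_of_ae_eq hc s.prim.continuousOn (hu.symm.trans s.rep.ae_eq))
  rw [nrm_sub_eq hI.1.memLp s.prim.memLp_self, s.toLp_eq] at h1
  have h2 := h1.trans (mul_le_mul_of_nonneg_left (s.rep.nrm_le _ le_rfl)
    (pow_nonneg M.h_pos.le _))
  have h3 := s.norm_sub_le ξ hk
  rw [norm_sub_rev] at h3
  rw [nrm_sub_eq hI.1.memLp s.ritz.mem.memLp]
  have h4 := norm_add_le (hI.1.memLp.toLp I - u) (u - s.ritz.mem.memLp.toLp Q)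
  rw [sub_add_sub_cancel] at h4
  linarith

/-- The constant in the error estimate. -/
noncomputable def errorConst (ne : ℕ) (T γ₀ γ₁ ma Ma αmax γmax R La : ℝ) : ℝ :=
  √(gronwallConst (ne * (2 * (R * (1 + T))) ^ 2)
    (2 * sumConst ne T γ₀ γ₁ ma Ma αmax γmax R La) T) + R * (1 + T)

/-- The squared errors `V - Q` are summed over the equations, since every coefficient depends on all
components. The square root in `errorConst` comes from returning to one component, and the added `R
* (1 + T)` is the Ritz error. -/
theorem error_estimate (hT : 0 < T) (hγ₀ : 0 < γ₀) (hma : 0 < ma) (hR : 0 ≤ R)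
    (hP : P.Admissible T γ₀ γ₁ ma Ma La αmax γmax) (hv : P.IsWeakSolution T v vt)
    (h : RegularityBound T k R v vt vtt vttt) (ξ : LagrangePoints M k) (hk : 1 ≤ k) {δ : ℝ}
    (hN : 1 ≤ N) (hδN : δ = T / N)
    (hδ0 : δ * (2 * sumConst ne T γ₀ γ₁ ma Ma αmax γmax R La) ≤ 1 / 2)
    {V : ℕ → Fin ne → ℝ → ℝ} {Vp : Fin ne → ℝ → ℝ} (hV : IsLinearisedCN P ξ N δ V Vp) {n : ℕ}
    (hn : n ≤ N) (i : Fin ne) :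
    nrm (fun y => V n i y - v i (n * δ) y) ≤
      errorConst ne T γ₀ γ₁ ma Ma αmax γmax R La * (M.h ^ (k + 1) + δ ^ 2) := by
  have hN0 : (0 : ℝ) < N := by exact_mod_cast hN
  have hδ : 0 < δ := by rw [hδN]; positivity
  have hNT : N * δ = T := by rw [hδN]; field_simp
  have hmem : ∀ n : ℕ, n ≤ N → (n : ℝ) * δ ∈ Icc 0 T := fun n hn => by
    refine ⟨by positivity, ?_⟩
    rw [← hNT]
    exact mul_le_mul_of_nonneg_right (by exact_mod_cast hn) hδ.le
  have hsnap : ∀ (i : Fin ne) (n : ℕ), ∃ f Q, n ≤ N →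
      Snapshot M k (R * (1 + T)) (v i (n * δ)) f Q := by
    intro i n
    by_cases hn : n ≤ N
    · obtain ⟨f, Q, hs⟩ := exists_snapshot hT hR hv h M hk i (hmem n hn)
      exact ⟨f, Q, fun _ => hs⟩
    · exact ⟨fun _ => 0, 0, fun h => absurd h hn⟩
  choose f Q hs using hsnap
  set L := sumConst ne T γ₀ γ₁ ma Ma αmax γmax R La with hL
  have hL0 : 0 ≤ L := sumConst_nonneg hT hγ₀ hma hP
  have hδL : 0 ≤ δ * L := mul_nonneg hδ.le hL0
  set K := R * (1 + T) with hK_def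
  have hK : 0 ≤ K := by positivity
  set η := M.h ^ (k + 1) + δ ^ 2 with hη
  have hh : 0 ≤ M.h ^ (k + 1) := pow_nonneg M.h_pos.le _
  have hδ2 : 0 ≤ δ ^ 2 := sq_nonneg δ
  have hη0 : 0 ≤ η := add_nonneg hh hδ2
  set ρ := R + K with hρ
  have hρ0 : 0 ≤ ρ := add_nonneg hR hK
  have hcons : M.h ^ (k + 1) * K + R * δ ^ 2 ≤ ρ * η := by
    have : 0 ≤ M.h ^ (k + 1) * R := by positivity
    have : 0 ≤ δ ^ 2 * K := by positivity
    rw [hρ, hη]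
    linarith
  have hcons1 : M.h ^ (k + 1) * K ≤ ρ * η := by
    have : 0 ≤ R * δ ^ 2 := by positivity
    linarith
  let e : ℕ → ℝ := fun n => ∑ i, nrm (fun y => V n i y - Q i n y) ^ 2
  let ep : ℝ := ∑ i, nrm (fun y => Vp i y - Q i 1 y) ^ 2
  have he : ∀ n, 0 ≤ e n := fun n => Finset.sum_nonneg fun _ _ => sq_nonneg _
  have hep : 0 ≤ ep := Finset.sum_nonneg fun _ _ => sq_nonneg _
  have hle : ∀ n j, nrm (fun y => V n j y - Q j n y) ≤ √(e n) := fun n j =>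
    le_sqrt_sum (x := fun i => nrm (fun y => V n i y - Q i n y)) j
  have hlep : ∀ j, nrm (fun y => Vp j y - Q j 1 y) ≤ √ep := fun j =>
    le_sqrt_sum (x := fun i => nrm (fun y => Vp i y - Q i 1 y)) j
  have hs0 : ∀ i, Snapshot M k K (v i 0) (f i 0) (Q i 0) := fun i => by
    simpa using hs i 0 (Nat.zero_le _)
  have hs1 : ∀ i, Snapshot M k K (v i (0 + δ)) (f i 1) (Q i 1) := fun i => by
    simpa using hs i 1 hN
  have hδT : δ ≤ T := by simpa using (hmem 1 hN).2
  have h0T : (0 : ℝ) ∈ Icc 0 T := ⟨le_rfl, hT.le⟩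
  have hbT : 0 + δ ∈ Icc 0 T := ⟨by linarith, by linarith⟩
  have hmT : 0 + δ / 2 ∈ Icc 0 T := ⟨by linarith, by linarith⟩
  have ht0 : δ / 2 = 0 + δ / 2 := (zero_add _).symm
  -- initial values
  have init : e 0 ≤ ne * (2 * K) ^ 2 * η ^ 2 := by
    have : e 0 ≤ ∑ _i : Fin ne, (2 * K * η) ^ 2 := by
      refine Finset.sum_le_sum fun i _ => pow_le_pow_left₀ (nrm_nonneg _) ?_ 2
      obtain ⟨dv₀, hv₀⟩ := hP.v₀_mem i
      refine (initial_error ξ hk (hs0 i) (hv.init i) hv₀.cont (hV.init i)).trans ?_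
      have : 0 ≤ K * δ ^ 2 := by positivity
      rw [hη]
      linarith
    rw [Finset.sum_const, Finset.card_univ, Fintype.card_fin, nsmul_eq_mul, mul_pow _ η,
      ← mul_assoc] at this
    exact this
  -- predictor
  have pred : ep ≤ e 0 + δ * (2 * L) * (ep + e 0 + η ^ 2 + δ ^ 2) := by
    have h1 := scheme_step_sum hT hγ₀ hma hR hP hv h ξ hk hδ le_rfl hbT.2 hs1 hs0 hV.mem_pred
      (hV.mem 0 (Nat.zero_le _)) (fun i => by rw [← ht0]; exact hV.predictor i)
      -- The coefficient is taken at time `0` instead of `δ / 2`, an error of first order only;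
      -- hence `ρ * δ` in `d` and `δ ^ 2` in `H`.
      (d := 2 * (√(e 0) + ρ * η + ρ * δ)) (S := e 0) (H := η ^ 2 + δ ^ 2) (by positivity)
      (fun j => (hV.mem 0 (Nat.zero_le _) j).memLp) (fun j => by
        have q1 := nrm_combination_sub_le (w := v j (0 + δ / 2)) ξ hk (hs0 j) (hs0 j)
          (hV.mem 0 (Nat.zero_le _) j) (hV.mem 0 (Nat.zero_le _) j) 1 0
        simp only [one_mul, zero_mul, add_zero, abs_one, abs_zero, one_smul, zero_smul] at q1
        have q2 := HasTimeDeriv.norm_sub_le (h.deriv1 j) (R := R) (by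
          filter_upwards [h.bound_vt j] with t ht using norm_le_of_hNormLE ht) hmT h0T
        have q3 : |0 - (0 + δ / 2)| = δ / 2 := by rw [abs_of_nonpos (by linarith)]; ring
        rw [q3] at q2
        have q4 := hle 0 j
        have q5 := Real.sqrt_nonneg (e 0)
        have q6 : 0 ≤ R * δ := by positivity
        have q7 : 0 ≤ K * δ := by positivity
        have q8 : 0 ≤ ρ * η := by positivity
        have q9 : ρ * δ = R * δ + K * δ := by rw [hρ]; ring
        rw [q9]
        linarith) (he 0) (by linarith) (by
        refine sq_three_le.trans (le_of_eq ?_)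
        rw [Real.sq_sqrt (he 0)]
        ring)
    refine h1.trans (add_le_add le_rfl ?_)
    -- `e 0` occurs twice, as the old level and in `S`; doubling `L` takes care of it, here and in
    -- the next two estimates.
    rw [← hL, mul_assoc δ (2 * L), mul_assoc 2 L, mul_assoc δ L]
    have h2 : 0 ≤ L * (ep + η ^ 2 + δ ^ 2) := by positivity
    refine mul_le_mul_of_nonneg_left ?_ hδ.le
    show L * (ep + e 0 + e 0 + (η ^ 2 + δ ^ 2)) ≤ _
    linarith
  -- corrector
  have corr : e 1 ≤ e 0 + δ * (2 * L) * (e 1 + e 0 + ep + η ^ 2) := by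
    have h1 := scheme_step_sum hT hγ₀ hma hR hP hv h ξ hk hδ le_rfl hbT.2 hs1 hs0 (hV.mem 1 hN)
      (hV.mem 0 (Nat.zero_le _)) (fun i => by rw [← ht0]; exact hV.corrector i)
      -- The average with the predictor is centred at `δ / 2`, so the exact solution contributes a
      -- second order error and the predictor only its distance `√ep` from the Ritz projection.
      (d := 2 * (√ep + √(e 0) + ρ * η)) (S := ep + e 0) (H := η ^ 2) (by positivity)
      (fun j => by
        have := memLp_combination (hV.mem_pred j).memLp (hV.mem 0 (Nat.zero_le _) j).memLp
          (1 / 2) (1 / 2)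
        refine (memLp_congr_ae (Filter.EventuallyEq.of_eq ?_)).1 this
        funext y
        simp only [avg]
        ring) (fun j => by
        have q1 := nrm_combination_sub_le (w := v j (0 + δ / 2)) ξ hk (hs1 j) (hs0 j)
          (hV.mem_pred j) (hV.mem 0 (Nat.zero_le _) j) (1 / 2) (1 / 2)
        have q2 := HasTimeDeriv.norm_avg_sub_le (h.deriv1 j) (h.deriv2 j) hR (h.bound_vtt j)
          hδ.le h0T hbT
        rw [smul_add] at q2
        have q3 : (fun y => avg (Vp j) (V 0 j) y - v j (0 + δ / 2) y) =
            fun y => 1 / 2 * Vp j y + 1 / 2 * V 0 j y - v j (0 + δ / 2) y := by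
          funext y
          simp only [avg]
          ring
        rw [q3]
        rw [abs_of_pos (by norm_num : (0 : ℝ) < 1 / 2)] at q1
        have q4 := hle 0 j
        have q5 := hlep j
        have q6 := Real.sqrt_nonneg (e 0)
        have q7 := Real.sqrt_nonneg ep
        have q8 : 0 ≤ ρ * η := by positivity
        linarith) (add_nonneg hep (he 0)) le_rfl (by
        refine sq_three_le.trans (le_of_eq ?_)
        rw [Real.sq_sqrt (he 0), Real.sq_sqrt hep]
        ring)
    refine h1.trans (add_le_add le_rfl ?_)
    rw [← hL, mul_assoc δ (2 * L), mul_assoc 2 L, mul_assoc δ L]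
    have h2 : 0 ≤ L * (e 1 + ep + η ^ 2) :=
      mul_nonneg hL0 (add_nonneg (add_nonneg (he 1) hep) (sq_nonneg _))
    refine mul_le_mul_of_nonneg_left ?_ hδ.le
    show L * (e 1 + e 0 + (ep + e 0) + η ^ 2) ≤ _
    linarith
  -- the other steps
  have steps : ∀ n, n + 2 ≤ N →
      e (n + 2) ≤ e (n + 1) + δ * (2 * L) * (e (n + 2) + e (n + 1) + e n + η ^ 2) := by
    intro n hn
    have t2 : ((n + 2 : ℕ) : ℝ) * δ = ((n + 1 : ℕ) : ℝ) * δ + δ := by push_cast; ring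
    have t0 : (n : ℝ) * δ = ((n + 1 : ℕ) : ℝ) * δ - δ := by push_cast; ring
    have tm : (((n + 2 : ℕ) : ℝ) - 1 / 2) * δ = ((n + 1 : ℕ) : ℝ) * δ + δ / 2 := by
      push_cast; ring
    have m2 := hmem (n + 2) hn
    have m1 := hmem (n + 1) (by omega)
    have m0 := hmem n (by omega)
    rw [t2] at m2
    rw [t0] at m0
    have s2 : ∀ i, Snapshot M k K (v i (((n + 1 : ℕ) : ℝ) * δ + δ)) (f i (n + 2)) (Q i (n + 2)) :=
      fun i => by rw [← t2]; exact hs i (n + 2) hn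
    have s1 : ∀ i, Snapshot M k K (v i (((n + 1 : ℕ) : ℝ) * δ)) (f i (n + 1)) (Q i (n + 1)) :=
      fun i => hs i (n + 1) (by omega)
    have s0 : ∀ i, Snapshot M k K (v i (((n + 1 : ℕ) : ℝ) * δ - δ)) (f i n) (Q i n) :=
      fun i => by rw [← t0]; exact hs i n (by omega)
    have h1 := scheme_step_sum hT hγ₀ hma hR hP hv h ξ hk hδ m1.1 m2.2 s2 s1 (hV.mem (n + 2) hn)
      (hV.mem (n + 1) (by omega)) (fun i => by
        rw [← tm]
        exact hV.step (n + 2) (by omega) hn i)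
      -- The factor 2 is the sum `3 / 2 + 1 / 2` of the absolute extrapolation weights, by which the
      -- Ritz errors are multiplied.
      (d := 2 * (√(e (n + 1)) + √(e n) + ρ * η)) (S := e (n + 1) + e n) (H := η ^ 2)
      (by positivity)
      (fun j => by
        have := memLp_combination (hV.mem (n + 1) (by omega) j).memLp
          (hV.mem n (by omega) j).memLp (3 / 2) (-(1 / 2))
        refine (memLp_congr_ae (Filter.EventuallyEq.of_eq ?_)).1 this
        funext y
        show _ = 3 / 2 * V (n + 1) j y - 1 / 2 * V n j y
        ring) (fun j => by
        have q1 := nrm_combination_sub_le (w := v j (((n + 1 : ℕ) : ℝ) * δ + δ / 2)) ξ hk (s1 j)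
          (s0 j) (hV.mem (n + 1) (by omega) j) (hV.mem n (by omega) j) (3 / 2) (-(1 / 2))
        have q2 := HasTimeDeriv.norm_extrap_sub_le (h.deriv1 j) (h.deriv2 j) hR (h.bound_vtt j)
          hδ.le m1 m0 ⟨by linarith [m1.1], by linarith [m2.2]⟩
        rw [neg_smul, ← sub_eq_add_neg] at q1
        have q3 : (fun y => extrap (V (n + 1) j) (V n j) y -
            v j (((n + 1 : ℕ) : ℝ) * δ + δ / 2) y) = fun y => 3 / 2 * V (n + 1) j y +
              -(1 / 2) * V n j y - v j (((n + 1 : ℕ) : ℝ) * δ + δ / 2) y := by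
          funext y
          simp only [extrap]
          ring
        have q4 := hle (n + 1) j
        have q5 := hle n j
        have q6 := Real.sqrt_nonneg (e (n + 1))
        have q7 := Real.sqrt_nonneg (e n)
        have q8 : 0 ≤ ρ * η := by positivity
        rw [abs_neg, abs_of_pos (by norm_num : (0 : ℝ) < 1 / 2),
          abs_of_pos (by norm_num : (0 : ℝ) < 3 / 2)] at q1
        refine (le_of_eq (congrArg nrm q3)).trans ?_
        linarith) (add_nonneg (he _) (he _)) le_rfl (by
        refine sq_three_le.trans (le_of_eq ?_)
        rw [Real.sq_sqrt (he _), Real.sq_sqrt (he _)]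
        ring)
    refine h1.trans (add_le_add le_rfl ?_)
    rw [← hL, mul_assoc δ (2 * L), mul_assoc 2 L, mul_assoc δ L]
    have h2 : 0 ≤ L * (e (n + 2) + e n + η ^ 2) :=
      mul_nonneg hL0 (add_nonneg (add_nonneg (he _) (he _)) (sq_nonneg _))
    refine mul_le_mul_of_nonneg_left ?_ hδ.le
    show L * (e (n + 2) + e (n + 1) + (e (n + 1) + e n) + η ^ 2) ≤ _
    linarith
  have main := gronwall he hep hδ (by positivity) hδ0 hNT (by positivity)
    (by rw [hη]; linarith) init pred corr steps hn
  have q1 := (hs i n hn).norm_sub_le ξ hk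
  have q2 := hle n i
  rw [nrm_sub_eq (hV.mem n hn i).memLp (hs i n hn).ritz.mem.memLp] at q2
  rw [nrm_sub_coe_eq (hV.mem n hn i).memLp]
  have q3 := norm_add_le ((hV.mem n hn i).memLp.toLp _ - (hs i n hn).ritz.mem.memLp.toLp _)
    ((hs i n hn).ritz.mem.memLp.toLp _ - v i (n * δ))
  rw [sub_add_sub_cancel] at q3
  have q4 := Real.sqrt_le_sqrt main
  rw [Real.sqrt_mul' _ (sq_nonneg η), Real.sqrt_sq hη0] at q4
  have q5 : 0 ≤ K * δ ^ 2 := by positivity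
  rw [errorConst, ← hL, ← hK_def, add_mul]
  rw [show K * η = K * M.h ^ (k + 1) + K * δ ^ 2 by rw [hη]; ring]
  linarith

end Final

end NonlocalFEM

/-! ### Choice of uniform constants -/

theorem theorem16 (ne : ℕ) (T γ₀ γ₁ ma Ma αmax γmax R : ℝ) (La : NNReal)
    (hT : 0 < T) (hγ₀ : 0 < γ₀) (hma : 0 < ma) :
    ∃ C > (0 : ℝ), ∃ δ₀ > (0 : ℝ),
      ∀ P : Problem ne, P.Admissible T γ₀ γ₁ ma Ma La αmax γmax →
      ∀ v vt : Fin ne → ℝ → L2Ω, P.IsWeakSolution T v vt →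
      ∀ k : ℕ, 1 ≤ k →
      ∀ vtt vttt : Fin ne → ℝ → L2Ω, RegularityBound T k R v vt vtt vttt →
      ∀ (M : Mesh) (ξ : LagrangePoints M k) (N : ℕ) (δ : ℝ),
        1 ≤ N → δ = T / N → δ ≤ δ₀ →
      ∀ (V : ℕ → Fin ne → ℝ → ℝ) (Vp : Fin ne → ℝ → ℝ), IsLinearisedCN P ξ N δ V Vp →
      ∀ n : ℕ, 1 ≤ n → n ≤ N → ∀ i : Fin ne,
        nrm (fun y => V n i y - v i (n * δ) y) ≤ C * (M.h ^ (k + 1) + δ ^ 2) := by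
  set L := sumConst ne T γ₀ γ₁ ma Ma αmax γmax R La with hL
  set E := errorConst ne T γ₀ γ₁ ma Ma αmax γmax R La with hE
  -- Both constants are fixed before any problem is given, when the signs of `R`, `L` and `E` are
  -- unknown; hence the absolute values. The choice of `δ₀` ensures `δ * (2 * L) ≤ 1 / 2`.
  refine ⟨|E| + 1, by positivity, 1 / (4 * |L| + 1), by positivity, ?_⟩
  intro P hP v vt hv k hk vtt vttt h M ξ N δ hN hδN hδ V Vp hV n _ hn i
  have hR : 0 ≤ R := by
    obtain ⟨t, -, ht⟩ := exists_of_ae_Ioo hT (h.bound_vtt i)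
    exact (norm_nonneg _).trans ht
  have hδ0 : 0 < δ := by
    rw [hδN]
    have : (0 : ℝ) < N := by exact_mod_cast hN
    positivity
  have hδL : δ * (2 * L) ≤ 1 / 2 := by
    rw [le_div_iff₀ (by positivity)] at hδ
    have := mul_le_mul_of_nonneg_left (le_abs_self L) hδ0.le
    linarith
  refine (error_estimate hT hγ₀ hma hR hP hv h ξ hk hN hδN hδL hV hn i).trans ?_
  have hη : 0 ≤ M.h ^ (k + 1) + δ ^ 2 := add_nonneg (pow_nonneg M.h_pos.le _) (sq_nonneg δ)
  exact mul_le_mul_of_nonneg_right (by linarith [le_abs_self E]) hη
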